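/- **Corollary 8.1 (projective manifolds).** Let $\mathbb K=\mathbb R$ or $\mathbb C$, let $\lambda\in\mathbb K$, and let $M$ be a smooth (Hausdorff) manifold of dimension $n$ endowed with a flat projective structure, i.e. with an atlas $\mathcal A$ of smooth charts $M\supset U\to\mathbb R^n$ all of whose coordinate changes are, near each point, linear-fractional transformations $$x\mapsto\Big(\frac{w_1}{w_0},\dots,\frac{w_n}{w_0}\Big),\qquad w=g\,(1,x)^{T},\quad g\in \mathrm{GL}(n+1,\mathbb R),\quad w_0\neq0 .$$ An atlas of smooth charts with this property is called projective; it belongs to the given projective structure if its charts are related to those of $\mathcal A$ by coordinate changes of the same kind. Let $\mathcal F_\lambda(M)$ be the space of smooth $\mathbb K$-valued tensor densities of degree $\lambda$ on $M$ (sections of $|\Lambda^nT^*M|^{\otimes\lambda}$), let $\mathcal D_\lambda(M)$ be the space of linear differential operators of finite order $A:\mathcal F_\lambda(M)\to\mathcal F_\lambda(M)$, and let $\mathrm{Pol}(T^*M)$ be the space of smooth $\mathbb K$-valued functions on $T^*M$ that are polynomial on the fibers, of bounded degree. In local coordinates, an operator $A\in\mathcal D_\lambda(M)$ of order at most $N$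 is written, on densities $f\,|dx^1\wedge\dots\wedge dx^n|^\lambda$, as $$A=\sum_{k=0}^{N}a_k^{i_1\dots i_k}\,\partial_{i_1}\cdots\partial_{i_k}$$ with smooth coefficients $a_k^{i_1\dots i_k}$ symmetric in $i_1,\dots,i_k$ (repeated indices are summed over). Put $(\mathrm{div}\,a_k)^{i_1\dots i_{k-1}}=\sum_j\partial_j a_k^{i_1\dots i_{k-1}j}$ and, for $0\le\ell\le k$, $$c^k_\ell=(-1)^{k-\ell}\,\frac{\binom{k}{\ell}\binom{(n+1)\lambda+k-1}{k-\ell}}{\binom{k+\ell+n}{k-\ell}},\qquad \binom{\alpha}{m}=\frac{\alpha(\alpha-1)\cdots(\alpha-m+1)}{m!}.$$ Then the formula $$\sigma_\lambda(A)(x,\xi)=\sum_{\ell=0}^{N}\ \sum_{k=\ell}^{N}c^k_\ell\,\big(\mathrm{div}^{k-\ell}a_k\big)^{i_1\dots i_\ell}(x)\;\xi_{i_1}\cdots\xi_{i_\ell},$$ used in the local coordinates of all charts of all projective atlases belonging to the given projective structure, gives a globally well-defined map on $M$: there is one and only one map $\sigma_\lambda:\mathcal D_\lambda(M)\to\mathrm{Pol}(T^*M)$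 given by this formula in all these charts. It is a symbol map, i.e. a linear bijection such that, for every $A$ of order at most $N$, the function $\sigma_\lambda(A)$ has degree at most $N$ on the fibers and its homogeneous component of degree $N$ is the principal symbol $a_N^{i_1\dots i_N}\xi_{i_1}\cdots\xi_{i_N}$ (in every smooth chart). -/

import Mathlib

open scoped Manifold ContDiff

noncomputable section

namespace ProjectiveSymbol

/-- The model space `ℝⁿ`. -/
abbrev E (n : ℕ) : Type := EuclideanSpace ℝ (Fin n)

/-- Standard basis vector `e_i` of `ℝⁿ`. -/
abbrev stdVec {n : ℕ} (i : Fin n) : E n := EuclideanSpace.single i (1 : ℝ)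

section Local

variable {𝕜 : Type*} [RCLike 𝕜] {n : ℕ}

/-- `|t| ^ μ` for a real number `t ≠ 0` and a real or complex exponent `μ`. -/
def absPow (t : ℝ) (μ : 𝕜) : 𝕜 := NormedSpace.exp (((Real.log |t| : ℝ) : 𝕜) * μ)

/-- The generalized binomial coefficient `α (α - 1) ⋯ (α - m + 1) / m!`. -/
def genBinom (α : 𝕜) (m : ℕ) : 𝕜 :=
  (∏ i ∈ Finset.range m, (α - (i : 𝕜))) / (m.factorial : 𝕜)

/-- The number
`c^k_ℓ = (-1)^(k-ℓ) * binom k ℓ * binom ((n+1)μ+k-1) (k-ℓ) / binom (k+ℓ+n) (k-ℓ)`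
(used for `ℓ ≤ k` only). -/
def symbolConst (n : ℕ) (μ : 𝕜) (k l : ℕ) : 𝕜 :=
  (-1) ^ (k - l) * ((k.choose l : 𝕜) * genBinom (((n : 𝕜) + 1) * μ + (k : 𝕜) - 1) (k - l))
    / ((k + l + n).choose (k - l) : 𝕜)

variable (𝕜 n) in
/-- Families `a_k^{i₁ … i_k}` (`k = 0, 1, 2, …`) of functions on `ℝⁿ`. -/
abbrev TensorFamily : Type _ := (k : ℕ) → (Fin k → Fin n) → E n → 𝕜

/-- On the set `U`, the family consists of components of smooth symmetric contravariant tensor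
fields, and it has no component of degree greater than `N`. -/
structure IsSymmetricOn (N : ℕ) (U : Set (E n)) (a : TensorFamily 𝕜 n) : Prop where
  smooth : ∀ (k : ℕ) (I : Fin k → Fin n), ContDiffOn ℝ ∞ (a k I) U
  symm : ∀ (k : ℕ) (I : Fin k → Fin n) (π : Equiv.Perm (Fin k)), ∀ y ∈ U, a k (I ∘ π) y = a k I y
  degree_le : ∀ k, N < k → ∀ (I : Fin k → Fin n), ∀ y ∈ U, a k I y = 0

/-- The value at `y` of `∑_{k ≤ N} a_k^{i₁ … i_k} ∂_{i₁} ⋯ ∂_{i_k} f`. -/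
def applyOp (N : ℕ) (a : TensorFamily 𝕜 n) (f : E n → 𝕜) (y : E n) : 𝕜 :=
  ∑ k ∈ Finset.range (N + 1), ∑ I : Fin k → Fin n,
    a k I y * iteratedFDeriv ℝ k f y (fun m => stdVec (I m))

/-- The value at `(y, ξ)` of `∑_{k ≤ N} a_k^{i₁ … i_k} ξ_{i₁} ⋯ ξ_{i_k}`. -/
def fiberPoly (N : ℕ) (a : TensorFamily 𝕜 n) (y : E n) (ξ : Fin n → ℝ) : 𝕜 :=
  ∑ k ∈ Finset.range (N + 1), ∑ I : Fin k → Fin n, a k I y * ∏ m, (ξ (I m) : 𝕜)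

/-- The divergence `(div a)_k^{i₁ … i_k} = ∑_j ∂_j a_{k+1}^{i₁ … i_k j}`, applied to all the
homogeneous components of a family at once. -/
def divergence (a : TensorFamily 𝕜 n) : TensorFamily 𝕜 n :=
  fun k I y => ∑ j : Fin n, fderiv ℝ (a (k + 1) (Fin.snoc I j)) y (stdVec j)

/-- The symbol in coordinates. Its component of degree `ℓ` is `∑_{ℓ ≤ k ≤ N} c^k_ℓ div^(k-ℓ) a_k`:
the component of degree `ℓ` of the family `div^(k-ℓ) a` is `div^(k-ℓ)` of `a_k`. -/
def symbolTensor (μ : 𝕜) (N : ℕ) (a : TensorFamily 𝕜 n) : TensorFamily 𝕜 n :=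
  fun l I y => ∑ k ∈ Finset.Icc l N, symbolConst n μ k l * (divergence^[k - l] a) l I y

end Local

section Algebra

variable {𝕜 : Type*} [RCLike 𝕜] {n : ℕ}

/-! Closure properties, needed to see that the spaces below are vector spaces. -/

lemma IsSymmetricOn.zero (U : Set (E n)) :
    IsSymmetricOn 0 U (fun _ _ _ => 0 : TensorFamily 𝕜 n) :=
  ⟨fun _ _ => contDiffOn_const, fun _ _ _ _ _ => rfl, fun _ _ _ _ _ => rfl⟩

lemma IsSymmetricOn.mono {N N' : ℕ} {U : Set (E n)} {a : TensorFamily 𝕜 n}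
    (h : IsSymmetricOn N U a) (hN : N ≤ N') : IsSymmetricOn N' U a :=
  ⟨h.smooth, h.symm, fun k hk => h.degree_le k (hN.trans_lt hk)⟩

lemma IsSymmetricOn.add {N : ℕ} {U : Set (E n)} {a b : TensorFamily 𝕜 n}
    (ha : IsSymmetricOn N U a) (hb : IsSymmetricOn N U b) :
    IsSymmetricOn N U (fun k I y => a k I y + b k I y) := by
  refine ⟨fun k I => (ha.smooth k I).add (hb.smooth k I), fun k I π y hy => ?_,
    fun k hk I y hy => ?_⟩
  · simp only [ha.symm k I π y hy, hb.symm k I π y hy]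
  · simp only [ha.degree_le k hk I y hy, hb.degree_le k hk I y hy, add_zero]

lemma IsSymmetricOn.smul {N : ℕ} {U : Set (E n)} {a : TensorFamily 𝕜 n} (r : 𝕜)
    (ha : IsSymmetricOn N U a) : IsSymmetricOn N U (fun k I y => r * a k I y) := by
  refine ⟨fun k I => contDiffOn_const.mul (ha.smooth k I), fun k I π y hy => ?_,
    fun k hk I y hy => ?_⟩
  · simp only [ha.symm k I π y hy]
  · simp only [ha.degree_le k hk I y hy, mul_zero]

lemma applyOp_mono {N N' : ℕ} {U : Set (E n)} {a : TensorFamily 𝕜 n}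
    (h : IsSymmetricOn N U a) (hN : N ≤ N') (f : E n → 𝕜) {y : E n} (hy : y ∈ U) :
    applyOp N' a f y = applyOp N a f y := by
  symm
  refine Finset.sum_subset (Finset.range_subset_range.2 (by omega)) fun k _ hk => ?_
  refine Finset.sum_eq_zero fun I _ => ?_
  rw [h.degree_le k (by simpa using hk) I y hy, zero_mul]

lemma fiberPoly_mono {N N' : ℕ} {U : Set (E n)} {a : TensorFamily 𝕜 n}
    (h : IsSymmetricOn N U a) (hN : N ≤ N') (ξ : Fin n → ℝ) {y : E n} (hy : y ∈ U) :
    fiberPoly N' a y ξ = fiberPoly N a y ξ := by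
  symm
  refine Finset.sum_subset (Finset.range_subset_range.2 (by omega)) fun k _ hk => ?_
  refine Finset.sum_eq_zero fun I _ => ?_
  rw [h.degree_le k (by simpa using hk) I y hy, zero_mul]

lemma applyOp_add (N : ℕ) (a b : TensorFamily 𝕜 n) (f : E n → 𝕜) (y : E n) :
    applyOp N (fun k I y => a k I y + b k I y) f y = applyOp N a f y + applyOp N b f y := by
  simp only [applyOp, add_mul, Finset.sum_add_distrib]

lemma fiberPoly_add (N : ℕ) (a b : TensorFamily 𝕜 n) (y : E n) (ξ : Fin n → ℝ) :
    fiberPoly N (fun k I y => a k I y + b k I y) y ξ = fiberPoly N a y ξ + fiberPoly N b y ξ := by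
  simp only [fiberPoly, add_mul, Finset.sum_add_distrib]

lemma applyOp_smul (N : ℕ) (r : 𝕜) (a : TensorFamily 𝕜 n) (f : E n → 𝕜) (y : E n) :
    applyOp N (fun k I y => r * a k I y) f y = r * applyOp N a f y := by
  simp only [applyOp, mul_assoc, Finset.mul_sum]

lemma fiberPoly_smul (N : ℕ) (r : 𝕜) (a : TensorFamily 𝕜 n) (y : E n) (ξ : Fin n → ℝ) :
    fiberPoly N (fun k I y => r * a k I y) y ξ = r * fiberPoly N a y ξ := by
  simp only [fiberPoly, mul_assoc, Finset.mul_sum]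

end Algebra

section Manifold

variable {𝕜 : Type*} [RCLike 𝕜] {n : ℕ} {M : Type*} [TopologicalSpace M] [ChartedSpace (E n) M]

variable (n M) in
/-- The charts of the smooth manifold `M`: the maximal smooth atlas. -/
abbrev smoothCharts : Set (OpenPartialHomeomorph M (E n)) :=
  IsManifold.maximalAtlas (𝓡 n) ∞ M

/-- The coordinate frame `∂₁, …, ∂ₙ` of the chart `c` at the point with coordinates `y`. -/
def coordFrame (c : OpenPartialHomeomorph M (E n)) (y : E n) :
    Fin n → TangentSpace (𝓡 n) (c.symm y) :=
  fun i => mfderiv (𝓡 n) (𝓡 n) c.symm y (stdVec i : E n)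

/-- The coordinate differential `dx^i` of the chart `c` at the point `x`. -/
def coordDifferential (c : OpenPartialHomeomorph M (E n)) (x : M) (i : Fin n) :
    TangentSpace (𝓡 n) x →L[ℝ] ℝ :=
  (EuclideanSpace.proj i : E n →L[ℝ] ℝ).comp
    (mfderiv (𝓡 n) (𝓡 n) c x : TangentSpace (𝓡 n) x →L[ℝ] E n)

/-- The covector `∑ i, ξ_i dx^i` at the point `x`. -/
def coordCovector (c : OpenPartialHomeomorph M (E n)) (x : M) (ξ : Fin n → ℝ) :
    TangentSpace (𝓡 n) x →L[ℝ] ℝ :=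
  ∑ i, ξ i • coordDifferential c x i

/-- The component in the chart `c` of a function `φ` of tangent frames. For a density `φ` of
degree `μ`, it is the function `f` such that `φ = f |dx¹ ∧ ⋯ ∧ dxⁿ|^μ` in the chart. -/
def localComponent (c : OpenPartialHomeomorph M (E n))
    (φ : (x : M) → (Fin n → TangentSpace (𝓡 n) x) → 𝕜) (y : E n) : 𝕜 :=
  φ (c.symm y) (coordFrame c y)

variable (n M) in
/-- The space of smooth tensor densities of degree `μ` on `M`. A density is given as a function of
the frames `v` of the tangent spaces which is multiplied by `|det g| ^ μ` when the frame `v` is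
replaced by the frame `v g` (and by convention it is zero on linearly dependent systems). -/
def densities (μ : 𝕜) : Submodule 𝕜 ((x : M) → (Fin n → TangentSpace (𝓡 n) x) → 𝕜) where
  carrier := {φ |
    (∀ (x : M) (v : Fin n → TangentSpace (𝓡 n) x), ¬ LinearIndependent ℝ v → φ x v = 0) ∧
    (∀ (x : M) (v : Fin n → TangentSpace (𝓡 n) x), LinearIndependent ℝ v →
      ∀ g : Matrix (Fin n) (Fin n) ℝ, g.det ≠ 0 →
        φ x (fun j => ∑ i, g i j • v i) = absPow g.det μ * φ x v) ∧
    ∀ c ∈ smoothCharts n M, ContDiffOn ℝ ∞ (localComponent c φ) c.target}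
  add_mem' := by
    rintro φ ψ ⟨h1, h2, h3⟩ ⟨k1, k2, k3⟩
    refine ⟨fun x v hv => ?_, fun x v hv g hg => ?_, fun c hc => (h3 c hc).add (k3 c hc)⟩
    · simp [h1 x v hv, k1 x v hv]
    · simp only [Pi.add_apply, h2 x v hv g hg, k2 x v hv g hg, mul_add]
  zero_mem' :=
    ⟨fun _ _ _ => rfl, fun _ _ _ _ _ => (mul_zero _).symm, fun _ _ => contDiffOn_const⟩
  smul_mem' := by
    rintro r φ ⟨h1, h2, h3⟩
    refine ⟨fun x v hv => ?_, fun x v hv g hg => ?_, fun c hc => contDiffOn_const.mul (h3 c hc)⟩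
    · simp [h1 x v hv]
    · simp only [Pi.smul_apply, h2 x v hv g hg, smul_eq_mul, mul_left_comm]

/-- In the chart `c`, the operator `A` on densities is `∑_{k ≤ N} a_k^{i₁ … i_k} ∂_{i₁} ⋯ ∂_{i_k}`,
with smooth symmetric coefficients. -/
structure HasLocalForm {μ : 𝕜} (c : OpenPartialHomeomorph M (E n))
    (A : Module.End 𝕜 (densities n M μ)) (N : ℕ) (a : TensorFamily 𝕜 n) : Prop where
  isSymmetricOn : IsSymmetricOn N c.target a
  apply_eq : ∀ φ : densities n M μ, ∀ y ∈ c.target,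
    localComponent c (A φ).1 y = applyOp N a (localComponent c φ.1) y

variable (n M) in
/-- The space `𝒟_μ(M)` of linear differential operators (of finite order) on densities of degree
`μ`. -/
def diffOps (μ : 𝕜) : Submodule 𝕜 (Module.End 𝕜 (densities n M μ)) where
  carrier := {A | ∃ N : ℕ, ∀ c ∈ smoothCharts n M, ∃ a, HasLocalForm c A N a}
  add_mem' := by
    rintro A B ⟨N, hA⟩ ⟨N', hB⟩
    refine ⟨max N N', fun c hc => ?_⟩
    obtain ⟨a, ha⟩ := hA c hc
    obtain ⟨b, hb⟩ := hB c hc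
    have ha' := ha.isSymmetricOn.mono (le_max_left N N')
    have hb' := hb.isSymmetricOn.mono (le_max_right N N')
    refine ⟨_, ha'.add hb', fun φ y hy => ?_⟩
    rw [applyOp_add, applyOp_mono ha.isSymmetricOn (le_max_left N N') _ hy,
      applyOp_mono hb.isSymmetricOn (le_max_right N N') _ hy, ← ha.apply_eq φ y hy,
      ← hb.apply_eq φ y hy]
    rfl
  zero_mem' := by
    refine ⟨0, fun c _ => ⟨_, IsSymmetricOn.zero _, fun φ y _ => ?_⟩⟩
    simp [applyOp, localComponent]
  smul_mem' := by
    rintro r A ⟨N, hA⟩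
    refine ⟨N, fun c hc => ?_⟩
    obtain ⟨a, ha⟩ := hA c hc
    refine ⟨_, ha.isSymmetricOn.smul r, fun φ y hy => ?_⟩
    rw [applyOp_smul, ← ha.apply_eq φ y hy]
    rfl

/-- In the chart `c`, the function `P` on the cotangent bundle is the polynomial
`∑_{k ≤ N} b_k^{i₁ … i_k} ξ_{i₁} ⋯ ξ_{i_k}`, with smooth symmetric coefficients. -/
structure HasFiberPoly (c : OpenPartialHomeomorph M (E n))
    (P : (x : M) → (TangentSpace (𝓡 n) x →L[ℝ] ℝ) → 𝕜) (N : ℕ) (b : TensorFamily 𝕜 n) :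
    Prop where
  isSymmetricOn : IsSymmetricOn N c.target b
  apply_eq : ∀ y ∈ c.target, ∀ ξ : Fin n → ℝ,
    P (c.symm y) (coordCovector c (c.symm y) ξ) = fiberPoly N b y ξ

variable (𝕜 n M) in
/-- The space `Pol(T*M)` of smooth functions on the cotangent bundle that are polynomial on the
fibers. -/
def polyFunctions : Submodule 𝕜 ((x : M) → (TangentSpace (𝓡 n) x →L[ℝ] ℝ) → 𝕜) where
  carrier := {P | ∃ N : ℕ, ∀ c ∈ smoothCharts n M, ∃ b, HasFiberPoly c P N b}
  add_mem' := by
    rintro P Q ⟨N, hP⟩ ⟨N', hQ⟩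
    refine ⟨max N N', fun c hc => ?_⟩
    obtain ⟨a, ha⟩ := hP c hc
    obtain ⟨b, hb⟩ := hQ c hc
    have ha' := ha.isSymmetricOn.mono (le_max_left N N')
    have hb' := hb.isSymmetricOn.mono (le_max_right N N')
    refine ⟨_, ha'.add hb', fun y hy ξ => ?_⟩
    rw [fiberPoly_add, fiberPoly_mono ha.isSymmetricOn (le_max_left N N') _ hy,
      fiberPoly_mono hb.isSymmetricOn (le_max_right N N') _ hy, ← ha.apply_eq y hy ξ,
      ← hb.apply_eq y hy ξ]
    rfl
  zero_mem' := by
    refine ⟨0, fun c _ => ⟨_, IsSymmetricOn.zero _, fun y _ ξ => ?_⟩⟩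
    simp [fiberPoly]
  smul_mem' := by
    rintro r P ⟨N, hP⟩
    refine ⟨N, fun c hc => ?_⟩
    obtain ⟨a, ha⟩ := hP c hc
    refine ⟨_, ha.isSymmetricOn.smul r, fun y hy ξ => ?_⟩
    rw [fiberPoly_smul, ← ha.apply_eq y hy ξ]
    rfl

/-- Homogeneous coordinates `g (1, x)` of the image of the point `[1 : x]` of projective space
under an invertible matrix `g`. -/
def homogImage (g : Matrix.GeneralLinearGroup (Fin (n + 1)) ℝ) (x : E n) : Fin (n + 1) → ℝ :=
  (g : Matrix (Fin (n + 1)) (Fin (n + 1)) ℝ).mulVec (Fin.cons 1 x.ofLp)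

/-- The charts `c` and `c'` are projectively related: near each point of the common domain, the
coordinate change from `c` to `c'` is a linear-fractional transformation. -/
def ProjectivelyRelated (c c' : OpenPartialHomeomorph M (E n)) : Prop :=
  ∀ p ∈ c.source ∩ c'.source, ∃ g : Matrix.GeneralLinearGroup (Fin (n + 1)) ℝ,
    ∀ᶠ q in nhds p, homogImage g (c q) 0 ≠ 0 ∧
      ∀ i : Fin n, c' q i = homogImage g (c q) i.succ / homogImage g (c q) 0

variable (n M) in
/-- A projective atlas on the smooth manifold `M`: a covering by smooth charts with
linear-fractional coordinate changes. -/
structure ProjectiveAtlas where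
  charts : Set (OpenPartialHomeomorph M (E n))
  smooth : charts ⊆ smoothCharts n M
  cover : ∀ x : M, ∃ c ∈ charts, x ∈ c.source
  related : ∀ c ∈ charts, ∀ c' ∈ charts, ProjectivelyRelated c c'

/-- Two projective atlases define the same projective structure. -/
def ProjectiveAtlas.Equivalent (𝒜 ℬ : ProjectiveAtlas n M) : Prop :=
  ∀ c ∈ 𝒜.charts, ∀ c' ∈ ℬ.charts, ProjectivelyRelated c c' ∧ ProjectivelyRelated c' c

/-- In the local coordinates of every projective atlas of the given projective structure, the map
`σ` is given by the explicit formula `∑_{ℓ ≤ k} c^k_ℓ div^(k-ℓ)` on the homogeneous components of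
operators. -/
def IsGivenBySymbolFormula {μ : 𝕜} (𝒜 : ProjectiveAtlas n M)
    (σ : diffOps n M μ → polyFunctions 𝕜 n M) : Prop :=
  ∀ ℬ : ProjectiveAtlas n M, 𝒜.Equivalent ℬ → ∀ c ∈ ℬ.charts,
    ∀ (A : diffOps n M μ) (N : ℕ) (a : TensorFamily 𝕜 n), HasLocalForm c A.1 N a →
      HasFiberPoly c (σ A).1 N (symbolTensor μ N a)

/-- A symbol map: a linear bijection from differential operators onto functions on the cotangent
bundle polynomial on the fibers, such that the highest order term of the image of an operator is
its principal symbol. -/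
structure IsSymbolMap {μ : 𝕜} (σ : diffOps n M μ →ₗ[𝕜] polyFunctions 𝕜 n M) : Prop where
  bijective : Function.Bijective σ
  principal : ∀ c ∈ smoothCharts n M, ∀ (A : diffOps n M μ) (N : ℕ) (a : TensorFamily 𝕜 n),
    HasLocalForm c A.1 N a → ∃ b : TensorFamily 𝕜 n, HasFiberPoly c (σ A).1 N b ∧
      ∀ I : Fin N → Fin n, ∀ y ∈ c.target, b N I y = a N I y

end Manifold

end ProjectiveSymbol

end

/-! The heart of the matter is local: the formula must be invariant under one linear-fractional
change of coordinates `ψ` with matrix `g`. By polarization it suffices to treat operators `h v^{i₁}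
⋯ v^{i_k} ∂_{i₁} ⋯ ∂_{i_k}` with a function `h` and a constant vector `v`. Put `q y = (g (1, y))₀`.
The field that `ψ` maps to `v` is `q w`, where `w y = u + b y` is affine with scalar linear part. So
`ψ` maps the line through `y` in the direction `w y` to a line of direction `v`, by a Möbius change
of parameter, and along this line the Jacobian factor of densities is a power with exponent `Λ = (n
+ 1) μ` of the denominator. Differentiating `k` times along the line gives the transformed operator
explicitly (`deriv_mobius`, `iteratedFDeriv_projective`): its component of degree `r` is `opCoeff Λ
k r * b ^ (k - r)` times `q ^ k (h ∘ ψ)` times the `r`-th power of `w`; this is `powFamily`.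

Divergences of such tensors keep this shape, because `∂_w w = b w`, `∂_w q = b q` and `∂_w (h ∘ ψ) =
q⁻¹ (∂_v h) ∘ ψ` (`iterate_divergence_projective`). The component of degree `l` of the symbol is
thus a combination of the derivatives `∂_v^j h` with `j ≤ k - l`. The constants `c^k_l` are such
that for `j < k - l` the coefficient is a multiple of a finite difference of order `D + 1` of a
polynomial of degree `D`, hence zero (`sum_symbolConst_mul_opCoeff`). What survives is `c^k_l
(∂_v^{k-l} h) ∘ ψ` times the `l`-th power of `q w`, which is the pullback of the symbol of the
original operator (`exists_correspondOn_pow`, `exists_correspondOn`).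

An operator determines its coefficients in a chart, as one sees by applying it to densities that are
exponentials near a point (`coeff_eq_of_applyOp_eq`). Therefore the transformed coefficients are the
actual ones, and symbols computed in projectively related charts agree
(`fiberPoly_symbolTensor_transition`). Since `c^l_l = 1`, the formula is triangular in the degree
and is inverted by descending recursion on any open set. This gives injectivity. For surjectivity
the local inverses are glued: local operators with the same symbol agree on overlaps
(`applyOp_transition`).

Smooth charts outside the projective structure need two further facts: an operator depending on
`N`-jets only has a local form of order at most `N` in every chart (`exists_hasLocalForm`), and the
coefficients of highest degree transform as a tensor (`homPoly_transition`). -/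

noncomputable section

namespace ProjectiveSymbol

open Finset

/-! ### Polarization of symmetric tensors -/

/-- Ryser's formula for the sum over all permutations. -/
theorem sum_neg_one_pow_card_prod_sum {R : Type*} [CommRing R] {k : ℕ} (A : Fin k → Fin k → R) :
    ∑ T : Finset (Fin k), (-1) ^ T.card * ∏ m, ∑ j ∈ Tᶜ, A m j =
      ∑ π : Equiv.Perm (Fin k), ∏ m, A m (π m) := by
  classical
  have h1 : ∀ T : Finset (Fin k), ∏ m, ∑ j ∈ Tᶜ, A m j =
      ∑ f : Fin k → Fin k, if T ⊆ (univ.image f)ᶜ then ∏ m, A m (f m) else 0 := by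
    intro T
    rw [prod_univ_sum, ← sum_filter]
    refine sum_congr ?_ fun _ _ => rfl
    ext f
    simp only [Fintype.mem_piFinset, mem_compl, mem_filter, mem_univ, true_and, subset_iff,
      mem_image]
    constructor
    · rintro h x hx ⟨m, rfl⟩
      exact h m hx
    · intro h m hm
      exact h hm ⟨m, rfl⟩
  simp only [h1, mul_sum]
  rw [sum_comm]
  -- For fixed `f`, the signed sum runs over the subsets of the complement of the image of `f`, so
  -- it vanishes unless `f` is onto.
  have h2 : ∀ f : Fin k → Fin k,
      ∑ T : Finset (Fin k), (-1) ^ T.card *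
        (if T ⊆ (univ.image f)ᶜ then ∏ m, A m (f m) else 0) =
      if Function.Bijective f then ∏ m, A m (f m) else 0 := by
    intro f
    have h3 : ∑ T : Finset (Fin k), (-1 : R) ^ T.card *
        (if T ⊆ (univ.image f)ᶜ then ∏ m, A m (f m) else 0) =
        (∑ T ∈ ((univ.image f)ᶜ).powerset, (-1 : R) ^ T.card) * ∏ m, A m (f m) := by
      rw [sum_mul, ← filter_subset_univ, sum_filter]
      refine sum_congr rfl fun T _ => ?_
      split_ifs <;> simp
    have h4 := congrArg (Int.cast : ℤ → R) (sum_powerset_neg_one_pow_card (x := (univ.image f)ᶜ))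
    push_cast at h4
    rw [h3, h4]
    have h5 : (univ.image f)ᶜ = ∅ ↔ Function.Bijective f := by
      rw [compl_eq_empty_iff, ← coe_eq_univ, coe_image, coe_univ, Set.image_univ, Set.range_eq_univ]
      exact Finite.surjective_iff_bijective
    simp only [h5]
    split_ifs <;> simp
  simp only [h2]
  rw [← sum_filter]
  symm
  refine sum_bij (fun π _ => (π : Fin k → Fin k)) (fun π _ => mem_filter.2 ⟨mem_univ _, π.bijective⟩)
    (fun π _ π' _ h => Equiv.ext (congrFun h)) (fun f hf => ?_) fun _ _ => rfl
  simp only [mem_filter, mem_univ, true_and] at hf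
  exact ⟨Equiv.ofBijective f hf, mem_univ _, rfl⟩

section

variable {𝕜 : Type*} [RCLike 𝕜] {n k : ℕ}

/-- The partial sums of the basis vectors `e_{J 0}, …, e_{J (k-1)}`. -/
def polVec (J : Fin k → Fin n) (T : Finset (Fin k)) : E n := ∑ m ∈ Tᶜ, stdVec (J m)

lemma polVec_apply (J : Fin k → Fin n) (T : Finset (Fin k)) (i : Fin n) :
    polVec J T i = ∑ m ∈ Tᶜ, if i = J m then (1 : ℝ) else 0 := by
  simp [polVec, Pi.single_apply]

/-- Ryser's formula for the matrix with entries `1` where `I m = J j` and `0` elsewhere: the product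
along a permutation `π` tests whether `I = J ∘ π`. -/
lemma sum_neg_one_pow_card_prod_polVec (I J : Fin k → Fin n) :
    ∑ T : Finset (Fin k), (-1 : 𝕜) ^ T.card * ∏ m, ((polVec J T (I m) : ℝ) : 𝕜) =
      ∑ π : Equiv.Perm (Fin k), if I = J ∘ π then 1 else 0 := by
  have h := sum_neg_one_pow_card_prod_sum
    (fun m j : Fin k => if I m = J j then (1 : 𝕜) else 0)
  refine Eq.trans (sum_congr rfl fun T _ => ?_) (h.trans (sum_congr rfl fun π _ => ?_))
  · simp only [polVec_apply]
    push_cast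
    refine congrArg _ (prod_congr rfl fun m _ => sum_congr rfl fun j _ => ?_)
    split_ifs <;> simp
  · by_cases hI : I = J ∘ π
    · simp [hI]
    · rw [if_neg hI]
      obtain ⟨m, hm⟩ := Function.ne_iff.1 hI
      exact prod_eq_zero (mem_univ m) (if_neg hm)

/-- A symmetric tensor is a combination of powers of vectors. -/
lemma symm_eq_sum_polVec {a : (Fin k → Fin n) → 𝕜}
    (ha : ∀ (I : Fin k → Fin n) (π : Equiv.Perm (Fin k)), a (I ∘ π) = a I) (I : Fin k → Fin n) :
    a I = ∑ J : Fin k → Fin n, ∑ T : Finset (Fin k),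
      ((-1 : 𝕜) ^ T.card / (k.factorial : 𝕜) * a J) * ∏ m, ((polVec J T (I m) : ℝ) : 𝕜) := by
  have hk : (k.factorial : 𝕜) ≠ 0 := Nat.cast_ne_zero.2 k.factorial_ne_zero
  have h1 : ∀ J : Fin k → Fin n, ∑ T : Finset (Fin k),
      ((-1 : 𝕜) ^ T.card / (k.factorial : 𝕜) * a J) * ∏ m, ((polVec J T (I m) : ℝ) : 𝕜) =
      ∑ π : Equiv.Perm (Fin k), if I ∘ ⇑π⁻¹ = J then a J / (k.factorial : 𝕜) else 0 := by
    intro J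
    have := congrArg (a J / (k.factorial : 𝕜) * ·) (sum_neg_one_pow_card_prod_polVec (𝕜 := 𝕜) I J)
    simp only [mul_sum] at this
    refine Eq.trans (sum_congr rfl fun T _ => by ring) (this.trans (sum_congr rfl fun π _ => ?_))
    have : I = J ∘ π ↔ I ∘ ⇑π⁻¹ = J := by
      constructor
      · rintro rfl
        ext x; simp
      · rintro rfl
        ext x; simp
    simp [this]
  simp only [h1]
  rw [sum_comm]
  simp [ha, Fintype.card_perm]
  field_simp

/-- Dual to the preceding expansion: evaluating the polynomial of a symmetric tensor at the vectors
`polVec J T` isolates one coefficient. This is what makes the polynomial determine the tensor. -/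
lemma sum_symm_mul_polVec {a : (Fin k → Fin n) → 𝕜}
    (ha : ∀ (I : Fin k → Fin n) (π : Equiv.Perm (Fin k)), a (I ∘ π) = a I) (J : Fin k → Fin n) :
    ∑ T : Finset (Fin k), (-1 : 𝕜) ^ T.card *
      ∑ I : Fin k → Fin n, a I * ∏ m, ((polVec J T (I m) : ℝ) : 𝕜) = k.factorial * a J := by
  simp only [mul_sum]
  rw [sum_comm]
  have h1 : ∀ I : Fin k → Fin n, ∑ T : Finset (Fin k), (-1 : 𝕜) ^ T.card *
      (a I * ∏ m, ((polVec J T (I m) : ℝ) : 𝕜)) =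
      ∑ π : Equiv.Perm (Fin k), if I = J ∘ π then a I else 0 := by
    intro I
    have := congrArg (a I * ·) (sum_neg_one_pow_card_prod_polVec (𝕜 := 𝕜) I J)
    simp only [mul_sum] at this
    refine Eq.trans (sum_congr rfl fun T _ => by ring) (this.trans (sum_congr rfl fun π _ => ?_))
    simp
  simp only [h1]
  rw [sum_comm]
  simp [ha, Fintype.card_perm]

/-- A symmetric tensor is determined by the corresponding polynomial. -/
lemma symm_ext {a b : (Fin k → Fin n) → 𝕜}
    (ha : ∀ (I : Fin k → Fin n) (π : Equiv.Perm (Fin k)), a (I ∘ π) = a I)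
    (hb : ∀ (I : Fin k → Fin n) (π : Equiv.Perm (Fin k)), b (I ∘ π) = b I)
    (h : ∀ ξ : Fin n → ℝ, ∑ I : Fin k → Fin n, a I * ∏ m, (ξ (I m) : 𝕜) =
      ∑ I : Fin k → Fin n, b I * ∏ m, (ξ (I m) : 𝕜)) (J : Fin k → Fin n) : a J = b J := by
  have hk : (k.factorial : 𝕜) ≠ 0 := Nat.cast_ne_zero.2 k.factorial_ne_zero
  refine mul_left_cancel₀ hk ?_
  rw [← sum_symm_mul_polVec ha, ← sum_symm_mul_polVec hb]
  exact sum_congr rfl fun T _ => by rw [h (fun i => polVec J T i)]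

/-- The homogeneous components of a polynomial function are determined by the function. -/
lemma homogeneous_ext {N : ℕ} {p q : ℕ → 𝕜}
    (h : ∀ t : ℝ, ∑ k ∈ range (N + 1), (t : 𝕜) ^ k * p k = ∑ k ∈ range (N + 1), (t : 𝕜) ^ k * q k)
    {k : ℕ} (hk : k ≤ N) : p k = q k := by
  -- This polynomial vanishes at all real points, an infinite subset of `𝕜`.
  let P : Polynomial 𝕜 := ∑ k ∈ range (N + 1), Polynomial.monomial k (p k - q k)
  have hP : P = 0 := by
    refine Polynomial.eq_zero_of_infinite_isRoot P ?_
    refine Set.Infinite.mono (s := Set.range ((↑) : ℝ → 𝕜)) ?_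
      (Set.infinite_range_of_injective RCLike.ofReal_injective)
    rintro _ ⟨t, rfl⟩
    have := h t
    simp only [Set.mem_ofPred_eq, Polynomial.IsRoot, P, Polynomial.eval_finsetSum,
      Polynomial.eval_monomial, sub_mul, sum_sub_distrib]
    simp only [mul_comm (_ : 𝕜) ((t : 𝕜) ^ _), this, sub_self]
  have := congrArg (fun Q => Polynomial.coeff Q k) hP
  simp only [P, Polynomial.finsetSum_coeff, Polynomial.coeff_monomial, Polynomial.coeff_zero,
    sum_ite_eq', mem_range, Nat.lt_succ_of_le hk, if_true] at this
  exact sub_eq_zero.1 this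

/-- The homogeneous component of degree `k` of the polynomial `fiberPoly`. -/
def homPoly (a : TensorFamily 𝕜 n) (k : ℕ) (y : E n) (ξ : Fin n → ℝ) : 𝕜 :=
  ∑ I : Fin k → Fin n, a k I y * ∏ m, (ξ (I m) : 𝕜)

lemma homPoly_smul (a : TensorFamily 𝕜 n) (k : ℕ) (y : E n) (ξ : Fin n → ℝ) (t : ℝ) :
    homPoly a k y (t • ξ) = (t : 𝕜) ^ k * homPoly a k y ξ := by
  simp only [homPoly, mul_sum, Pi.smul_apply, smul_eq_mul, RCLike.ofReal_mul, prod_mul_distrib,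
    prod_const, card_univ, Fintype.card_fin]
  exact sum_congr rfl fun I _ => by ring

/-- Both sides are polynomials in the scaling parameter `t`, and the homogeneous components are
their coefficients. -/
lemma homPoly_eq_of_fiberPoly_eq {a b : TensorFamily 𝕜 n} {N : ℕ} {y z : E n}
    {ξ η : Fin n → ℝ} (h : ∀ t : ℝ, fiberPoly N a y (t • ξ) = fiberPoly N b z (t • η))
    {k : ℕ} (hk : k ≤ N) : homPoly a k y ξ = homPoly b k z η := by
  refine homogeneous_ext (N := N) (p := fun k => homPoly a k y ξ) (q := fun k => homPoly b k z η)
    (fun t => ?_) hk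
  simp only [← homPoly_smul]
  exact h t

lemma coeff_eq_of_fiberPoly_eq {a b : TensorFamily 𝕜 n} {N : ℕ} {y : E n} {U : Set (E n)}
    (ha : IsSymmetricOn N U a) (hb : IsSymmetricOn N U b) (hy : y ∈ U)
    (h : ∀ ξ, fiberPoly N a y ξ = fiberPoly N b y ξ) (k : ℕ) (I : Fin k → Fin n) :
    a k I y = b k I y := by
  rcases le_or_gt k N with hk | hk
  · exact symm_ext (a := fun I => a k I y) (b := fun I => b k I y)
      (fun I π => ha.symm k I π y hy) (fun I π => hb.symm k I π y hy)
      (fun ξ => homPoly_eq_of_fiberPoly_eq (fun t => h (t • ξ)) hk) I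
  · rw [ha.degree_le k hk I y hy, hb.degree_le k hk I y hy]

end

/-! ### The combinatorial identity -/

/-- A finite difference of order `D + 1` of a polynomial of degree `D`. -/
lemma sum_neg_one_pow_choose_mul_ascFactorial {R : Type*} [CommRing R] (D c : ℕ) :
    ∑ q ∈ range (D + 2), (-1 : R) ^ q * ((D + 1).choose q : R) * ((c + q).ascFactorial D : R) =
      0 := by
  have h := fwdDiff_iter_eq_sum_shift (1 : ℕ) (fun x => ((c + x).ascFactorial D : ℤ)) (D + 1) 0
  have h0 : (fwdDiff (1 : ℕ))^[D + 1] (fun x => ((c + x).ascFactorial D : ℤ)) 0 = 0 := by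
    have h1 : ∀ P : Polynomial ℤ, P.natDegree < D + 1 →
        (fwdDiff (1 : ℕ))^[D + 1] (fun x : ℕ => P.eval (x : ℤ)) 0 = 0 := by
      intro P hP
      have h2 := congrFun (Polynomial.fwdDiff_iter_eq_zero_of_degree_lt hP) 0
      rw [fwdDiff_iter_eq_sum_shift] at h2 ⊢
      simpa using h2
    -- The rising factorial `(c + x) ⋯ (c + x + D - 1)` is a polynomial of degree `D` in `x`.
    have h3 := h1 ((ascPochhammer ℤ D).comp (Polynomial.X + Polynomial.C (c : ℤ))) (by
      refine lt_of_le_of_lt Polynomial.natDegree_comp_le ?_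
      rw [Polynomial.natDegree_X_add_C, ascPochhammer_natDegree]
      omega)
    convert h3 using 3 with x
    simp only [Polynomial.eval_comp, Polynomial.eval_add, Polynomial.eval_X, Polynomial.eval_C]
    rw [← Nat.cast_add, ← ascPochhammer_eval_cast, add_comm x c,
      ascPochhammer_nat_eq_ascFactorial]
  rw [h0] at h
  have h' := congrArg (Int.cast : ℤ → R) h
  push_cast at h'
  have h2 := congrArg ((-1 : R) ^ (D + 1) * ·) h'
  simp only [mul_zero, mul_sum] at h2
  rw [h2]
  refine sum_congr rfl fun q hq => ?_
  have hq' : q ≤ D + 1 := Nat.lt_succ_iff.1 (mem_range.1 hq)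
  obtain ⟨e, he⟩ := Nat.exists_eq_add_of_le hq'
  have : (-1 : R) ^ (D + 1) * (-1) ^ (D + 1 - q) = (-1) ^ q := by
    rw [he, Nat.add_sub_cancel_left, pow_add, mul_assoc, ← mul_pow]; simp
  rw [← this]
  simp
  ring

section

variable {𝕜 : Type*} [RCLike 𝕜]

/-- The coefficients of the operator `∂ᵏ` on densities in a projective coordinate. -/
def opCoeff (Λ : 𝕜) (k r : ℕ) : 𝕜 := (k.choose r : 𝕜) * ∏ i ∈ Ico r k, (Λ + (i : 𝕜))

lemma opCoeff_zero_zero (Λ : 𝕜) : opCoeff Λ 0 0 = 1 := by simp [opCoeff]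

lemma opCoeff_of_lt (Λ : 𝕜) {k r : ℕ} (h : k < r) : opCoeff Λ k r = 0 := by
  simp [opCoeff, Nat.choose_eq_zero_of_lt h]

lemma opCoeff_succ_zero (Λ : 𝕜) (k : ℕ) :
    opCoeff Λ (k + 1) 0 = (Λ + k) * opCoeff Λ k 0 := by
  simp only [opCoeff, Nat.choose_zero_right, Nat.Ico_zero_eq_range, prod_range_succ]
  ring

/-- This is the recursion produced by one more differentiation in `deriv_mobius`. After removing the
common factors it reduces to `(r + 1) * choose k (r + 1) = (k - r) * choose k r`. -/
lemma opCoeff_succ_succ (Λ : 𝕜) (k r : ℕ) :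
    opCoeff Λ (k + 1) (r + 1) = (Λ + k + (r + 1 : ℕ)) * opCoeff Λ k (r + 1) + opCoeff Λ k r := by
  rcases lt_trichotomy k r with h | rfl | h
  · rw [opCoeff_of_lt Λ (by omega), opCoeff_of_lt Λ (by omega), opCoeff_of_lt Λ h]; simp
  · rw [opCoeff_of_lt Λ (Nat.lt_succ_self k)]
    simp [opCoeff]
  · simp only [opCoeff]
    rw [prod_Ico_succ_top (by omega), prod_eq_prod_Ico_succ_bot h,
      Nat.choose_succ_succ]
    have h1 : ((k.choose (r + 1) : ℕ) : 𝕜) * ((r : 𝕜) + 1) = (k.choose r : 𝕜) * ((k : 𝕜) - r) := by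
      have := Nat.choose_succ_right_eq k r
      have h2 := congrArg (Nat.cast : ℕ → 𝕜) this
      rw [Nat.cast_mul, Nat.cast_mul, Nat.cast_sub h.le] at h2
      push_cast at h2
      exact h2
    push_cast
    linear_combination (-(∏ i ∈ Ico (r + 1) k, (Λ + (i : 𝕜)))) * h1

/-- In this form the numerator fits the product over `Ico (l + i) (l + d)` in `opCoeff`: together
they give a product over `Ico l (l + d)`, which does not depend on `i`. -/
lemma genBinom_eq_prod_Ico (Λ : 𝕜) (l i : ℕ) :
    genBinom (Λ + ((l + i : ℕ) : 𝕜) - 1) i =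
      (∏ s ∈ Ico l (l + i), (Λ + (s : 𝕜))) / (i.factorial : 𝕜) := by
  rw [genBinom, prod_Ico_eq_prod_range, Nat.add_sub_cancel_left, ← prod_range_reflect]
  congr 1
  refine prod_congr rfl fun s hs => ?_
  have h : s + 1 ≤ i := mem_range.1 hs
  rw [Nat.sub_sub, Nat.cast_sub (by omega)]
  push_cast
  ring

/-- The identity behind the projective invariance of the symbol. -/
theorem sum_symbolConst_mul_opCoeff (n : ℕ) (μ : 𝕜) (l d j : ℕ) (hj : j ≤ d) :
    ∑ i ∈ range (d + 1), symbolConst n μ (l + i) l * opCoeff (((n : 𝕜) + 1) * μ) (l + d) (l + i) *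
      ((i.choose j : 𝕜) * ((2 * l + n + d).ascFactorial (i - j) : 𝕜)) =
      if j = d then symbolConst n μ (l + d) l else 0 := by
  set Λ := ((n : 𝕜) + 1) * μ with hΛ
  set Q := ∏ s ∈ Ico l (l + d), (Λ + (s : 𝕜)) with hQ
  set M := 2 * l + n with hM
  have hasc : ∀ c i : ℕ, (((c + 1).ascFactorial i : ℕ) : 𝕜) ≠ 0 := fun c i =>
    Nat.cast_ne_zero.2 (Nat.ascFactorial_pos c i).ne'
  have hsymb : ∀ i, symbolConst n μ (l + i) l = (-1) ^ i * ((l + i).choose l : 𝕜) *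
      (∏ s ∈ Ico l (l + i), (Λ + (s : 𝕜))) / ((M + 1).ascFactorial i : 𝕜) := by
    intro i
    have h1 : l + i + l + n = M + i := by omega
    rw [symbolConst, Nat.add_sub_cancel_left, genBinom_eq_prod_Ico, ← hΛ, h1,
      Nat.ascFactorial_eq_factorial_mul_choose]
    push_cast
    field_simp
  -- All dependence on `Λ` is collected in the common factor `Q`; the rest is a sum of rational
  -- numbers.
  have hterm : ∀ i ∈ range (d + 1), symbolConst n μ (l + i) l * opCoeff Λ (l + d) (l + i) *
      ((i.choose j : 𝕜) * ((M + d).ascFactorial (i - j) : 𝕜)) =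
      (-1) ^ i * Q * ((l + d).choose l : 𝕜) * (d.choose i : 𝕜) * (i.choose j : 𝕜) *
        ((M + d).ascFactorial (i - j) : 𝕜) / ((M + 1).ascFactorial i : 𝕜) := by
    intro i hi
    have hi' : i ≤ d := Nat.lt_succ_iff.1 (mem_range.1 hi)
    have hQ' : (∏ s ∈ Ico l (l + i), (Λ + (s : 𝕜))) * ∏ s ∈ Ico (l + i) (l + d), (Λ + (s : 𝕜)) = Q :=
      prod_Ico_consecutive _ (by omega) (by omega)
    have hc : ((l + d).choose (l + i) : 𝕜) * ((l + i).choose l : 𝕜) =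
        ((l + d).choose l : 𝕜) * (d.choose i : 𝕜) := by
      have := Nat.choose_mul (n := l + d) (k := l + i) (s := l) (by omega)
      simp only [Nat.add_sub_cancel_left] at this
      exact_mod_cast this
    rw [hsymb, opCoeff, ← hQ']
    linear_combination ((-1) ^ i * (∏ s ∈ Ico l (l + i), (Λ + (s : 𝕜))) *
      (∏ s ∈ Ico (l + i) (l + d), (Λ + (s : 𝕜))) * (i.choose j : 𝕜) *
      ((M + d).ascFactorial (i - j) : 𝕜) / ((M + 1).ascFactorial i : 𝕜)) * hc
  rw [sum_congr rfl hterm]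
  split_ifs with hjd
  · subst hjd
    rw [sum_range_succ, sum_eq_zero, hsymb]
    · simp
      ring
    · intro i hi
      simp [Nat.choose_eq_zero_of_lt (mem_range.1 hi)]
  · obtain ⟨D, rfl⟩ : ∃ D, d = j + (D + 1) := ⟨d - j - 1, by omega⟩
    rw [show j + (D + 1) + 1 = j + (D + 2) by ring, sum_range_add, sum_eq_zero, zero_add]
    · set c := M + 1 + j with hc
      have key := sum_neg_one_pow_choose_mul_ascFactorial (R := 𝕜) D c
      have h2 : ∀ q ∈ range (D + 2), (-1 : 𝕜) ^ (j + q) * Q * ((l + (j + (D + 1))).choose l : 𝕜) *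
          ((j + (D + 1)).choose (j + q) : 𝕜) * ((j + q).choose j : 𝕜) *
          ((M + (j + (D + 1))).ascFactorial (j + q - j) : 𝕜) / ((M + 1).ascFactorial (j + q) : 𝕜) =
          ((-1) ^ j * Q * ((l + (j + (D + 1))).choose l : 𝕜) * ((j + (D + 1)).choose j : 𝕜) /
            (((M + 1).ascFactorial j : 𝕜) * (c.ascFactorial D : 𝕜))) *
          ((-1 : 𝕜) ^ q * ((D + 1).choose q : 𝕜) * ((c + q).ascFactorial D : 𝕜)) := by
        intro q hq
        have hq' : q ≤ D + 1 := Nat.lt_succ_iff.1 (mem_range.1 hq)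
        have hch : ((j + (D + 1)).choose (j + q) : 𝕜) * ((j + q).choose j : 𝕜) =
            ((j + (D + 1)).choose j : 𝕜) * ((D + 1).choose q : 𝕜) := by
          have := Nat.choose_mul (n := j + (D + 1)) (k := j + q) (s := j) (by omega)
          simp only [Nat.add_sub_cancel_left] at this
          exact_mod_cast this
        have ha1 : ((M + 1).ascFactorial (j + q) : 𝕜) =
            ((M + 1).ascFactorial j : 𝕜) * (c.ascFactorial q : 𝕜) := by
          rw [← Nat.cast_mul, hc, Nat.ascFactorial_mul_ascFactorial]
        -- Both sides are the rising factorial of length `D + q`. This turns a quotient of rising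
        -- factorials of length `q` into a polynomial of degree `D` in `q`, which the alternating
        -- sum of order `D + 1` kills.
        have ha2 : (c.ascFactorial D : 𝕜) * ((c + D).ascFactorial q : 𝕜) =
            (c.ascFactorial q : 𝕜) * ((c + q).ascFactorial D : 𝕜) := by
          rw [← Nat.cast_mul, ← Nat.cast_mul, Nat.ascFactorial_mul_ascFactorial,
            Nat.ascFactorial_mul_ascFactorial, add_comm]
        have hM' : M + (j + (D + 1)) = c + D := by omega
        have n1 := hasc M j
        have n2 : (c.ascFactorial q : 𝕜) ≠ 0 := by
          rw [show c = (M + j) + 1 by omega]; exact hasc _ _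
        have n3 : (c.ascFactorial D : 𝕜) ≠ 0 := by
          rw [show c = (M + j) + 1 by omega]; exact hasc _ _
        rw [Nat.add_sub_cancel_left, ha1, hM', pow_add, div_eq_iff (mul_ne_zero n1 n2)]
        field_simp
        linear_combination (Q * ((l + (j + (D + 1))).choose l : 𝕜) *
          ((c + D).ascFactorial q : 𝕜) * (c.ascFactorial D : 𝕜)) * hch +
          (Q * ((l + (j + (D + 1))).choose l : 𝕜) *
          ((j + (D + 1)).choose j : 𝕜) * ((D + 1).choose q : 𝕜)) * ha2
      rw [sum_congr rfl h2, ← mul_sum, key, mul_zero]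
    · intro i hi
      simp [Nat.choose_eq_zero_of_lt (mem_range.1 hi)]

end

/-! ### Jets -/

section Jets

variable {𝕜 : Type*} [RCLike 𝕜] {n : ℕ}

lemma two_le_infty : (2 : WithTop ℕ∞) ≤ ∞ := WithTop.coe_le_coe.2 (le_top : (2 : ℕ∞) ≤ ⊤)

/-- The derivatives of `f` at `y` of order less than `p` vanish. -/
def VanishesTo (p : ℕ) (f : E n → 𝕜) (y : E n) : Prop :=
  ∀ i < p, iteratedFDeriv ℝ i f y = 0

lemma VanishesTo.congr {p : ℕ} {f g : E n → 𝕜} {y : E n} (hf : VanishesTo p f y)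
    (h : g =ᶠ[nhds y] f) : VanishesTo p g y :=
  fun i hi => by rw [h.iteratedFDeriv ℝ i |>.eq_of_nhds, hf i hi]

lemma VanishesTo.mono {p q : ℕ} {f : E n → 𝕜} {y : E n} (hf : VanishesTo p f y)
    (h : q ≤ p) : VanishesTo q f y :=
  fun i hi => hf i (hi.trans_le h)

/-- By the Leibniz bound: in every term of a derivative of order below `p + q`, either `f` is
differentiated fewer than `p` times or `g` fewer than `q` times. -/
lemma VanishesTo.mul {p q : ℕ} {f g : E n → 𝕜} {s : Set (E n)} {y : E n} (hs : IsOpen s)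
    (hy : y ∈ s) (hf : ContDiffOn ℝ ∞ f s) (hg : ContDiffOn ℝ ∞ g s)
    (hfy : VanishesTo p f y) (hgy : VanishesTo q g y) :
    VanishesTo (p + q) (fun x => f x * g x) y := by
  intro i hi
  have h := norm_iteratedFDerivWithin_mul_le hf hg hs.uniqueDiffOn hy (n := i)
    (by exact_mod_cast le_top)
  rw [iteratedFDerivWithin_of_isOpen i hs hy] at h
  refine norm_le_zero_iff.1 (h.trans (le_of_eq (sum_eq_zero fun j hj => ?_)))
  rw [iteratedFDerivWithin_of_isOpen _ hs hy, iteratedFDerivWithin_of_isOpen _ hs hy]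
  rcases lt_or_ge j p with hjp | hjp
  · rw [hfy j hjp]; simp
  · rw [hgy (i - j) (by rw [mem_range] at hj; omega)]; simp

lemma VanishesTo.zero (f : E n → 𝕜) (y : E n) : VanishesTo 0 f y := fun i hi => absurd hi (by omega)

lemma VanishesTo.one {f : E n → 𝕜} {y : E n} (h : f y = 0) : VanishesTo 1 f y := by
  intro i hi
  obtain rfl : i = 0 := by omega
  ext v
  simpa using h

lemma VanishesTo.two {f : E n → 𝕜} {y : E n} (h : f y = 0) (h' : fderiv ℝ f y = 0) :
    VanishesTo 2 f y := by
  intro i hi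
  rcases (by omega : i = 0 ∨ i = 1) with rfl | rfl
  · exact VanishesTo.one h 0 (by omega)
  · ext v
    simp [iteratedFDeriv_one_apply, h']

lemma VanishesTo.pow {f : E n → 𝕜} {s : Set (E n)} {y : E n} (hs : IsOpen s)
    (hy : y ∈ s) (hf : ContDiffOn ℝ ∞ f s) (h : f y = 0) (m : ℕ) :
    VanishesTo m (fun x => f x ^ m) y := by
  induction m with
  | zero => exact VanishesTo.zero _ _
  | succ m ih =>
    simp only [pow_succ]
    exact ih.mul hs hy (hf.pow m) hf (VanishesTo.one h)

lemma VanishesTo.comp {p : ℕ} {g : E n → 𝕜} {ψ : E n → E n} {s t : Set (E n)} {y : E n}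
    (hs : IsOpen s) (ht : IsOpen t) (hst : Set.MapsTo ψ s t) (hy : y ∈ s)
    (hg : ContDiffOn ℝ ∞ g t) (hψ : ContDiffOn ℝ ∞ ψ s) (hgy : VanishesTo p g (ψ y)) :
    VanishesTo p (fun x => g (ψ x)) y := by
  intro i hi
  set D : ℝ := 1 + ∑ j ∈ range (i + 1), ‖iteratedFDerivWithin ℝ j ψ s y‖ with hD
  have hD1 : 1 ≤ D := by
    have : 0 ≤ ∑ j ∈ range (i + 1), ‖iteratedFDerivWithin ℝ j ψ s y‖ :=
      sum_nonneg fun _ _ => norm_nonneg _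
    linarith
  -- The estimate for derivatives of a composition is linear in the bound `C` for the derivatives of
  -- `g`, and here `C = 0`. Any `D ≥ 1` bounding the derivatives of `ψ` will do.
  have h := norm_iteratedFDerivWithin_comp_le hg hψ (n := i) (by exact_mod_cast le_top)
    ht.uniqueDiffOn hs.uniqueDiffOn hst hy (C := 0) (D := D)
    (fun j hj => by
      rw [iteratedFDerivWithin_of_isOpen _ ht (hst hy), hgy j (by omega), norm_zero])
    (fun j hj hji => by
      refine le_trans ?_ (le_self_pow₀ hD1 (by omega))
      have := single_le_sum (f := fun j => ‖iteratedFDerivWithin ℝ j ψ s y‖)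
        (fun _ _ => norm_nonneg _) (mem_range.2 (Nat.lt_succ_of_le hji))
      linarith)
  rw [iteratedFDerivWithin_of_isOpen i hs hy] at h
  simp only [mul_zero, zero_mul, norm_le_zero_iff] at h
  exact h

/-! ### Symmetry of iterated derivatives -/

lemma contDiffOn_iteratedFDeriv_apply {f : E n → 𝕜} {s : Set (E n)} (hs : IsOpen s)
    (hf : ContDiffOn ℝ ∞ f s) (k : ℕ) (v : Fin k → E n) :
    ContDiffOn ℝ ∞ (fun x => iteratedFDeriv ℝ k f x v) s := fun x hx =>
  ((ContinuousMultilinearMap.apply ℝ (fun _ : Fin k => E n) 𝕜 v).contDiff.contDiffAt.comp x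
    ((hf.contDiffAt (hs.mem_nhds hx)).iteratedFDeriv_right (i := k) (m := ∞) (by
      exact_mod_cast le_top))).contDiffWithinAt

lemma iteratedFDeriv_succ_apply {f : E n → 𝕜} {s : Set (E n)} (hs : IsOpen s)
    (hf : ContDiffOn ℝ ∞ f s) {k : ℕ} {x : E n} (hx : x ∈ s) (v : Fin (k + 1) → E n) :
    iteratedFDeriv ℝ (k + 1) f x v =
      fderiv ℝ (fun x => iteratedFDeriv ℝ k f x (Fin.tail v)) x (v 0) := by
  have hd : DifferentiableAt ℝ (iteratedFDeriv ℝ k f) x :=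
    ((hf.contDiffAt (hs.mem_nhds hx)).iteratedFDeriv_right (i := k) (m := 1) (by
      exact_mod_cast le_top)).differentiableAt one_ne_zero
  rw [iteratedFDeriv_succ_apply_left]
  have h := ((ContinuousMultilinearMap.apply ℝ (fun _ : Fin k => E n) 𝕜
    (Fin.tail v)).hasFDerivAt.comp x hd.hasFDerivAt).fderiv
  exact (congrArg (fun L => L (v 0)) h).symm

/-- The iterated derivative of a smooth function is symmetric. -/
theorem iteratedFDeriv_comp_perm {f : E n → 𝕜} {s : Set (E n)} (hs : IsOpen s)
    (hf : ContDiffOn ℝ ∞ f s) {k : ℕ} {y : E n} (hy : y ∈ s) (v : Fin k → E n)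
    (π : Equiv.Perm (Fin k)) :
    iteratedFDeriv ℝ k f y (v ∘ π) = iteratedFDeriv ℝ k f y v := by
  induction k generalizing y with
  | zero => exact congrArg _ (Subsingleton.elim _ _)
  | succ k ih =>
    -- Adjacent transpositions suffice. The one exchanging the first two places is the symmetry of
    -- second derivatives; the others fix the first place, and the induction hypothesis applies
    -- under the outermost derivative.
    have hπ : π ∈ Submonoid.closure (Set.range fun i : Fin k => Equiv.swap i.castSucc i.succ) := by
      rw [Equiv.Perm.mclosure_swap_castSucc_succ]
      trivial
    induction hπ using Submonoid.closure_induction generalizing v with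
    | one => rfl
    | mul π π' _ _ h h' => rw [Equiv.Perm.coe_mul, ← Function.comp_assoc, h', h]
    | mem π hπ =>
      obtain ⟨i, rfl⟩ := hπ
      simp only
      cases k with
      | zero => exact i.elim0
      | succ k =>
      refine Fin.cases ?_ (fun i' => ?_) i
      · have h2 : ∀ w : Fin (k + 2) → E n, iteratedFDeriv ℝ (k + 2) f y w =
            fderiv ℝ (fderiv ℝ (fun x => iteratedFDeriv ℝ k f x (Fin.tail (Fin.tail w)))) y
              (w 0) (w 1) := by
          intro w
          set g := fun x => iteratedFDeriv ℝ k f x (Fin.tail (Fin.tail w)) with hg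
          have hgs : ContDiffOn ℝ ∞ g s := contDiffOn_iteratedFDeriv_apply hs hf k _
          have hgd : DifferentiableAt ℝ (fderiv ℝ g) y :=
            ((hgs.contDiffAt (hs.mem_nhds hy)).fderiv_right (m := 1)
              (le_trans (by norm_num) two_le_infty)).differentiableAt one_ne_zero
          rw [iteratedFDeriv_succ_apply hs hf hy]
          have h3 : (fun x => iteratedFDeriv ℝ (k + 1) f x (Fin.tail w)) =ᶠ[nhds y]
              fun x => fderiv ℝ g x (w 1) := by
            filter_upwards [hs.mem_nhds hy] with x hx
            exact iteratedFDeriv_succ_apply hs hf hx _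
          rw [h3.fderiv_eq, fderiv_clm_apply hgd (differentiableAt_const _)]
          simp
        have hgs : ContDiffOn ℝ ∞ (fun x => iteratedFDeriv ℝ k f x (Fin.tail (Fin.tail v))) s :=
          contDiffOn_iteratedFDeriv_apply hs hf k _
        have hsymm := (hgs.contDiffAt (hs.mem_nhds hy)).isSymmSndFDerivAt (by
          rw [minSmoothness_of_isRCLikeNormedField]; exact two_le_infty) (v 0) (v 1)
        rw [h2, h2 v]
        have ht : Fin.tail (Fin.tail (v ∘ ⇑(Equiv.swap (0 : Fin (k + 1)).castSucc
            (0 : Fin (k + 1)).succ))) = Fin.tail (Fin.tail v) := by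
          funext j
          simp only [Fin.tail, Function.comp_apply]
          rw [Equiv.swap_apply_of_ne_of_ne]
          · simp
          · simp [Fin.ext_iff]
        have e0 : (v ∘ ⇑(Equiv.swap (0 : Fin (k + 1)).castSucc (0 : Fin (k + 1)).succ)) 0 = v 1 := by
          simp
        have e1 : (v ∘ ⇑(Equiv.swap (0 : Fin (k + 1)).castSucc (0 : Fin (k + 1)).succ)) 1 = v 0 := by
          simp
        rw [ht, hsymm, e0, e1]
      · rw [iteratedFDeriv_succ_apply hs hf hy, iteratedFDeriv_succ_apply hs hf hy]
        have h0 : (v ∘ ⇑(Equiv.swap i'.succ.castSucc i'.succ.succ)) 0 = v 0 := by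
          simp only [Function.comp_apply]
          rw [Equiv.swap_apply_of_ne_of_ne]
          · simp [Fin.ext_iff]
          · simp [Fin.ext_iff]
        have ht : Fin.tail (v ∘ ⇑(Equiv.swap i'.succ.castSucc i'.succ.succ)) =
            Fin.tail v ∘ ⇑(Equiv.swap i'.castSucc i'.succ) := by
          funext j
          simp only [Fin.tail, Function.comp_apply]
          rw [Fin.castSucc_succ, ← (Fin.succ_injective _).map_swap]
        rw [h0, ht]
        congr 1
        refine Filter.EventuallyEq.fderiv_eq ?_
        filter_upwards [hs.mem_nhds hy] with x hx
        exact ih hx _ _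

/-- The polynomial function defined by a multilinear map. -/
lemma contDiff_multilinear_diag {k : ℕ} (T : (E n) [×k]→L[ℝ] 𝕜) (y : E n) :
    ContDiff ℝ ∞ (fun x => T (fun _ => x - y)) :=
  T.contDiff.comp (contDiff_pi.2 fun _ => contDiff_id.sub contDiff_const)

lemma iteratedFDeriv_multilinear_diag {k : ℕ} (T : (E n) [×k]→L[ℝ] 𝕜) (y : E n) (v : Fin k → E n) :
    iteratedFDeriv ℝ k (fun x => T (fun _ => x - y)) y v =
      ∑ σ : Equiv.Perm (Fin k), T (fun i => v (σ i)) := by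
  have := iteratedFDeriv_comp_sub (𝕜 := ℝ) (f := fun x => T (fun _ => x)) k y
  rw [this]
  exact T.iteratedFDeriv_comp_diagonal _ v

/-- The derivative is a sum over injections of `j` places into `k` slots. For `j < k` a slot is left
that contains the base point `0`; for `j > k` there are no injections. -/
lemma iteratedFDeriv_multilinear_diag_of_ne {k j : ℕ} (hjk : j ≠ k) (T : (E n) [×k]→L[ℝ] 𝕜)
    (y : E n) : iteratedFDeriv ℝ j (fun x => T (fun _ => x - y)) y = 0 := by
  have := iteratedFDeriv_comp_sub (𝕜 := ℝ) (f := fun x => T (fun _ => x)) j y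
  rw [this, sub_self]
  let g : E n →L[ℝ] (Fin k → E n) := ContinuousLinearMap.pi (fun i ↦ ContinuousLinearMap.id ℝ (E n))
  change iteratedFDeriv ℝ j (T ∘ g) 0 = _
  ext v
  rw [ContinuousLinearMap.iteratedFDeriv_comp_right _ T.contDiff _ le_rfl, T.iteratedFDeriv_eq]
  simp only [ContinuousMultilinearMap.iteratedFDeriv,
    ContinuousMultilinearMap.compContinuousLinearMap_apply, _root_.sum_apply,
    ContinuousMultilinearMap.iteratedFDerivComponent_apply, Set.mem_range, Pi.compRightL_apply]
  refine sum_eq_zero fun e _ => ?_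
  rcases lt_or_gt_of_ne hjk with h | h
  · obtain ⟨i, hi⟩ : ∃ i, i ∉ Set.range e := by
      by_contra! hcon
      have := Fintype.card_le_of_surjective e hcon
      simp at this
      omega
    refine T.map_coord_zero i ?_
    rw [dif_neg (by simpa using hi)]
    simp [g]
  · have := Fintype.card_le_of_embedding e
    simp at this
    omega

/-- Taylor's formula. -/
theorem vanishesTo_sub_taylor {f : E n → 𝕜} {s : Set (E n)} (hs : IsOpen s)
    (hf : ContDiffOn ℝ ∞ f s) {y : E n} (hy : y ∈ s) (N : ℕ) :
    VanishesTo (N + 1) (fun x => f x - ∑ k ∈ range (N + 1),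
      ((k.factorial : ℝ)⁻¹ • iteratedFDeriv ℝ k f y) (fun _ => x - y)) y := by
  intro i hi
  have hT : ∀ k, ContDiff ℝ ∞ (fun x => ((k.factorial : ℝ)⁻¹ • iteratedFDeriv ℝ k f y)
      (fun _ => x - y)) := fun k => contDiff_multilinear_diag _ y
  have hle : (i : WithTop ℕ∞) ≤ ∞ := by exact_mod_cast le_top
  ext v
  rw [fun_iteratedFDeriv_sub_apply ((hf.contDiffAt (hs.mem_nhds hy)).of_le hle)
    ((ContDiff.sum fun k _ => hT k).contDiffAt.of_le hle)]
  rw [iteratedFDeriv_fun_sum_apply fun k _ => ((hT k).contDiffAt.of_le hle)]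
  rw [sum_eq_single i (fun k _ hk => iteratedFDeriv_multilinear_diag_of_ne hk.symm _ y)
    (fun h => absurd (mem_range.2 hi) h)]
  have := iteratedFDeriv_multilinear_diag ((i.factorial : ℝ)⁻¹ • iteratedFDeriv ℝ i f y) y v
  rw [_root_.sub_apply, this]
  simp only [_root_.smul_apply, _root_.zero_apply]
  -- By symmetry all `i!` terms of the derivative of the Taylor polynomial are equal, which cancels
  -- the factor `1 / i!`.
  have h2 : ∀ σ : Equiv.Perm (Fin i), iteratedFDeriv ℝ i f y (fun j => v (σ j)) =
    iteratedFDeriv ℝ i f y v := fun σ => iteratedFDeriv_comp_perm hs hf hy v σ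
  have h3 : (i.factorial : ℝ) ≠ 0 := Nat.cast_ne_zero.2 i.factorial_ne_zero
  simp only [h2, sum_const, card_univ, Fintype.card_perm, Fintype.card_fin]
  rw [← Nat.cast_smul_eq_nsmul ℝ, smul_smul, mul_inv_cancel₀ h3, one_smul, sub_self]

/-- The leading derivative of the product of a power of a function vanishing at `y`. -/
theorem iteratedFDeriv_pow_mul {F G : E n → 𝕜} {s : Set (E n)} (hs : IsOpen s)
    (hF : ContDiffOn ℝ ∞ F s) (hG : ContDiffOn ℝ ∞ G s) {y : E n} (hy : y ∈ s) (hFy : F y = 0)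
    (m : ℕ) (v : Fin m → E n) :
    iteratedFDeriv ℝ m (fun x => F x ^ m * G x) y v =
      m.factorial * (∏ i, fderiv ℝ F y (v i)) * G y := by
  set L := fderiv ℝ F y with hL
  -- The model: `F` is replaced by its differential and `G` by its value at `y`. The error vanishes
  -- to order `m + 1`, so it does not affect the `m`-th derivative.
  let T : (E n) [×m]→L[ℝ] 𝕜 := G y •
    (ContinuousMultilinearMap.mkPiAlgebra ℝ (Fin m) 𝕜).compContinuousLinearMap (fun _ => L)
  have hT : ∀ x, T (fun _ => x - y) = L (x - y) ^ m * G y := by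
    intro x
    simp [T, mul_comm]
  have hTs := contDiff_multilinear_diag T y
  have hLs : ContDiffOn ℝ ∞ (fun x => L (x - y)) s :=
    (L.contDiff.comp (contDiff_id.sub contDiff_const)).contDiffOn
  have hdiff : VanishesTo (m + 1) (fun x => F x ^ m * G x - T (fun _ => x - y)) y := by
    have e1 : (fun x => F x ^ m * G x - T (fun _ => x - y)) = fun x =>
        (F x ^ m - L (x - y) ^ m) * G x + L (x - y) ^ m * (G x - G y) := by
      funext x
      rw [hT]
      ring
    -- The difference of powers is `F - L`, of vanishing order two, times a sum of monomials of
    -- degree `m - 1`. The case `m = 0`, where `m - 1` is truncated, is trivial.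
    have h1 : VanishesTo (m + 1) (fun x => F x ^ m - L (x - y) ^ m) y := by
      have h2 : VanishesTo 2 (fun x => F x - L (x - y)) y := by
        refine VanishesTo.two (by simp [hFy]) ?_
        have hd : DifferentiableAt ℝ F y :=
          (hF.contDiffAt (hs.mem_nhds hy)).differentiableAt (by simp)
        have hd2 : HasFDerivAt (fun x => L (x - y)) L y := by
          exact L.hasFDerivAt.comp y ((hasFDerivAt_id y).sub_const y)
        exact (hd.hasFDerivAt.sub hd2).fderiv.trans (sub_self _)
      have h3 : ∀ i ∈ range m, VanishesTo (m - 1) (fun x => F x ^ i * L (x - y) ^ (m - 1 - i)) y := by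
        intro i hi
        have h4 := (VanishesTo.pow hs hy hF hFy i).mul hs hy (hF.pow i) (hLs.pow (m - 1 - i))
          (VanishesTo.pow hs hy hLs (by simp) (m - 1 - i))
        rw [mem_range] at hi
        exact h4.mono (by omega)
      have h5 : VanishesTo (m - 1) (fun x => ∑ i ∈ range m, F x ^ i * L (x - y) ^ (m - 1 - i)) y := by
        intro j hj
        rw [iteratedFDeriv_fun_sum_apply fun i _ => (((hF.pow i).mul
          (hLs.pow (m - 1 - i))).contDiffAt (hs.mem_nhds hy)).of_le (by exact_mod_cast le_top)]
        exact sum_eq_zero fun i hi => h3 i hi j hj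
      rcases Nat.eq_zero_or_pos m with rfl | hm
      · intro i hi
        simp
      · have h6 := h5.mul hs hy (ContDiffOn.sum fun i _ => (hF.pow i).mul (hLs.pow (m - 1 - i)))
          (hF.sub hLs) h2
        refine (h6.mono (by omega)).congr (Filter.Eventually.of_forall fun x => ?_)
        exact (Commute.geom_sum₂_mul (Commute.all _ _) m).symm
    have h7 := h1.mul hs hy ((hF.pow m).sub (hLs.pow m)) hG (VanishesTo.zero G y)
    have h8 := (VanishesTo.pow hs hy hLs (by simp) m).mul hs hy (hLs.pow m)
      (hG.sub contDiffOn_const) (VanishesTo.one (f := fun x => G x - G y) (sub_self _))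
    intro i hi
    have hle : (i : WithTop ℕ∞) ≤ ∞ := by exact_mod_cast le_top
    rw [e1, fun_iteratedFDeriv_add_apply
      (((((hF.pow m).sub (hLs.pow m)).mul hG).contDiffAt (hs.mem_nhds hy)).of_le hle)
      ((((hLs.pow m).mul (hG.sub contDiffOn_const)).contDiffAt (hs.mem_nhds hy)).of_le hle),
      h7 i hi, h8 i hi, add_zero]
  have h := hdiff m (Nat.lt_succ_self m)
  have hle : (m : WithTop ℕ∞) ≤ ∞ := by exact_mod_cast le_top
  rw [fun_iteratedFDeriv_sub_apply
    ((((hF.pow m).mul hG).contDiffAt (hs.mem_nhds hy)).of_le hle)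
    (hTs.contDiffAt.of_le hle), sub_eq_zero] at h
  rw [h, iteratedFDeriv_multilinear_diag]
  have h9 : ∀ σ : Equiv.Perm (Fin m), T (fun i => v (σ i)) = (∏ i, L (v i)) * G y := by
    intro σ
    simp only [T, _root_.smul_apply, ContinuousMultilinearMap.compContinuousLinearMap_apply,
      ContinuousMultilinearMap.mkPiAlgebra_apply, smul_eq_mul]
    rw [Equiv.prod_comp σ (fun i => L (v i)), mul_comm]
  simp only [h9, sum_const, card_univ, Fintype.card_perm, Fintype.card_fin, nsmul_eq_mul]
  ring

lemma contDiff_exp_real : ContDiff ℝ ∞ (NormedSpace.exp : 𝕜 → 𝕜) :=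
  contDiff_iff_contDiffAt.2 fun x => (NormedSpace.exp_analytic (𝕂 := ℝ) x).contDiffAt

/-- Derivatives of an exponential function. -/
lemma iteratedFDeriv_exp (ζ : E n →L[ℝ] 𝕜) (k : ℕ) (y x : E n) (v : Fin k → E n) :
    iteratedFDeriv ℝ k (fun x => NormedSpace.exp (ζ (x - y))) x v =
      (∏ i, ζ (v i)) * NormedSpace.exp (ζ (x - y)) := by
  have hd : ∀ x, HasFDerivAt (fun x => NormedSpace.exp (ζ (x - y)))
      (NormedSpace.exp (ζ (x - y)) • ζ) x := by
    intro x
    have h1 : HasFDerivAt (fun x => ζ (x - y)) ζ x := by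
      exact ζ.hasFDerivAt.comp x ((hasFDerivAt_id x).sub_const y)
    have h2 := ((_root_.hasDerivAt_exp (𝕂 := 𝕜) (x := ζ (x - y))).hasFDerivAt.restrictScalars ℝ).comp x h1
    refine HasFDerivAt.congr_fderiv (f := fun x => NormedSpace.exp (ζ (x - y))) h2 ?_
    ext w
    simp [mul_comm]
  have hs : ContDiff ℝ ∞ (fun x => NormedSpace.exp (ζ (x - y))) :=
    contDiff_exp_real.comp (ζ.contDiff.comp (contDiff_id.sub contDiff_const))
  induction k generalizing x with
  | zero => simp
  | succ k ih =>
    rw [iteratedFDeriv_succ_apply isOpen_univ hs.contDiffOn (Set.mem_univ x)]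
    have : (fun x => iteratedFDeriv ℝ k (fun x => NormedSpace.exp (ζ (x - y))) x (Fin.tail v)) =
        fun x => (∏ i, ζ (Fin.tail v i)) * NormedSpace.exp (ζ (x - y)) := funext fun x => ih x _
    rw [this, ((hd x).const_mul _).fderiv, Fin.prod_univ_succ]
    simp [Fin.tail]
    ring

end Jets

/-! ### Operators in coordinates -/

section Coordinates

variable {𝕜 : Type*} [RCLike 𝕜] {n : ℕ}

lemma sum_smul_stdVec (v : E n) : ∑ i, v i • stdVec i = v := by
  ext j
  simp [Pi.single_apply]

lemma sum_apply_mul_apply_stdVec {F : Type*} [NormedAddCommGroup F] [NormedSpace ℝ F]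
    (L : E n →L[ℝ] F) (v : E n) : L v = ∑ i, v i • L (stdVec i) := by
  conv_lhs => rw [← sum_smul_stdVec v]
  simp

/-- Expansion of a multilinear map in coordinates. -/
lemma multilinear_diag_eq_sum {k : ℕ} (T : (E n) [×k]→L[ℝ] 𝕜) (v : E n) :
    T (fun _ => v) = ∑ I : Fin k → Fin n, (∏ m, ((v (I m) : ℝ) : 𝕜)) * T (fun m => stdVec (I m)) := by
  conv_lhs => rw [← sum_smul_stdVec v]
  rw [T.map_sum]
  refine sum_congr rfl fun I _ => ?_
  rw [T.map_smul_univ, RCLike.real_smul_eq_coe_mul]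
  push_cast
  rfl

/-- The linear form with coefficients `ξ`. -/
def linForm (𝕜 : Type*) [RCLike 𝕜] (ξ : Fin n → ℝ) : E n →L[ℝ] 𝕜 :=
  (RCLike.ofRealCLM : ℝ →L[ℝ] 𝕜).comp (∑ i, ξ i • (EuclideanSpace.proj i : E n →L[ℝ] ℝ))

@[simp] lemma linForm_apply (ξ : Fin n → ℝ) (v : E n) :
    linForm 𝕜 ξ v = ((∑ i, ξ i * v i : ℝ) : 𝕜) := by
  simp [linForm]

lemma linForm_stdVec (ξ : Fin n → ℝ) (i : Fin n) : linForm 𝕜 ξ (stdVec i) = (ξ i : 𝕜) := by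
  simp

/-- Each derivative of the exponential brings down the linear form, and the exponential is `1` at
`y`. The action on these functions therefore recovers all coefficients at `y` at once. -/
lemma applyOp_exp (N : ℕ) (a : TensorFamily 𝕜 n) (ξ : Fin n → ℝ) (y : E n) :
    applyOp N a (fun x => NormedSpace.exp (linForm 𝕜 ξ (x - y))) y = fiberPoly N a y ξ := by
  refine sum_congr rfl fun k _ => sum_congr rfl fun I _ => ?_
  rw [iteratedFDeriv_exp]
  simp only [linForm_stdVec]
  simp

lemma applyOp_congr {N : ℕ} {a : TensorFamily 𝕜 n} {f g : E n → 𝕜} {y : E n}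
    (h : f =ᶠ[nhds y] g) : applyOp N a f y = applyOp N a g y := by
  refine sum_congr rfl fun k _ => sum_congr rfl fun I _ => ?_
  rw [(h.iteratedFDeriv ℝ k).eq_of_nhds]

lemma applyOp_eq_zero {N : ℕ} {a : TensorFamily 𝕜 n} {f : E n → 𝕜} {y : E n}
    (h : VanishesTo (N + 1) f y) : applyOp N a f y = 0 := by
  refine sum_eq_zero fun k hk => sum_eq_zero fun I _ => ?_
  rw [h k (mem_range.1 hk)]
  simp

/-- Terms of order below `m` vanish because `F ^ m` does so to order `m` at `y`, terms of order
above `m` by hypothesis. This isolates the leading homogeneous part of an operator without choosing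
coordinates adapted to `F`. -/
lemma applyOp_pow_mul {N m : ℕ} {a : TensorFamily 𝕜 n} {F G : E n → 𝕜} {s : Set (E n)}
    (hs : IsOpen s) (hF : ContDiffOn ℝ ∞ F s) (hG : ContDiffOn ℝ ∞ G s) {y : E n} (hy : y ∈ s)
    (hFy : F y = 0) (hm : m ≤ N) (ha : ∀ k, m < k → k ≤ N → ∀ I : Fin k → Fin n, a k I y = 0)
    {ξ : Fin n → ℝ} (hξ : ∀ i, fderiv ℝ F y (stdVec i) = (ξ i : 𝕜)) :
    applyOp N a (fun x => F x ^ m * G x) y = m.factorial * homPoly a m y ξ * G y := by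
  rw [applyOp, sum_eq_single m]
  · rw [homPoly, mul_sum, sum_mul]
    refine sum_congr rfl fun I _ => ?_
    rw [iteratedFDeriv_pow_mul hs hF hG hy hFy]
    simp only [hξ]
    ring
  · intro k hk hkm
    refine sum_eq_zero fun I _ => ?_
    rcases lt_or_gt_of_ne hkm with h | h
    · have := (VanishesTo.pow hs hy hF hFy m).mul hs hy (hF.pow m) hG (VanishesTo.zero G y)
      rw [this k h]
      simp
    · rw [ha k h (by rw [mem_range] at hk; omega), zero_mul]
  · intro h
    exact absurd (mem_range.2 (by omega)) h

lemma contDiffOn_applyOp {N : ℕ} {a : TensorFamily 𝕜 n} {f : E n → 𝕜} {s : Set (E n)}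
    (hs : IsOpen s) (ha : ∀ (k : ℕ) (I : Fin k → Fin n), ContDiffOn ℝ ∞ (a k I) s)
    (hf : ContDiffOn ℝ ∞ f s) : ContDiffOn ℝ ∞ (applyOp N a f) s :=
  ContDiffOn.sum fun k _ => ContDiffOn.sum fun I _ =>
    (ha k I).mul (contDiffOn_iteratedFDeriv_apply hs hf k _)

lemma applyOp_add_right {N : ℕ} {a : TensorFamily 𝕜 n} {f g : E n → 𝕜} {s : Set (E n)}
    (hs : IsOpen s) (hf : ContDiffOn ℝ ∞ f s) (hg : ContDiffOn ℝ ∞ g s) {y : E n} (hy : y ∈ s) :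
    applyOp N a (fun x => f x + g x) y = applyOp N a f y + applyOp N a g y := by
  simp only [applyOp, ← sum_add_distrib, ← mul_add]
  refine sum_congr rfl fun k _ => sum_congr rfl fun I _ => ?_
  have hle : (k : WithTop ℕ∞) ≤ ∞ := by exact_mod_cast le_top
  rw [fun_iteratedFDeriv_add_apply ((hf.contDiffAt (hs.mem_nhds hy)).of_le hle)
    ((hg.contDiffAt (hs.mem_nhds hy)).of_le hle)]
  rfl

lemma iteratedFDeriv_const_mul {k : ℕ} {f : E n → 𝕜} {s : Set (E n)}
    (hs : IsOpen s) (hf : ContDiffOn ℝ ∞ f s) {y : E n} (hy : y ∈ s) (r : 𝕜) (v : Fin k → E n) :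
    iteratedFDeriv ℝ k (fun x => r * f x) y v = r * iteratedFDeriv ℝ k f y v := by
  have hle : (k : WithTop ℕ∞) ≤ ∞ := by exact_mod_cast le_top
  have := ContinuousLinearMap.iteratedFDeriv_comp_left (i := k)
    (ContinuousLinearMap.mul ℝ 𝕜 r) (hf.contDiffAt (hs.mem_nhds hy)) hle
  exact congrArg (fun T => T v) this

lemma applyOp_const_mul_right {N : ℕ} {a : TensorFamily 𝕜 n} {f : E n → 𝕜} {s : Set (E n)}
    (hs : IsOpen s) (hf : ContDiffOn ℝ ∞ f s) {y : E n} (hy : y ∈ s) (r : 𝕜) :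
    applyOp N a (fun x => r * f x) y = r * applyOp N a f y := by
  simp only [applyOp, mul_sum]
  refine sum_congr rfl fun k _ => sum_congr rfl fun I _ => ?_
  rw [iteratedFDeriv_const_mul hs hf hy]
  ring

/-! ### Powers of real numbers -/

lemma absPow_one (μ : 𝕜) : absPow 1 μ = 1 := by simp [absPow]

lemma absPow_mul {s t : ℝ} (hs : s ≠ 0) (ht : t ≠ 0) (μ : 𝕜) :
    absPow (s * t) μ = absPow s μ * absPow t μ := by
  rw [absPow, absPow, absPow, ← NormedSpace.exp_add, abs_mul,
    Real.log_mul (abs_ne_zero.2 hs) (abs_ne_zero.2 ht)]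
  push_cast
  rw [add_mul]

lemma absPow_ne_zero (t : ℝ) (μ : 𝕜) : absPow t μ ≠ 0 := by
  intro h
  have h1 : absPow t μ * absPow t (-μ) = 1 := by
    rw [absPow, absPow, ← NormedSpace.exp_add]
    simp
  rw [h, zero_mul] at h1
  exact zero_ne_one h1

lemma contDiffAt_absPow (μ : 𝕜) {t : ℝ} (ht : t ≠ 0) : ContDiffAt ℝ ∞ (fun t => absPow t μ) t := by
  simp only [absPow, Real.log_abs]
  refine contDiff_exp_real.contDiffAt.comp t (ContDiffAt.mul ?_ contDiffAt_const)
  exact (RCLike.ofRealCLM : ℝ →L[ℝ] 𝕜).contDiff.contDiffAt.comp t (Real.contDiffAt_log.2 ht)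

end Coordinates

/-! ### Frames and charts -/

section Charts

variable {n : ℕ} {M : Type*} [TopologicalSpace M]

/-- The domain of the coordinate change from `c` to `c'`. -/
def overlap (c c' : OpenPartialHomeomorph M (E n)) : Set (E n) := c.target ∩ c.symm ⁻¹' c'.source

lemma isOpen_overlap (c c' : OpenPartialHomeomorph M (E n)) : IsOpen (overlap c c') :=
  c.isOpen_inter_preimage_symm c'.open_source

/-- The coordinate change from `c` to `c'`. -/
def transition (c c' : OpenPartialHomeomorph M (E n)) (y : E n) : E n := c' (c.symm y)

lemma symm_transition {c c' : OpenPartialHomeomorph M (E n)} {y : E n} (hy : y ∈ overlap c c') :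
    c'.symm (transition c c' y) = c.symm y := c'.left_inv hy.2

lemma transition_mem_overlap {c c' : OpenPartialHomeomorph M (E n)} {y : E n}
    (hy : y ∈ overlap c c') : transition c c' y ∈ overlap c' c := by
  refine ⟨c'.map_source hy.2, ?_⟩
  rw [Set.mem_preimage, symm_transition hy]
  exact c.map_target hy.1

lemma transition_transition {c c' : OpenPartialHomeomorph M (E n)} {y : E n}
    (hy : y ∈ overlap c c') : transition c' c (transition c c' y) = y := by
  rw [transition, symm_transition hy]
  exact c.right_inv hy.1

/-- The Jacobian matrix of the coordinate change from `c` to `c'`. -/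
def jac (c c' : OpenPartialHomeomorph M (E n)) (y : E n) : Matrix (Fin n) (Fin n) ℝ :=
  Matrix.of fun i j => (fderiv ℝ (transition c c') y (stdVec j)) i

variable [ChartedSpace (E n) M]

/-- The derivative of a chart. -/
def dChart (c : OpenPartialHomeomorph M (E n)) (x : M) : E n →L[ℝ] E n :=
  mfderiv (𝓡 n) (𝓡 n) c x

/-- The derivative of the inverse of a chart. -/
def dSymm (c : OpenPartialHomeomorph M (E n)) (y : E n) : E n →L[ℝ] E n :=
  mfderiv (𝓡 n) (𝓡 n) c.symm y

/-- The components of a frame in a chart. -/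
def frameMatrix (c : OpenPartialHomeomorph M (E n)) (x : M) (v : Fin n → E n) :
    Matrix (Fin n) (Fin n) ℝ :=
  Matrix.of fun i j => (dChart c x (v j)) i

lemma mdifferentiable_of_mem_smoothCharts {c : OpenPartialHomeomorph M (E n)}
    (hc : c ∈ smoothCharts n M) : c.MDifferentiable (𝓡 n) (𝓡 n) :=
  ⟨(contMDiffOn_of_mem_maximalAtlas hc).mdifferentiableOn (by simp),
    (contMDiffOn_symm_of_mem_maximalAtlas hc).mdifferentiableOn (by simp)⟩

lemma dChart_comp_dSymm {c : OpenPartialHomeomorph M (E n)} (hc : c ∈ smoothCharts n M) {y : E n}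
    (hy : y ∈ c.target) : (dChart c (c.symm y)).comp (dSymm c y) = ContinuousLinearMap.id ℝ (E n) :=
  (mdifferentiable_of_mem_smoothCharts hc).comp_symm_deriv hy

lemma dChart_dSymm {c : OpenPartialHomeomorph M (E n)} (hc : c ∈ smoothCharts n M) {y : E n}
    (hy : y ∈ c.target) (v : E n) : dChart c (c.symm y) (dSymm c y v) = v :=
  congrArg (fun L => L v) (dChart_comp_dSymm hc hy)

/-- In finite dimension a one-sided inverse of an endomorphism is two-sided. -/
lemma dSymm_dChart {c : OpenPartialHomeomorph M (E n)} (hc : c ∈ smoothCharts n M) {y : E n}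
    (hy : y ∈ c.target) (v : E n) : dSymm c y (dChart c (c.symm y) v) = v := by
  have h : (dChart c (c.symm y) : E n →ₗ[ℝ] E n) * (dSymm c y : E n →ₗ[ℝ] E n) = 1 :=
    LinearMap.ext fun v => dChart_dSymm hc hy v
  exact congrArg (fun L : E n →ₗ[ℝ] E n => L v) (mul_eq_one_comm.1 h)

lemma contDiffOn_transition {c c' : OpenPartialHomeomorph M (E n)} (hc : c ∈ smoothCharts n M)
    (hc' : c' ∈ smoothCharts n M) : ContDiffOn ℝ ∞ (transition c c') (overlap c c') := by
  rw [← contMDiffOn_iff_contDiffOn]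
  exact (contMDiffOn_of_mem_maximalAtlas hc').comp
    ((contMDiffOn_symm_of_mem_maximalAtlas hc).mono Set.inter_subset_left) Set.inter_subset_right

lemma fderiv_transition {c c' : OpenPartialHomeomorph M (E n)} (hc : c ∈ smoothCharts n M)
    (hc' : c' ∈ smoothCharts n M) {y : E n} (hy : y ∈ overlap c c') :
    fderiv ℝ (transition c c') y = (dChart c' (c.symm y)).comp (dSymm c y) := by
  rw [← mfderiv_eq_fderiv]
  exact mfderiv_comp y ((mdifferentiable_of_mem_smoothCharts hc').mdifferentiableAt hy.2)
    ((mdifferentiable_of_mem_smoothCharts hc).mdifferentiableAt_symm hy.1)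

lemma jac_eq_frameMatrix {c c' : OpenPartialHomeomorph M (E n)} (hc : c ∈ smoothCharts n M)
    (hc' : c' ∈ smoothCharts n M) {y : E n} (hy : y ∈ overlap c c') :
    jac c c' y = frameMatrix c' (c.symm y) (fun j => dSymm c y (stdVec j)) := by
  ext i j
  simp only [jac, frameMatrix, fderiv_transition hc hc' hy]
  rfl

lemma eq_sum_frameMatrix_smul {c : OpenPartialHomeomorph M (E n)} (hc : c ∈ smoothCharts n M)
    {y : E n} (hy : y ∈ c.target) (v : Fin n → E n) (j : Fin n) :
    v j = ∑ i, frameMatrix c (c.symm y) v i j • dSymm c y (stdVec i) := by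
  conv_lhs => rw [← dSymm_dChart hc hy (v j), sum_apply_mul_apply_stdVec]
  rfl

lemma linearIndependent_iff_det_frameMatrix {c : OpenPartialHomeomorph M (E n)}
    (hc : c ∈ smoothCharts n M) {y : E n} (hy : y ∈ c.target) (v : Fin n → E n) :
    LinearIndependent ℝ v ↔ (frameMatrix c (c.symm y) v).det ≠ 0 := by
  have hinj : Function.Injective (dChart c (c.symm y)) :=
    (Function.LeftInverse.injective (g := dSymm c y) (dSymm_dChart hc hy))
  have h1 : LinearIndependent ℝ v ↔ LinearIndependent ℝ (fun j => dChart c (c.symm y) (v j)) :=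
    (LinearMap.linearIndependent_iff (dChart c (c.symm y) : E n →ₗ[ℝ] E n)
      (LinearMap.ker_eq_bot.2 hinj)).symm
  have h2 : LinearIndependent ℝ (fun j => dChart c (c.symm y) (v j)) ↔
      LinearIndependent ℝ (frameMatrix c (c.symm y) v).col :=
    (LinearMap.linearIndependent_iff (EuclideanSpace.equiv (Fin n) ℝ : E n →ₗ[ℝ] (Fin n → ℝ))
      (LinearMap.ker_eq_bot.2 (EuclideanSpace.equiv (Fin n) ℝ).injective)).symm
  rw [h1, h2, Matrix.linearIndependent_cols_iff_isUnit, Matrix.isUnit_iff_isUnit_det,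
    isUnit_iff_ne_zero]

lemma linearIndependent_dSymm {c : OpenPartialHomeomorph M (E n)}
    (hc : c ∈ smoothCharts n M) {y : E n} (hy : y ∈ c.target) :
    LinearIndependent ℝ (fun j => dSymm c y (stdVec j)) := by
  rw [linearIndependent_iff_det_frameMatrix hc hy]
  have : frameMatrix c (c.symm y) (fun j => dSymm c y (stdVec j)) = 1 := by
    ext i j
    simp [frameMatrix, dChart_dSymm hc hy, Matrix.one_apply]
  rw [this]
  simp

lemma det_jac_ne_zero {c c' : OpenPartialHomeomorph M (E n)} (hc : c ∈ smoothCharts n M)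
    (hc' : c' ∈ smoothCharts n M) {y : E n} (hy : y ∈ overlap c c') : (jac c c' y).det ≠ 0 := by
  have h := (linearIndependent_iff_det_frameMatrix hc' (transition_mem_overlap hy).1 _).1
    (linearIndependent_dSymm hc hy.1)
  rwa [symm_transition hy, ← jac_eq_frameMatrix hc hc' hy] at h

lemma contDiffOn_jac {c c' : OpenPartialHomeomorph M (E n)} (hc : c ∈ smoothCharts n M)
    (hc' : c' ∈ smoothCharts n M) (i j : Fin n) :
    ContDiffOn ℝ ∞ (fun y => jac c c' y i j) (overlap c c') := by
  have h := (contDiffOn_transition hc hc').fderiv_of_isOpen (m := ∞) (isOpen_overlap c c') (by simp)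
  exact (EuclideanSpace.proj i : E n →L[ℝ] ℝ).contDiff.comp_contDiffOn (h.clm_apply contDiffOn_const)

lemma contDiffOn_det_jac {c c' : OpenPartialHomeomorph M (E n)} (hc : c ∈ smoothCharts n M)
    (hc' : c' ∈ smoothCharts n M) :
    ContDiffOn ℝ ∞ (fun y => (jac c c' y).det) (overlap c c') := by
  simp only [Matrix.det_apply]
  refine ContDiffOn.sum fun σ _ => ContDiffOn.const_smul _ ?_
  exact contDiffOn_prod fun i _ => contDiffOn_jac hc hc' _ _

lemma contDiffOn_absPow_det_jac {𝕜 : Type*} [RCLike 𝕜] (μ : 𝕜)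
    {c c' : OpenPartialHomeomorph M (E n)} (hc : c ∈ smoothCharts n M)
    (hc' : c' ∈ smoothCharts n M) :
    ContDiffOn ℝ ∞ (fun y => absPow (jac c c' y).det μ) (overlap c c') := fun y hy =>
  ContDiffAt.comp_contDiffWithinAt (g := fun t => absPow t μ) y
    (contDiffAt_absPow μ (det_jac_ne_zero hc hc' hy)) (contDiffOn_det_jac hc hc' y hy)

/-! ### Covectors -/

lemma coordCovector_apply (c : OpenPartialHomeomorph M (E n)) (x : M) (ξ : Fin n → ℝ) (v : E n) :
    (coordCovector c x ξ : E n →L[ℝ] ℝ) v = ∑ i, ξ i * dChart c x v i := by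
  have : (coordCovector c x ξ : E n →L[ℝ] ℝ) =
    ∑ i, ξ i • (EuclideanSpace.proj i : E n →L[ℝ] ℝ).comp (dChart c x) := rfl
  refine (congrArg (fun L : E n →L[ℝ] ℝ => L v) this).trans ?_
  simp

lemma coordCovector_surjective {c : OpenPartialHomeomorph M (E n)} (hc : c ∈ smoothCharts n M)
    {y : E n} (hy : y ∈ c.target) (η : TangentSpace (𝓡 n) (c.symm y) →L[ℝ] ℝ) :
    ∃ ξ, coordCovector c (c.symm y) ξ = η := by
  let η' : E n →L[ℝ] ℝ := η
  refine ⟨fun i => η' (dSymm c y (stdVec i)), ?_⟩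
  refine ContinuousLinearMap.ext (M₁ := E n) fun v => ?_
  refine (coordCovector_apply c (c.symm y) _ v).trans ?_
  change _ = η' v
  conv_rhs => rw [← dSymm_dChart hc hy v]
  rw [← ContinuousLinearMap.comp_apply, sum_apply_mul_apply_stdVec (η'.comp (dSymm c y))]
  exact sum_congr rfl fun i _ => mul_comm _ _

lemma coordCovector_injective {c : OpenPartialHomeomorph M (E n)} (hc : c ∈ smoothCharts n M)
    {y : E n} (hy : y ∈ c.target) : Function.Injective (coordCovector c (c.symm y)) := by
  intro ξ ξ' h
  funext i
  have h1 : (coordCovector c (c.symm y) ξ : E n →L[ℝ] ℝ) (dSymm c y (stdVec i)) =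
    (coordCovector c (c.symm y) ξ' : E n →L[ℝ] ℝ) (dSymm c y (stdVec i)) :=
    congrArg (fun η : E n →L[ℝ] ℝ => η (dSymm c y (stdVec i))) h
  rw [coordCovector_apply, coordCovector_apply] at h1
  simpa [dChart_dSymm hc hy] using h1

lemma coordCovector_transition {c c' : OpenPartialHomeomorph M (E n)} (hc : c ∈ smoothCharts n M)
    (hc' : c' ∈ smoothCharts n M) {y : E n} (hy : y ∈ overlap c c') (ξ' : Fin n → ℝ) :
    coordCovector c' (c.symm y) ξ' =
      coordCovector c (c.symm y) (fun i => ∑ j, ξ' j * jac c c' y j i) := by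
  obtain ⟨ξ, hξ⟩ := coordCovector_surjective hc hy.1 (coordCovector c' (c.symm y) ξ')
  rw [← hξ]
  congr 1
  funext i
  have h1 : (coordCovector c (c.symm y) ξ : E n →L[ℝ] ℝ) (dSymm c y (stdVec i)) =
    (coordCovector c' (c.symm y) ξ' : E n →L[ℝ] ℝ) (dSymm c y (stdVec i)) :=
    congrArg (fun η : E n →L[ℝ] ℝ => η (dSymm c y (stdVec i))) hξ
  rw [coordCovector_apply, coordCovector_apply] at h1
  simp only [dChart_dSymm hc hy.1] at h1
  simp only [jac_eq_frameMatrix hc hc' hy, frameMatrix, Matrix.of_apply]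
  rw [← h1]
  simp

/-! ### Densities -/

variable {𝕜 : Type*} [RCLike 𝕜] {μ : 𝕜}

lemma density_apply_eq {φ : (x : M) → (Fin n → TangentSpace (𝓡 n) x) → 𝕜}
    (hφ : φ ∈ densities n M μ) {c : OpenPartialHomeomorph M (E n)}
    (hc : c ∈ smoothCharts n M) {y : E n} (hy : y ∈ c.target) {v : Fin n → E n}
    (hv : LinearIndependent ℝ v) :
    φ (c.symm y) v = absPow (frameMatrix c (c.symm y) v).det μ * localComponent c φ y := by
  have h := hφ.2.1 (c.symm y) (fun j => dSymm c y (stdVec j)) (linearIndependent_dSymm hc hy)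
    (frameMatrix c (c.symm y) v) ((linearIndependent_iff_det_frameMatrix hc hy v).1 hv)
  have h2 : v = fun j => ∑ i, frameMatrix c (c.symm y) v i j • dSymm c y (stdVec i) :=
    funext fun j => eq_sum_frameMatrix_smul hc hy v j
  exact (congrArg (fun w : Fin n → E n => φ (c.symm y) w) h2).trans h

lemma localComponent_transition {φ : (x : M) → (Fin n → TangentSpace (𝓡 n) x) → 𝕜}
    (hφ : φ ∈ densities n M μ) {c c' : OpenPartialHomeomorph M (E n)}
    (hc : c ∈ smoothCharts n M) (hc' : c' ∈ smoothCharts n M) {y : E n} (hy : y ∈ overlap c c') :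
    localComponent c φ y =
      absPow (jac c c' y).det μ * localComponent c' φ (transition c c' y) := by
  have h := density_apply_eq hφ hc' (transition_mem_overlap hy).1 (v := fun j => dSymm c y (stdVec j))
    (linearIndependent_dSymm hc hy.1)
  rw [symm_transition hy] at h
  rw [jac_eq_frameMatrix hc hc' hy, ← h]
  rfl

/-- At each point a density is determined by its value on one frame, so one chart per point
suffices, and only the component at that point. -/
lemma density_eq_of_localComponent_eq {φ φ' : (x : M) → (Fin n → TangentSpace (𝓡 n) x) → 𝕜}
    (hφ : φ ∈ densities n M μ) (hφ' : φ' ∈ densities n M μ)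
    (h : ∀ x : M, ∃ c ∈ smoothCharts n M, x ∈ c.source ∧
      localComponent c φ (c x) = localComponent c φ' (c x)) : φ = φ' := by
  funext x v
  obtain ⟨c, hc, hx, h⟩ := h x
  obtain ⟨y, hy, rfl⟩ : ∃ y ∈ c.target, c.symm y = x := ⟨c x, c.map_source hx, c.left_inv hx⟩
  rw [c.right_inv hy] at h
  by_cases hv : LinearIndependent ℝ (v : Fin n → E n)
  · exact ((density_apply_eq hφ hc hy hv).trans (by rw [h])).trans
      (density_apply_eq hφ' hc hy hv).symm
  · exact (hφ.1 _ _ hv).trans (hφ'.1 _ _ hv).symm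

/-- A system of functions of tangent frames given by local components. -/
def ofLocal (μ : 𝕜) (c : M → OpenPartialHomeomorph M (E n)) (f : M → 𝕜) :
    (x : M) → (Fin n → TangentSpace (𝓡 n) x) → 𝕜 := by
  classical
  exact fun x v => if LinearIndependent ℝ (v : Fin n → E n) then
    absPow (frameMatrix (c x) x v).det μ * f x else 0

lemma frameMatrix_comp (c : OpenPartialHomeomorph M (E n)) (x : M) (v : Fin n → E n)
    (g : Matrix (Fin n) (Fin n) ℝ) :
    frameMatrix c x (fun j => ∑ i, g i j • v i) = frameMatrix c x v * g := by
  ext i j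
  simp [frameMatrix, Matrix.mul_apply, mul_comm]

lemma localComponent_ofLocal {c : M → OpenPartialHomeomorph M (E n)}
    (hc : ∀ x, c x ∈ smoothCharts n M) (f : M → 𝕜) {c' : OpenPartialHomeomorph M (E n)}
    (hc' : c' ∈ smoothCharts n M) {y : E n} (hy : y ∈ c'.target)
    (hx : c'.symm y ∈ (c (c'.symm y)).source) :
    localComponent c' (ofLocal μ c f) y =
      absPow (jac c' (c (c'.symm y)) y).det μ * f (c'.symm y) := by
  rw [jac_eq_frameMatrix hc' (hc _) ⟨hy, hx⟩]
  exact if_pos (linearIndependent_dSymm hc' hy)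

lemma localComponent_ofLocal_eq_zero {c : M → OpenPartialHomeomorph M (E n)}
    {f : M → 𝕜} {c' : OpenPartialHomeomorph M (E n)}
    (hc' : c' ∈ smoothCharts n M) {y : E n} (hy : y ∈ c'.target)
    (hx : f (c'.symm y) = 0) :
    localComponent c' (ofLocal μ c f) y = 0 := by
  refine (if_pos (linearIndependent_dSymm hc' hy)).trans ?_
  rw [hx, mul_zero]

variable [IsManifold (𝓡 n) ∞ M]

/-- The point `x` need lie in the domain of `c x` only where `f x ≠ 0`. This admits both a system of
charts around all points and one fixed chart with a function cut off inside its domain; elsewhere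
the value is zero, whatever the derivative of the chart is. -/
lemma ofLocal_mem {c : M → OpenPartialHomeomorph M (E n)}
    (hc : ∀ x, c x ∈ smoothCharts n M) {f : M → 𝕜} (hcx : ∀ x, f x ≠ 0 → x ∈ (c x).source)
    (hf : ∀ c' ∈ smoothCharts n M,
      ContDiffOn ℝ ∞ (localComponent c' (ofLocal μ c f)) c'.target) :
    ofLocal μ c f ∈ densities n M μ := by
  refine ⟨fun x v hv => if_neg hv, fun x v hv g hg => ?_, hf⟩
  have key : ∀ (e : OpenPartialHomeomorph M (E n)) (_ : e ∈ smoothCharts n M) (_ : x ∈ e.source)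
      (w : Fin n → E n), LinearIndependent ℝ w ↔ (frameMatrix e x w).det ≠ 0 := by
    intro e he hx w
    have := linearIndependent_iff_det_frameMatrix he (e.map_source hx) w
    rwa [e.left_inv hx] at this
  have hlin : ∀ w : Fin n → E n, LinearIndependent ℝ w →
      LinearIndependent ℝ (fun j => ∑ i, g i j • w i) := by
    intro w hw
    have h1 := key (chartAt (E n) x) (IsManifold.chart_mem_maximalAtlas x) (mem_chart_source _ x)
    rw [h1, frameMatrix_comp, Matrix.det_mul]
    exact mul_ne_zero ((h1 w).1 hw) hg
  have hdet : ∀ w : Fin n → E n, LinearIndependent ℝ w → f x ≠ 0 →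
      absPow (frameMatrix (c x) x (fun j => ∑ i, g i j • w i)).det μ =
        absPow g.det μ * absPow (frameMatrix (c x) x w).det μ := by
    intro w hw hfx
    rw [frameMatrix_comp, Matrix.det_mul,
      absPow_mul ((key (c x) (hc x) (hcx x hfx) w).1 hw) hg, mul_comm]
  refine (if_pos (hlin v hv)).trans ?_
  refine Eq.trans ?_ (congrArg (absPow g.det μ * ·) (if_pos hv)).symm
  by_cases hfx : f x = 0
  · rw [hfx]
    simp only [mul_zero]
  · exact (congrArg (· * f x) (hdet v hv hfx)).trans (mul_assoc _ _ _)

/-- There are densities with any given germ of local components. -/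
theorem exists_density_eventuallyEq [T2Space M] {c : OpenPartialHomeomorph M (E n)}
    (hc : c ∈ smoothCharts n M) {y₀ : E n} (hy₀ : y₀ ∈ c.target) {f : E n → 𝕜}
    (hf : ContDiff ℝ ∞ f) :
    ∃ φ : densities n M μ, localComponent c φ.1 =ᶠ[nhds y₀] f := by
  -- The germ is multiplied by a bump function with closed support in the domain of `c` and extended
  -- by zero. Such bump functions exist because `M` is Hausdorff.
  obtain ⟨χ, -, hχ⟩ := (SmoothBumpFunction.nhds_basis_tsupport (I := 𝓡 n) (c.symm y₀)).mem_iff.1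
    (c.open_source.mem_nhds (c.map_target hy₀))
  set F : M → 𝕜 := fun x => (χ x : 𝕜) * f (c x) with hF
  have hF0 : ∀ x, F x ≠ 0 → x ∈ c.source := fun x hx => hχ (subset_closure fun h => hx (by
    simp [hF, h]))
  have hmem : ofLocal μ (fun _ => c) F ∈ densities n M μ := by
    refine ofLocal_mem (fun _ => hc) hF0 fun c' hc' z hz => ?_
    by_cases hzc : c'.symm z ∈ c.source
    · have hov : z ∈ overlap c' c := ⟨hz, hzc⟩
      have hs := isOpen_overlap c' c
      have h1 : ContDiffOn ℝ ∞ (fun w => absPow (jac c' c w).det μ *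
          (((χ (c'.symm w) : ℝ) : 𝕜) * f (transition c' c w))) (overlap c' c) := by
        refine (contDiffOn_absPow_det_jac μ hc' hc).mul (ContDiffOn.mul ?_
          (hf.comp_contDiffOn (contDiffOn_transition hc' hc)))
        refine (RCLike.ofRealCLM : ℝ →L[ℝ] 𝕜).contDiff.comp_contDiffOn (f := fun w => χ (c'.symm w)) ?_
        rw [← contMDiffOn_iff_contDiffOn]
        exact χ.contMDiff.comp_contMDiffOn ((contMDiffOn_symm_of_mem_maximalAtlas hc').mono
          Set.inter_subset_left)
      refine ((h1.contDiffAt (hs.mem_nhds hov)).congr_of_eventuallyEq ?_).contDiffWithinAt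
      filter_upwards [hs.mem_nhds hov] with w hw
      exact localComponent_ofLocal (c := fun _ => c) (fun _ => hc) F hc' hw.1 hw.2
    · have h1 : ∀ᶠ w in nhds z, w ∈ c'.target ∧ c'.symm w ∉ tsupport χ := by
        refine (c'.open_target.eventually_mem hz).and ?_
        exact (c'.continuousAt_symm hz).eventually
          ((isClosed_tsupport χ).isOpen_compl.eventually_mem fun h => hzc (hχ h))
      refine (contDiffAt_const (c := (0 : 𝕜)).congr_of_eventuallyEq ?_).contDiffWithinAt
      filter_upwards [h1] with w hw
      refine localComponent_ofLocal_eq_zero hc' hw.1 ?_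
      simp [hF, image_eq_zero_of_notMem_tsupport hw.2]
  refine ⟨⟨_, hmem⟩, ?_⟩
  have h2 : ∀ᶠ w in nhds y₀, χ (c.symm w) = 1 :=
    (c.continuousAt_symm hy₀).eventually χ.eventuallyEq_one
  filter_upwards [h2, c.open_target.mem_nhds hy₀] with w hw hwc
  have h3 := localComponent_ofLocal (μ := μ) (c := fun _ => c) (fun _ => hc) F hc hwc
    (c.map_target hwc)
  have h4 : (jac c c w) = 1 := by
    rw [jac_eq_frameMatrix hc hc ⟨hwc, c.map_target hwc⟩]
    ext i j
    simp [frameMatrix, dChart_dSymm hc hwc, Matrix.one_apply]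
  rw [h3, h4]
  simp [hF, hw, c.right_inv hwc, absPow_one]

end Charts

section

variable {𝕜 : Type*} [RCLike 𝕜] {n : ℕ}

lemma IsSymmetricOn.mono_set {N : ℕ} {U V : Set (E n)} {a : TensorFamily 𝕜 n}
    (h : IsSymmetricOn N U a) (hV : V ⊆ U) : IsSymmetricOn N V a :=
  ⟨fun k I => (h.smooth k I).mono hV, fun k I π y hy => h.symm k I π y (hV hy),
    fun k hk I y hy => h.degree_le k hk I y (hV hy)⟩

variable {M : Type*} [TopologicalSpace M]

/-! ### Functions polynomial on the fibers in different charts -/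

/-- The components in the chart `c` of tensor fields with components `b` in the chart `c'`. -/
def pullback (c c' : OpenPartialHomeomorph M (E n)) (b : TensorFamily 𝕜 n) : TensorFamily 𝕜 n :=
  fun k I y => ∑ J : Fin k → Fin n, b k J (transition c c' y) *
    ∏ m, ((jac c' c (transition c c' y) (I m) (J m) : ℝ) : 𝕜)

lemma fiberPoly_pullback (c c' : OpenPartialHomeomorph M (E n)) (b : TensorFamily 𝕜 n) (N : ℕ)
    (y : E n) (ξ : Fin n → ℝ) :
    fiberPoly N (pullback c c' b) y ξ = fiberPoly N b (transition c c' y)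
      (fun j => ∑ i, ξ i * jac c' c (transition c c' y) i j) := by
  refine sum_congr rfl fun k _ => ?_
  simp only [pullback, sum_mul]
  rw [sum_comm]
  refine sum_congr rfl fun J _ => ?_
  push_cast
  rw [prod_univ_sum, mul_sum, Fintype.piFinset_univ]
  refine sum_congr rfl fun I _ => ?_
  rw [prod_mul_distrib]
  ring

variable [ChartedSpace (E n) M]

lemma isSymmetricOn_pullback {c c' : OpenPartialHomeomorph M (E n)} (hc : c ∈ smoothCharts n M)
    (hc' : c' ∈ smoothCharts n M) {N : ℕ} {b : TensorFamily 𝕜 n}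
    (hb : IsSymmetricOn N c'.target b) : IsSymmetricOn N (overlap c c') (pullback c c' b) := by
  have hmaps : Set.MapsTo (transition c c') (overlap c c') (overlap c' c) :=
    fun y hy => transition_mem_overlap hy
  refine ⟨fun k I => ?_, fun k I π y hy => ?_, fun k hk I y hy => ?_⟩
  · refine ContDiffOn.sum fun J _ => ContDiffOn.mul ?_ (contDiffOn_prod fun m _ => ?_)
    · exact (hb.smooth k J).comp (contDiffOn_transition hc hc') fun y hy => (hmaps hy).1
    · exact (RCLike.ofRealCLM : ℝ →L[ℝ] 𝕜).contDiff.comp_contDiffOn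
        ((contDiffOn_jac hc' hc (I m) (J m)).comp (contDiffOn_transition hc hc') hmaps)
  · rw [pullback, pullback, ← Equiv.sum_comp (Equiv.arrowCongr π.symm (Equiv.refl (Fin n)))]
    refine sum_congr rfl fun J _ => ?_
    have : (Equiv.arrowCongr π.symm (Equiv.refl (Fin n))) J = J ∘ π := by
      ext; simp [Equiv.arrowCongr]
    rw [this, hb.symm k J π _ (hmaps hy).1]
    congr 1
    exact Equiv.prod_comp π (fun m => ((jac c' c (transition c c' y) (I m) (J m) : ℝ) : 𝕜))
  · exact sum_eq_zero fun J _ => by rw [hb.degree_le k hk J _ (hmaps hy).1, zero_mul]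

lemma HasFiberPoly.apply_pullback {c c' : OpenPartialHomeomorph M (E n)}
    (hc : c ∈ smoothCharts n M) (hc' : c' ∈ smoothCharts n M)
    {P : (x : M) → (TangentSpace (𝓡 n) x →L[ℝ] ℝ) → 𝕜} {N : ℕ} {b : TensorFamily 𝕜 n}
    (hb : HasFiberPoly c' P N b) {y : E n} (hy : y ∈ overlap c c') (ξ : Fin n → ℝ) :
    P (c.symm y) (coordCovector c (c.symm y) ξ) = fiberPoly N (pullback c c' b) y ξ := by
  have h := coordCovector_transition hc' hc (transition_mem_overlap hy) ξ
  rw [symm_transition hy] at h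
  rw [fiberPoly_pullback, h]
  have h2 := hb.apply_eq _ (transition_mem_overlap hy).1
    (fun j => ∑ i, ξ i * jac c' c (transition c c' y) i j)
  rw [symm_transition hy] at h2
  exact h2

/-- A function that is a smooth polynomial on the fibers in the charts of a covering is so in
all smooth charts. -/
theorem exists_hasFiberPoly {P : (x : M) → (TangentSpace (𝓡 n) x →L[ℝ] ℝ) → 𝕜} {N : ℕ}
    (hP : ∀ x, ∃ c' ∈ smoothCharts n M, x ∈ c'.source ∧ ∃ b, HasFiberPoly c' P N b)
    {c : OpenPartialHomeomorph M (E n)} (hc : c ∈ smoothCharts n M) :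
    ∃ b, HasFiberPoly c P N b := by
  choose c' hc' hx b hb using hP
  have hov : ∀ y ∈ c.target, y ∈ overlap c (c' (c.symm y)) := fun y hy => ⟨hy, hx _⟩
  have hsymm := fun x => isSymmetricOn_pullback hc (hc' x) (hb x).isSymmetricOn
  have key : ∀ y ∈ c.target, ∀ x, y ∈ overlap c (c' x) → ∀ (k : ℕ) (I : Fin k → Fin n),
      pullback c (c' (c.symm y)) (b (c.symm y)) k I y = pullback c (c' x) (b x) k I y := by
    intro y hy x hyx
    -- Coefficients computed through two charts give the same polynomial on the fiber over `y`,
    -- hence agree at `y`; a comparison on a single point is enough.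
    refine coeff_eq_of_fiberPoly_eq (U := {y}) (N := N)
      ((hsymm (c.symm y)).mono_set (Set.singleton_subset_iff.2 (hov y hy)))
      ((hsymm x).mono_set (Set.singleton_subset_iff.2 hyx)) rfl fun ξ => ?_
    rw [← (hb _).apply_pullback hc (hc' _) (hov y hy), ← (hb x).apply_pullback hc (hc' x) hyx]
  refine ⟨fun k I y => pullback c (c' (c.symm y)) (b (c.symm y)) k I y, ⟨fun k I y hy => ?_,
    fun k I π y hy => (hsymm _).symm k I π y (hov y hy),
    fun k hk I y hy => (hsymm _).degree_le k hk I y (hov y hy)⟩, fun y hy ξ => ?_⟩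
  -- The auxiliary chart varies with the point; by `key` it may be frozen near `y`, where smoothness
  -- is then clear.
  · have ho := (isOpen_overlap c (c' (c.symm y))).mem_nhds (hov y hy)
    refine ((((hsymm (c.symm y)).smooth k I).contDiffAt ho).congr_of_eventuallyEq
      ?_).contDiffWithinAt
    filter_upwards [ho] with w hw
    exact key w hw.1 _ hw k I
  · exact (hb _).apply_pullback hc (hc' _) (hov y hy) ξ

/-! ### Local forms of operators -/

variable {μ : 𝕜}

lemma contDiffOn_localComponent (φ : densities n M μ) {c : OpenPartialHomeomorph M (E n)}
    (hc : c ∈ smoothCharts n M) : ContDiffOn ℝ ∞ (localComponent c φ.1) c.target :=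
  φ.2.2.2 c hc

lemma vanishesTo_transition {φ : densities n M μ} {c c' : OpenPartialHomeomorph M (E n)}
    (hc : c ∈ smoothCharts n M) (hc' : c' ∈ smoothCharts n M) {y : E n} (hy : y ∈ overlap c c')
    {p : ℕ} (h : VanishesTo p (localComponent c' φ.1) (transition c c' y)) :
    VanishesTo p (localComponent c φ.1) y := by
  have ho := isOpen_overlap c c'
  have hm : Set.MapsTo (transition c c') (overlap c c') c'.target :=
    fun y hy => (transition_mem_overlap hy).1
  have h1 := (VanishesTo.zero (fun y => absPow (jac c c' y).det μ) y).mul ho hy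
    (contDiffOn_absPow_det_jac μ hc hc')
    ((contDiffOn_localComponent φ hc').comp (contDiffOn_transition hc hc') hm)
    (VanishesTo.comp (ψ := transition c c') (g := localComponent c' φ.1) ho c'.open_target hm hy
      (contDiffOn_localComponent φ hc')
      (contDiffOn_transition hc hc') h)
  rw [zero_add] at h1
  refine h1.congr ?_
  filter_upwards [ho.mem_nhds hy] with w hw
  exact localComponent_transition φ.2 hc hc' hw

lemma localComponent_eq_zero_of_transition {φ : densities n M μ}
    {c c' : OpenPartialHomeomorph M (E n)}
    (hc : c ∈ smoothCharts n M) (hc' : c' ∈ smoothCharts n M) {y : E n} (hy : y ∈ overlap c c')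
    (h : localComponent c' φ.1 (transition c c' y) = 0) : localComponent c φ.1 y = 0 := by
  rw [localComponent_transition φ.2 hc hc' hy, h, mul_zero]

variable [IsManifold (𝓡 n) ∞ M] [T2Space M]

/-- The coefficients of an operator are determined by its action on densities. -/
theorem coeff_eq_of_applyOp_eq {c : OpenPartialHomeomorph M (E n)} (hc : c ∈ smoothCharts n M)
    {U : Set (E n)} (hU : U ⊆ c.target) {N : ℕ} {a b : TensorFamily 𝕜 n}
    (ha : IsSymmetricOn N U a) (hb : IsSymmetricOn N U b)
    (h : ∀ φ : densities n M μ, ∀ y ∈ U,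
      applyOp N a (localComponent c φ.1) y = applyOp N b (localComponent c φ.1) y)
    {y : E n} (hy : y ∈ U) (k : ℕ) (I : Fin k → Fin n) : a k I y = b k I y := by
  refine coeff_eq_of_fiberPoly_eq ha hb hy (fun ξ => ?_) k I
  -- Exponentials are the test functions: on them the action at `y` is the value of the full
  -- polynomial at `ξ`.
  obtain ⟨φ, hφ⟩ := exists_density_eventuallyEq (μ := μ) hc (hU hy)
    (f := fun x => NormedSpace.exp (linForm 𝕜 ξ (x - y)))
    (contDiff_exp_real.comp ((linForm 𝕜 ξ).contDiff.comp (contDiff_id.sub contDiff_const)))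
  rw [← applyOp_exp, ← applyOp_exp, ← applyOp_congr hφ, ← applyOp_congr hφ]
  exact h φ y hy

/-- The monomials `(x - y)^I / k!`. -/
def monomial {k : ℕ} (I : Fin k → Fin n) (y x : E n) : 𝕜 :=
  (k.factorial : 𝕜)⁻¹ * ∏ m, ((x (I m) - y (I m) : ℝ) : 𝕜)

lemma contDiff_coord (i : Fin n) : ContDiff ℝ ∞ (fun x : E n => ((x i : ℝ) : 𝕜)) :=
  (RCLike.ofRealCLM : ℝ →L[ℝ] 𝕜).contDiff.comp (EuclideanSpace.proj i : E n →L[ℝ] ℝ).contDiff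

lemma contDiff_monomial {k : ℕ} (I : Fin k → Fin n) (y : E n) :
    ContDiff ℝ ∞ (monomial I y : E n → 𝕜) := by
  refine contDiff_const.mul (contDiff_prod fun m _ => ?_)
  push_cast
  exact (contDiff_coord (I m)).sub contDiff_const

/-- The sum runs over all words `I`, so each word carries `1 / k!` rather than the inverse factorial
of a multi-index. -/
lemma taylor_eq_sum_monomial {k : ℕ} (T : (E n) [×k]→L[ℝ] 𝕜) (x y : E n) :
    ((k.factorial : ℝ)⁻¹ • T) (fun _ => x - y) =
      ∑ I : Fin k → Fin n, T (fun m => stdVec (I m)) * monomial I y x := by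
  have h := multilinear_diag_eq_sum T (x - y)
  refine (congrArg ((k.factorial : ℝ)⁻¹ • ·) h).trans ?_
  rw [smul_sum]
  refine sum_congr rfl fun I _ => ?_
  rw [monomial, RCLike.real_smul_eq_coe_mul]
  push_cast
  simp only [PiLp.sub_apply]
  push_cast
  ring

/-- An operator on densities that depends on jets of order `N` only is a differential operator of
order at most `N`. -/
theorem exists_hasLocalForm {A : Module.End 𝕜 (densities n M μ)} {N : ℕ}
    (hA : ∀ x, ∃ c ∈ smoothCharts n M, x ∈ c.source ∧ ∀ φ : densities n M μ,
      VanishesTo (N + 1) (localComponent c φ.1) (c x) → localComponent c (A φ).1 (c x) = 0)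
    {c : OpenPartialHomeomorph M (E n)} (hc : c ∈ smoothCharts n M) :
    ∃ a, HasLocalForm c A N a := by
  have hjet : ∀ φ : densities n M μ, ∀ y ∈ c.target,
      VanishesTo (N + 1) (localComponent c φ.1) y → localComponent c (A φ).1 y = 0 := by
    intro φ y hy hφ
    obtain ⟨c', hc', hx, h⟩ := hA (c.symm y)
    have hov : y ∈ overlap c c' := ⟨hy, hx⟩
    refine localComponent_eq_zero_of_transition hc hc' hov (h φ ?_)
    refine vanishesTo_transition hc' hc (transition_mem_overlap hov) ?_
    rwa [transition_transition hov]
  have hgerm : ∀ φ ψ : densities n M μ, ∀ y ∈ c.target,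
      VanishesTo (N + 1) (fun x => localComponent c φ.1 x - localComponent c ψ.1 x) y →
      localComponent c (A φ).1 y = localComponent c (A ψ).1 y := by
    intro φ ψ y hy h
    have h1 := hjet (φ - ψ) y hy h
    rw [map_sub] at h1
    exact sub_eq_zero.1 h1
  have hgerm' : ∀ φ ψ : densities n M μ, ∀ y ∈ c.target,
      localComponent c φ.1 =ᶠ[nhds y] localComponent c ψ.1 →
      localComponent c (A φ).1 y = localComponent c (A ψ).1 y := by
    intro φ ψ y hy h
    refine hgerm φ ψ y hy (VanishesTo.congr (f := fun _ => 0) (fun i _ => ?_) ?_)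
    · simp
    · filter_upwards [h] with x hx
      rw [hx, sub_self]
  have hex : ∀ (k : ℕ) (I : Fin k → Fin n) (y : E n), ∃ φ : densities n M μ, y ∈ c.target →
      localComponent c φ.1 =ᶠ[nhds y] monomial I y := by
    intro k I y
    by_cases hy : y ∈ c.target
    · obtain ⟨φ, hφ⟩ := exists_density_eventuallyEq (μ := μ) hc hy (contDiff_monomial I y)
      exact ⟨φ, fun _ => hφ⟩
    · exact ⟨0, fun h => absurd h hy⟩
  choose Φ hΦ using hex
  -- The coefficient at `y` is the value at `y` of `A` on a density that is the monomial `(x - y)^I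
  -- / k!` near `y`. It does not depend on the choice of this density, by `hgerm'`.
  refine ⟨fun k I y => if k ≤ N then localComponent c (A (Φ k I y)).1 y else 0,
    ⟨fun k I y₀ hy₀ => ?_, fun k I π y hy => ?_, fun k hk I y hy => if_neg (by omega)⟩,
    fun φ y hy => ?_⟩
  · by_cases hk : k ≤ N
    swap
    · simp only [hk, if_false]
      exact contDiffWithinAt_const
    simp only [hk, if_true]
    have hΘ : ∀ S : Finset (Fin k), ∃ θ : densities n M μ, localComponent c θ.1 =ᶠ[nhds y₀]
        fun x => ∏ m ∈ S, ((x (I m) : ℝ) : 𝕜) := fun S =>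
      exists_density_eventuallyEq hc hy₀ (contDiff_prod fun m _ => contDiff_coord (I m))
    choose Θ hΘ using hΘ
    -- For smoothness, `(x - y)^I` is expanded in powers of `x`. The densities `Θ S` stay fixed for
    -- `y` near `y₀`, and `y` enters only through the smooth factors `r S y`.
    set r : Finset (Fin k) → E n → 𝕜 := fun S y =>
      (k.factorial : 𝕜)⁻¹ * ∏ m ∈ univ \ S, (-((y (I m) : ℝ) : 𝕜)) with hr
    have hmon : ∀ y x : E n, (monomial I y x : 𝕜) =
        ∑ S : Finset (Fin k), r S y * ∏ m ∈ S, ((x (I m) : ℝ) : 𝕜) := by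
      intro y x
      have := prod_add (fun m : Fin k => ((x (I m) : ℝ) : 𝕜)) (fun m => -((y (I m) : ℝ) : 𝕜)) univ
      simp only [monomial, sub_eq_add_neg, RCLike.ofReal_add, RCLike.ofReal_neg, this, mul_sum,
        powerset_univ, hr]
      exact sum_congr rfl fun S _ => by ring
    have hloc : ∀ y, ∀ ψ : Finset (Fin k) → densities n M μ, ∀ x,
        localComponent c (∑ S, r S y • ψ S : densities n M μ).1 x =
          ∑ S, r S y * localComponent c (ψ S).1 x := by
      intro y ψ x
      simp only [localComponent]
      rw [Submodule.coe_sum, Finset.sum_apply, Finset.sum_apply]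
      rfl
    have hsm : ContDiffAt ℝ ∞ (fun y => ∑ S, r S y * localComponent c (A (Θ S)).1 y) y₀ := by
      refine ContDiffAt.sum fun S _ => ContDiffAt.mul ?_
        ((contDiffOn_localComponent _ hc).contDiffAt (c.open_target.mem_nhds hy₀))
      exact (contDiff_const.mul (contDiff_prod fun m _ => (contDiff_coord (I m)).neg)).contDiffAt
    refine (hsm.congr_of_eventuallyEq ?_).contDiffWithinAt
    have hall : ∀ᶠ y in nhds y₀, ∀ S, localComponent c (Θ S).1 =ᶠ[nhds y]
        fun x => ∏ m ∈ S, ((x (I m) : ℝ) : 𝕜) :=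
      Filter.eventually_all.2 fun S => eventually_eventually_nhds.2 (hΘ S)
    filter_upwards [hall, c.open_target.mem_nhds hy₀] with y hy hyc
    rw [hgerm' (Φ k I y) (∑ S, r S y • Θ S) y hyc, map_sum]
    · simp only [map_smul]
      exact hloc y (fun S => A (Θ S)) y
    · filter_upwards [hΦ k I y hyc, Filter.eventually_all.2 hy] with x hx hxS
      rw [hx, hloc y Θ x, hmon]
      simp only [hxS]
  · by_cases hk : k ≤ N
    swap
    · simp only [hk, if_false]
    simp only [hk, if_true]
    refine hgerm' _ _ y hy ((hΦ k _ y hy).trans (Filter.EventuallyEq.trans ?_ (hΦ k I y hy).symm))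
    refine Filter.Eventually.of_forall fun x => ?_
    simp only [monomial, Function.comp_apply]
    rw [Equiv.prod_comp π (fun m => ((x (I m) - y (I m) : ℝ) : 𝕜))]
  · set f := localComponent c φ.1 with hf
    -- Near `y` this density is the Taylor polynomial of `φ` of order `N`, so `A φ` and `A ψ` agree
    -- at `y`.
    set ψ : densities n M μ := ∑ k ∈ range (N + 1), ∑ I : Fin k → Fin n,
      (iteratedFDeriv ℝ k f y (fun m => stdVec (I m))) • Φ k I y with hψ
    have hloc : ∀ (B : Module.End 𝕜 (densities n M μ)) (x : E n), localComponent c (B ψ).1 x =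
        ∑ k ∈ range (N + 1), ∑ I : Fin k → Fin n,
          (iteratedFDeriv ℝ k f y (fun m => stdVec (I m))) * localComponent c (B (Φ k I y)).1 x := by
      intro B x
      rw [hψ]
      simp only [map_sum, map_smul, localComponent]
      rw [Submodule.coe_sum, Finset.sum_apply, Finset.sum_apply]
      refine sum_congr rfl fun k _ => ?_
      rw [Submodule.coe_sum, Finset.sum_apply, Finset.sum_apply]
      rfl
    have h1 : localComponent c (A φ).1 y = localComponent c (A ψ).1 y := by
      refine hgerm φ ψ y hy ((vanishesTo_sub_taylor c.open_target
        (contDiffOn_localComponent φ hc) hy N).congr ?_)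
      have hall : ∀ᶠ x in nhds y, ∀ k ∈ range (N + 1), ∀ I : Fin k → Fin n,
          localComponent c (Φ k I y).1 x = monomial I y x :=
        (Filter.eventually_all_finset _).2 fun k _ =>
          Filter.eventually_all.2 fun I => hΦ k I y hy
      filter_upwards [hall] with x hx
      have h2 := hloc 1 x
      simp only [Module.End.one_apply] at h2
      rw [h2]
      refine congrArg (_ - ·) (sum_congr rfl fun k hk => ?_)
      rw [taylor_eq_sum_monomial]
      exact sum_congr rfl fun I _ => by rw [hx k hk I]
    rw [h1, hloc A y]
    refine sum_congr rfl fun k hk => sum_congr rfl fun I _ => ?_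
    rw [mem_range] at hk
    simp only [if_pos (by omega : k ≤ N), mul_comm]

/-! ### The principal symbol -/

/-- Both sides arise from applying `A` to a density equal to the `m`-th power of a linear form
vanishing at the point. Allowing `m ≥ N`, not just `m = N`, gives two uses: for `m > N` the right
side is zero, which bounds the order in the other chart, and `m = N` compares principal symbols. -/
lemma homPoly_transition {c c' : OpenPartialHomeomorph M (E n)} (hc : c ∈ smoothCharts n M)
    (hc' : c' ∈ smoothCharts n M) {A : Module.End 𝕜 (densities n M μ)} {N N' : ℕ}
    {a a' : TensorFamily 𝕜 n} (ha : HasLocalForm c A N a) (ha' : HasLocalForm c' A N' a')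
    {y : E n} (hy : y ∈ overlap c c') {m : ℕ} (hm : m ≤ N') (hNm : N ≤ m)
    (htop : ∀ k, m < k → k ≤ N' → ∀ I : Fin k → Fin n, a' k I (transition c c' y) = 0)
    (ξ' : Fin n → ℝ) :
    homPoly a' m (transition c c' y) ξ' =
      homPoly a m y (fun i => ∑ j, ξ' j * jac c c' y j i) := by
  set z := transition c c' y with hz
  have hzo : z ∈ overlap c' c := transition_mem_overlap hy
  set κ : E n → 𝕜 := fun w => absPow (jac c c' w).det μ with hκ
  set L := linForm 𝕜 ξ' with hL
  have hlin : ContDiff ℝ ∞ (fun x => L (x - z)) :=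
    L.contDiff.comp (contDiff_id.sub contDiff_const)
  obtain ⟨φ, hφ⟩ := exists_density_eventuallyEq (μ := μ) hc' hzo.1
    (f := fun x => L (x - z) ^ m * 1) ((hlin.pow m).mul contDiff_const)
  have hdL : HasFDerivAt (fun x => L (x - z)) L z :=
    L.hasFDerivAt.comp z ((hasFDerivAt_id z).sub_const z)
  have hm0 : (m.factorial : 𝕜) ≠ 0 := Nat.cast_ne_zero.2 m.factorial_ne_zero
  have e1 : localComponent c' (A φ).1 z = m.factorial * homPoly a' m z ξ' := by
    rw [ha'.apply_eq φ z hzo.1, applyOp_congr hφ, applyOp_pow_mul isOpen_univ hlin.contDiffOn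
      contDiffOn_const (Set.mem_univ z) (by simp) hm htop (ξ := ξ'), mul_one]
    intro i
    rw [hdL.fderiv, hL, linForm_stdVec]
  have ho := isOpen_overlap c c'
  have hF : ContDiffOn ℝ ∞ (fun w => L (transition c c' w - z)) (overlap c c') :=
    hlin.comp_contDiffOn (contDiffOn_transition hc hc')
  have hφ' : localComponent c φ.1 =ᶠ[nhds y] fun w => L (transition c c' w - z) ^ m * κ w := by
    have h1 := ((contDiffOn_transition hc hc').contDiffAt (ho.mem_nhds hy)).continuousAt.eventually hφ
    filter_upwards [h1, ho.mem_nhds hy] with w hw hwo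
    rw [localComponent_transition φ.2 hc hc' hwo, hw]
    ring
  have hξ : ∀ i, fderiv ℝ (fun w => L (transition c c' w - z)) y (stdVec i) =
      ((∑ j, ξ' j * jac c c' y j i : ℝ) : 𝕜) := by
    intro i
    have h1 := ((contDiffOn_transition hc hc').contDiffAt
      (ho.mem_nhds hy)).differentiableAt (by simp)
    have h2 := hdL.comp y h1.hasFDerivAt
    have h3 := congrArg (fun T : E n →L[ℝ] 𝕜 => T (stdVec i)) h2.fderiv
    refine h3.trans ?_
    simp only [ContinuousLinearMap.comp_apply, hL, linForm_apply]
    rfl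
  have e2 : localComponent c (A φ).1 y =
      m.factorial * homPoly a m y (fun i => ∑ j, ξ' j * jac c c' y j i) * κ y := by
    rw [ha.apply_eq φ y hy.1, ← applyOp_mono ha.isSymmetricOn hNm _ hy.1, applyOp_congr hφ']
    refine applyOp_pow_mul ho hF (contDiffOn_absPow_det_jac μ hc hc') hy (by simp [hz]) le_rfl
      (fun k hk hk' => absurd hk (by omega)) hξ
  rw [localComponent_transition (A φ).2 hc hc' hy, e1] at e2
  have hκ0 : κ y ≠ 0 := absPow_ne_zero _ _
  refine mul_left_cancel₀ hm0 (mul_right_cancel₀ hκ0 ?_)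
  rw [← e2]
  ring

/-- The order of an operator at a point does not depend on the chart. -/
theorem coeff_eq_zero_of_transition {c c' : OpenPartialHomeomorph M (E n)}
    (hc : c ∈ smoothCharts n M)
    (hc' : c' ∈ smoothCharts n M) {A : Module.End 𝕜 (densities n M μ)} {N N' : ℕ}
    {a a' : TensorFamily 𝕜 n} (ha : HasLocalForm c A N a) (ha' : HasLocalForm c' A N' a')
    {y : E n} (hy : y ∈ overlap c c') {k : ℕ} (hk : N < k) (I : Fin k → Fin n) :
    a' k I (transition c c' y) = 0 := by
  have hz := (transition_mem_overlap hy).1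
  rcases lt_or_ge N' k with h | h
  · exact ha'.isSymmetricOn.degree_le k h I _ hz
  -- Descending induction on `k`: the coefficients of higher degree must vanish at the point before
  -- degree `k` can be isolated.
  induction hd : N' - k using Nat.strong_induction_on generalizing k with
  | _ d ih =>
    have htop : ∀ j, k < j → j ≤ N' → ∀ J : Fin j → Fin n, a' j J (transition c c' y) = 0 :=
      fun j hj hjN J => ih (N' - j) (by omega) (by omega) J hjN rfl
    refine symm_ext (a := fun I => a' k I (transition c c' y)) (b := fun _ => 0)
      (fun J π => ha'.isSymmetricOn.symm k J π _ hz) (fun _ _ => rfl) (fun ξ' => ?_) I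
    have h1 := homPoly_transition hc hc' ha ha' hy h hk.le htop ξ'
    have h2 : homPoly a k y (fun i => ∑ j, ξ' j * jac c c' y j i) = 0 :=
      sum_eq_zero fun J _ => by rw [ha.isSymmetricOn.degree_le k hk J y hy.1, zero_mul]
    rw [h2] at h1
    simp only [zero_mul, sum_const_zero]
    exact h1

end

/-! ### The divergence and the symbol of families of tensor fields -/

section

variable {𝕜 : Type*} [RCLike 𝕜] {n : ℕ} {U : Set (E n)} {N : ℕ} {a b : TensorFamily 𝕜 n}

lemma divergence_congr (hU : IsOpen U) {k : ℕ}
    (h : ∀ (I : Fin (k + 1) → Fin n), ∀ y ∈ U, a (k + 1) I y = b (k + 1) I y)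
    (I : Fin k → Fin n) {y : E n} (hy : y ∈ U) : divergence a k I y = divergence b k I y := by
  refine sum_congr rfl fun j _ => ?_
  have : a (k + 1) (Fin.snoc I j) =ᶠ[nhds y] b (k + 1) (Fin.snoc I j) := by
    filter_upwards [hU.mem_nhds hy] with x hx
    exact h _ x hx
  rw [this.fderiv_eq]

/-- Only the component of degree `l + m` enters. The degree is a variable `k` with an equation so
that index tuples need no casts. -/
lemma iterate_divergence_congr (hU : IsOpen U) {m l k : ℕ} (hk : k = l + m)
    (h : ∀ (I : Fin k → Fin n), ∀ y ∈ U, a k I y = b k I y)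
    (I : Fin l → Fin n) {y : E n} (hy : y ∈ U) :
    (divergence^[m] a) l I y = (divergence^[m] b) l I y := by
  induction m generalizing l y with
  | zero =>
    obtain rfl : k = l := hk
    exact h I y hy
  | succ m ih =>
    rw [Function.iterate_succ_apply', Function.iterate_succ_apply']
    exact divergence_congr hU (fun J x hx => ih (by omega) J hx) I hy

lemma iterate_divergence_zero (m : ℕ) :
    divergence^[m] (fun _ _ _ => 0 : TensorFamily 𝕜 n) = fun _ _ _ => 0 := by
  induction m with
  | zero => rfl
  | succ m ih =>
    rw [Function.iterate_succ_apply', ih]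
    funext k I y
    simp [divergence]

/-- Extension of a permutation by a fixed last element. -/
lemma exists_perm_snoc {k : ℕ} (π : Equiv.Perm (Fin k)) :
    ∃ π' : Equiv.Perm (Fin (k + 1)), ∀ (I : Fin k → Fin n) (j : Fin n),
      (Fin.snoc (I ∘ π) j : Fin (k + 1) → Fin n) = (Fin.snoc I j : Fin (k + 1) → Fin n) ∘ π' := by
  refine ⟨(finSuccEquivLast.trans (Equiv.optionCongr π)).trans finSuccEquivLast.symm,
    fun I j => ?_⟩
  funext i
  refine Fin.lastCases ?_ (fun i => ?_) i
  · simp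
  · simp

lemma IsSymmetricOn.divergence (hU : IsOpen U) (ha : IsSymmetricOn N U a) :
    IsSymmetricOn N U (divergence a) := by
  refine ⟨fun k I => ?_, fun k I π y hy => ?_, fun k hk I y hy => ?_⟩
  · refine ContDiffOn.sum fun j _ => ?_
    exact ((ha.smooth (k + 1) (Fin.snoc I j)).fderiv_of_isOpen (m := ∞) hU (by simp)).clm_apply
      contDiffOn_const
  · obtain ⟨π', hπ'⟩ := exists_perm_snoc (n := n) π
    refine sum_congr rfl fun j _ => ?_
    have : a (k + 1) (Fin.snoc (I ∘ π) j) =ᶠ[nhds y] a (k + 1) (Fin.snoc I j) := by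
      filter_upwards [hU.mem_nhds hy] with x hx
      rw [hπ' I j]
      exact ha.symm _ _ _ x hx
    rw [this.fderiv_eq]
  · have := divergence_congr (b := fun _ _ _ => 0) hU (fun J x hx =>
      ha.degree_le (k + 1) (by omega) J x hx) I hy
    rw [this]
    simp [ProjectiveSymbol.divergence]

lemma IsSymmetricOn.iterate_divergence (hU : IsOpen U) (ha : IsSymmetricOn N U a) (m : ℕ) :
    IsSymmetricOn N U (ProjectiveSymbol.divergence^[m] a) := by
  induction m with
  | zero => exact ha
  | succ m ih =>
    rw [Function.iterate_succ_apply']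
    exact ih.divergence hU

lemma IsSymmetricOn.symbolTensor (hU : IsOpen U) (ha : IsSymmetricOn N U a) (μ : 𝕜) :
    IsSymmetricOn N U (symbolTensor μ N a) := by
  refine ⟨fun l I => ?_, fun l I π y hy => ?_, fun l hl I y hy => ?_⟩
  · exact ContDiffOn.sum fun k _ =>
      contDiffOn_const.mul ((ha.iterate_divergence hU _).smooth l I)
  · exact sum_congr rfl fun k _ => by rw [(ha.iterate_divergence hU _).symm l I π y hy]
  · rw [ProjectiveSymbol.symbolTensor, Icc_eq_empty (by omega), sum_empty]

lemma divergence_add (hU : IsOpen U) (ha : ∀ (k : ℕ) (I : Fin k → Fin n), ContDiffOn ℝ ∞ (a k I) U)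
    (hb : ∀ (k : ℕ) (I : Fin k → Fin n), ContDiffOn ℝ ∞ (b k I) U) (k : ℕ) (I : Fin k → Fin n)
    {y : E n} (hy : y ∈ U) :
    divergence (fun k I y => a k I y + b k I y) k I y = divergence a k I y + divergence b k I y := by
  simp only [divergence, ← sum_add_distrib]
  refine sum_congr rfl fun j _ => ?_
  rw [fderiv_fun_add (((ha _ _).contDiffAt (hU.mem_nhds hy)).differentiableAt (by simp))
    (((hb _ _).contDiffAt (hU.mem_nhds hy)).differentiableAt (by simp))]
  rfl

lemma iterate_divergence_add (hU : IsOpen U) {N' : ℕ} (ha : IsSymmetricOn N U a)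
    (hb : IsSymmetricOn N' U b) (m l : ℕ) (I : Fin l → Fin n) {y : E n} (hy : y ∈ U) :
    (divergence^[m] (fun k I y => a k I y + b k I y)) l I y =
      (divergence^[m] a) l I y + (divergence^[m] b) l I y := by
  induction m generalizing l y with
  | zero => rfl
  | succ m ih =>
    simp only [Function.iterate_succ_apply']
    rw [← divergence_add hU (ha.iterate_divergence hU m).smooth
      (hb.iterate_divergence hU m).smooth l I hy]
    exact divergence_congr hU (fun J x hx => ih (l + 1) J hx) I hy

lemma divergence_smul (hU : IsOpen U) (ha : ∀ (k : ℕ) (I : Fin k → Fin n), ContDiffOn ℝ ∞ (a k I) U)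
    (r : 𝕜) (k : ℕ) (I : Fin k → Fin n) {y : E n} (hy : y ∈ U) :
    divergence (fun k I y => r * a k I y) k I y = r * divergence a k I y := by
  simp only [divergence, mul_sum]
  refine sum_congr rfl fun j _ => ?_
  rw [fderiv_const_mul (((ha _ _).contDiffAt (hU.mem_nhds hy)).differentiableAt (by simp))]
  rfl

lemma iterate_divergence_smul (hU : IsOpen U) (ha : IsSymmetricOn N U a)
    (r : 𝕜) (m l : ℕ) (I : Fin l → Fin n) {y : E n} (hy : y ∈ U) :
    (divergence^[m] (fun k I y => r * a k I y)) l I y = r * (divergence^[m] a) l I y := by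
  induction m generalizing l y with
  | zero => rfl
  | succ m ih =>
    simp only [Function.iterate_succ_apply']
    rw [← divergence_smul hU (ha.iterate_divergence hU m).smooth r l I hy]
    exact divergence_congr hU (fun J x hx => ih (l + 1) J hx) I hy

lemma symbolTensor_add (hU : IsOpen U) {N' N'' : ℕ} (ha : IsSymmetricOn N' U a)
    (hb : IsSymmetricOn N'' U b) (μ : 𝕜) (l : ℕ) (I : Fin l → Fin n) {y : E n} (hy : y ∈ U) :
    symbolTensor μ N (fun k I y => a k I y + b k I y) l I y =
      symbolTensor μ N a l I y + symbolTensor μ N b l I y := by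
  simp only [symbolTensor, ← sum_add_distrib]
  exact sum_congr rfl fun k _ => by rw [iterate_divergence_add hU ha hb _ _ I hy, mul_add]

lemma symbolTensor_smul (hU : IsOpen U) {N' : ℕ} (ha : IsSymmetricOn N' U a)
    (μ r : 𝕜) (l : ℕ) (I : Fin l → Fin n) {y : E n} (hy : y ∈ U) :
    symbolTensor μ N (fun k I y => r * a k I y) l I y = r * symbolTensor μ N a l I y := by
  simp only [symbolTensor, mul_sum]
  exact sum_congr rfl fun k _ => by rw [iterate_divergence_smul hU ha r _ _ I hy]; ring

lemma symbolTensor_congr (hU : IsOpen U) (μ : 𝕜) {l : ℕ}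
    (h : ∀ k, l ≤ k → k ≤ N → ∀ (I : Fin k → Fin n), ∀ y ∈ U, a k I y = b k I y)
    (I : Fin l → Fin n) {y : E n} (hy : y ∈ U) :
    symbolTensor μ N a l I y = symbolTensor μ N b l I y := by
  refine sum_congr rfl fun k hk => ?_
  rw [mem_Icc] at hk
  rw [iterate_divergence_congr hU (k := k) (by omega) (h k hk.1 hk.2) I hy]

lemma symbolTensor_mono (hU : IsOpen U) (ha : IsSymmetricOn N U a) {N' : ℕ} (hN : N ≤ N') (μ : 𝕜)
    {l : ℕ} (I : Fin l → Fin n) {y : E n} (hy : y ∈ U) :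
    symbolTensor μ N' a l I y = symbolTensor μ N a l I y := by
  symm
  refine sum_subset (Icc_subset_Icc le_rfl hN) fun k hk hk' => ?_
  rw [mem_Icc] at hk hk'
  rw [iterate_divergence_congr (b := fun _ _ _ => 0) hU (k := k) (by omega)
    (ha.degree_le k (by omega)) I hy, iterate_divergence_zero, mul_zero]

lemma symbolConst_self (n : ℕ) (μ : 𝕜) (k : ℕ) : symbolConst n μ k k = 1 := by
  simp [symbolConst, genBinom]

/-- Triangularity: since `c^l_l = 1`, the symbol in degree `l` is `a_l` plus terms from strictly
higher degrees. Injectivity, surjectivity and the principal symbol property all rest on this. -/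
lemma symbolTensor_eq_add (μ : 𝕜) {l : ℕ} (hl : l ≤ N) (I : Fin l → Fin n) (y : E n) :
    symbolTensor μ N a l I y = a l I y +
      ∑ k ∈ Ioc l N, symbolConst n μ k l * (divergence^[k - l] a) l I y := by
  rw [symbolTensor, ← Ioc_insert_left hl, sum_insert (by simp), symbolConst_self]
  simp

/-- The coefficients are determined by the symbol. -/
theorem eq_of_symbolTensor_eq (hU : IsOpen U) (μ : 𝕜) (ha : IsSymmetricOn N U a)
    (hb : IsSymmetricOn N U b)
    (h : ∀ (l : ℕ) (I : Fin l → Fin n), ∀ y ∈ U, symbolTensor μ N a l I y = symbolTensor μ N b l I y)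
    (l : ℕ) (I : Fin l → Fin n) {y : E n} (hy : y ∈ U) : a l I y = b l I y := by
  rcases lt_or_ge N l with hl | hl
  · rw [ha.degree_le l hl I y hy, hb.degree_le l hl I y hy]
  induction hd : N - l using Nat.strong_induction_on generalizing l y with
  | _ d ih =>
    have h1 := h l I y hy
    rw [symbolTensor_eq_add μ hl, symbolTensor_eq_add μ hl] at h1
    have h2 : ∑ k ∈ Ioc l N, symbolConst n μ k l * (divergence^[k - l] a) l I y =
        ∑ k ∈ Ioc l N, symbolConst n μ k l * (divergence^[k - l] b) l I y := by
      refine sum_congr rfl fun k hk => ?_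
      rw [mem_Ioc] at hk
      rw [iterate_divergence_congr hU (k := k) (by omega)
        (fun J x hx => ih (N - k) (by omega) k J hx hk.2 rfl) I hy]
    rw [h2] at h1
    exact add_right_cancel h1

/-- Every symmetric family of tensor fields is a symbol. -/
theorem exists_symbolTensor_eq (hU : IsOpen U) (μ : 𝕜) (hb : IsSymmetricOn N U b) :
    ∃ a, IsSymmetricOn N U a ∧
      ∀ (l : ℕ) (I : Fin l → Fin n), ∀ y ∈ U, symbolTensor μ N a l I y = b l I y := by
  -- Here `m` counts the degrees, from `N` downwards, in which the symbol is already right.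
  have key : ∀ m, ∃ a, IsSymmetricOn N U a ∧ ∀ (l : ℕ), N < l + m → ∀ (I : Fin l → Fin n), ∀ y ∈ U,
      symbolTensor μ N a l I y = b l I y := by
    intro m
    induction m with
    | zero =>
      refine ⟨fun _ _ _ => 0, ⟨fun _ _ => contDiffOn_const, fun _ _ _ _ _ => rfl,
        fun _ _ _ _ _ => rfl⟩, fun l hl I y hy => ?_⟩
      rw [hb.degree_le l (by omega) I y hy, symbolTensor, Icc_eq_empty (by omega), sum_empty]
    | succ m ih =>
      obtain ⟨a, ha, hab⟩ := ih
      rcases lt_or_ge N m with hm | hm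
      · exact ⟨a, ha, fun l _ => hab l (by omega)⟩
      set r : TensorFamily 𝕜 n := fun l I y => b l I y - symbolTensor μ N a l I y with hr
      have hrs : IsSymmetricOn N U r := by
        have := hb.add ((ha.symbolTensor hU μ).smul (-1))
        simpa only [neg_one_mul, ← sub_eq_add_neg] using this
      -- The defect is added in degree `N - m` only. By triangularity this repairs the symbol in
      -- that degree and leaves the higher degrees unchanged.
      set a' : TensorFamily 𝕜 n := fun l I y => if l = N - m then a l I y + r l I y else a l I y
        with ha'
      have ha's : IsSymmetricOn N U a' := by
        have h2 := ha.add hrs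
        refine ⟨fun l I => ?_, fun l I π y hy => ?_, fun l hl I y hy => ?_⟩
        · by_cases h : l = N - m
          · simp only [ha', h, if_true]
            exact h2.smooth _ _
          · simp only [ha', h, if_false]
            exact ha.smooth l I
        · simp only [ha', hrs.symm l I π y hy, ha.symm l I π y hy]
        · simp only [ha', hrs.degree_le l hl I y hy, ha.degree_le l hl I y hy, add_zero, ite_self]
      refine ⟨a', ha's, fun l hl I y hy => ?_⟩
      have hgt : ∀ k, N - m < k → ∀ (J : Fin k → Fin n), ∀ x ∈ U, a' k J x = a k J x :=
        fun k hk J x _ => by simp only [ha', if_neg (by omega : ¬ k = N - m)]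
      rcases lt_or_ge N (l + m) with hl' | hl'
      · rw [← hab l hl' I y hy]
        exact symbolTensor_congr hU μ (fun k hk _ => hgt k (by omega)) I hy
      · have hlN : l ≤ N := by omega
        have h3 : ∑ k ∈ Ioc l N, symbolConst n μ k l * (divergence^[k - l] a') l I y =
            ∑ k ∈ Ioc l N, symbolConst n μ k l * (divergence^[k - l] a) l I y := by
          refine sum_congr rfl fun k hk => ?_
          rw [mem_Ioc] at hk
          rw [iterate_divergence_congr hU (k := k) (by omega) (hgt k (by omega)) I hy]
        rw [symbolTensor_eq_add μ hlN, h3]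
        simp only [ha', if_pos (by omega : l = N - m), hr]
        rw [symbolTensor_eq_add μ hlN]
        ring
  obtain ⟨a, ha, h⟩ := key (N + 1)
  exact ⟨a, ha, fun l I y hy => h l (by omega) I y hy⟩

end

/-! ### Operators under projective coordinate changes -/

section

variable {𝕜 : Type*} [RCLike 𝕜] {n : ℕ}

lemma hasDerivAt_absPow (μ : 𝕜) {t : ℝ} (ht : t ≠ 0) :
    HasDerivAt (fun t => absPow t μ) (absPow t μ * (μ * ((t⁻¹ : ℝ) : 𝕜))) t := by
  simp only [absPow, Real.log_abs]
  have h1 : HasDerivAt (fun t : ℝ => ((Real.log t : ℝ) : 𝕜) * μ) (((t⁻¹ : ℝ) : 𝕜) * μ) t :=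
    ((RCLike.ofRealCLM : ℝ →L[ℝ] 𝕜).hasFDerivAt.comp_hasDerivAt t
      (Real.hasDerivAt_log ht)).mul_const μ
  have h2 := HasDerivAt.comp_of_eq (h₂ := (NormedSpace.exp : 𝕜 → 𝕜)) t
    (_root_.hasDerivAt_exp (𝕂 := 𝕜) (x := ((Real.log t : ℝ) : 𝕜) * μ)) h1 rfl
  refine h2.congr_deriv ?_
  ring

lemma absPow_pow {t : ℝ} (μ : 𝕜) (m : ℕ) : absPow (t ^ m) μ = absPow t ((m : 𝕜) * μ) := by
  rw [absPow, absPow, abs_pow, Real.log_pow]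
  push_cast
  ring_nf

lemma absPow_mul_neg (t : ℝ) (μ : 𝕜) : absPow t (-μ) * absPow t μ = 1 := by
  rw [absPow, absPow, ← NormedSpace.exp_add]
  simp

/-- The derivatives of a density along a line in a projective coordinate. -/
theorem deriv_mobius {S S' : Set ℝ} (hS' : IsOpen S') {F G : ℕ → ℝ → 𝕜} {Λ : 𝕜} {c : ℝ}
    (hF : ∀ r, ∀ τ ∈ S, HasDerivAt (F r) (F (r + 1) τ) τ)
    (hG : ∀ r, ∀ s ∈ S', HasDerivAt (G r) (G (r + 1) s) s)
    (hc : ∀ s ∈ S', 1 - c * s ≠ 0) (hSS : ∀ s ∈ S', s / (1 - c * s) ∈ S)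
    (h0 : ∀ s ∈ S', G 0 s = absPow (1 - c * s) (-Λ) * F 0 (s / (1 - c * s))) (k : ℕ) :
    ∀ s ∈ S', G k s = ∑ r ∈ range (k + 1), opCoeff Λ k r * (c : 𝕜) ^ (k - r) *
      (absPow (1 - c * s) (-Λ) * (((1 - c * s)⁻¹ : ℝ) : 𝕜) ^ (k + r) * F r (s / (1 - c * s))) := by
  induction k with
  | zero =>
    intro s hs
    simp [h0 s hs, opCoeff_zero_zero]
  | succ k ih =>
    intro s hs
    set X : 𝕜 := (((1 - c * s)⁻¹ : ℝ) : 𝕜) with hX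
    set ρ : 𝕜 := absPow (1 - c * s) (-Λ) with hρ
    have hne := hc s hs
    have hlin : HasDerivAt (fun s => 1 - c * s) (-c) s := by
      simpa using ((hasDerivAt_id s).const_mul c).const_sub 1
    have d1 : HasDerivAt (fun s => absPow (1 - c * s) (-Λ)) (ρ * (Λ * c * X)) s := by
      refine ((hasDerivAt_absPow (-Λ) hne).scomp s hlin).congr_deriv ?_
      rw [RCLike.real_smul_eq_coe_mul, hX]
      push_cast
      ring
    have d2 : HasDerivAt (fun s => (((1 - c * s)⁻¹ : ℝ) : 𝕜)) (c * X ^ 2) s := by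
      refine ((RCLike.ofRealCLM : ℝ →L[ℝ] 𝕜).hasFDerivAt.comp_hasDerivAt s
        (hlin.inv hne)).congr_deriv ?_
      simp only [RCLike.ofRealCLM_apply, hX]
      push_cast
      field_simp
    have d3 : HasDerivAt (fun s => s / (1 - c * s)) ((1 - c * s)⁻¹ ^ 2) s := by
      refine ((hasDerivAt_id s).div hlin hne).congr_deriv ?_
      simp only [id]
      field_simp
      ring
    have d4 : ∀ r, HasDerivAt (fun s => F r (s / (1 - c * s)))
        (X ^ 2 * F (r + 1) (s / (1 - c * s))) s := by
      intro r
      refine ((hF r _ (hSS s hs)).scomp s d3).congr_deriv ?_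
      rw [RCLike.real_smul_eq_coe_mul, hX]
      push_cast
      ring
    -- The density factor contributes `Λ`, the power of the denominator contributes `k + r`, and the
    -- new parameter `s / (1 - c s)` has derivative `(1 - c s)⁻²`. The case `k + r = 0` is separate
    -- because of the exponent `k + r - 1` in the power rule.
    have d5 : ∀ r, HasDerivAt (fun s => opCoeff Λ k r * (c : 𝕜) ^ (k - r) *
        (absPow (1 - c * s) (-Λ) * (((1 - c * s)⁻¹ : ℝ) : 𝕜) ^ (k + r) * F r (s / (1 - c * s))))
        (opCoeff Λ k r * (c : 𝕜) ^ (k - r) * (ρ * X ^ (k + r) *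
          ((Λ + k + r) * c * X * F r (s / (1 - c * s)) + X ^ 2 * F (r + 1) (s / (1 - c * s))))) s := by
      intro r
      refine (((d1.mul (d2.pow (k + r))).mul (d4 r)).const_mul _).congr_deriv ?_
      simp only [Pi.mul_apply, Pi.pow_apply, ← hX, ← hρ]
      rcases Nat.eq_zero_or_pos (k + r) with h | h
      · obtain ⟨rfl, rfl⟩ : k = 0 ∧ r = 0 := by omega
        simp only [Nat.cast_zero, zero_mul, mul_zero, add_zero, pow_zero, mul_one]
        ring
      · obtain ⟨e, he⟩ : ∃ e, k + r = e + 1 := ⟨k + r - 1, by omega⟩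
        have hcast : (k : 𝕜) + r = (e : 𝕜) + 1 := by exact_mod_cast he
        have : Λ + k + r = Λ + ((e : 𝕜) + 1) := by rw [← hcast]; ring
        rw [this, he]
        simp only [Nat.add_sub_cancel, Nat.cast_add, Nat.cast_one]
        ring
    have hsum : HasDerivAt (G k) (∑ r ∈ range (k + 1), opCoeff Λ k r * (c : 𝕜) ^ (k - r) *
        (ρ * X ^ (k + r) * ((Λ + k + r) * c * X * F r (s / (1 - c * s)) +
          X ^ 2 * F (r + 1) (s / (1 - c * s))))) s := by
      refine (HasDerivAt.fun_sum fun r _ => d5 r).congr_of_eventuallyEq ?_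
      filter_upwards [hS'.mem_nhds hs] with t ht
      exact ih t ht
    rw [(hG k s hs).unique hsum]
    have e1 : ∀ r ∈ range (k + 1), opCoeff Λ k r * (c : 𝕜) ^ (k - r) *
        (ρ * X ^ (k + r) * ((Λ + k + r) * c * X * F r (s / (1 - c * s)) +
          X ^ 2 * F (r + 1) (s / (1 - c * s)))) =
        (Λ + k + r) * opCoeff Λ k r * (c : 𝕜) ^ (k + 1 - r) *
          (ρ * X ^ (k + 1 + r) * F r (s / (1 - c * s))) +
        opCoeff Λ k r * (c : 𝕜) ^ (k + 1 - (r + 1)) *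
          (ρ * X ^ (k + 1 + (r + 1)) * F (r + 1) (s / (1 - c * s))) := by
      intro r hr
      rw [mem_range] at hr
      rw [show k + 1 - r = (k - r) + 1 by omega, show k + 1 - (r + 1) = k - r by omega]
      ring
    rw [sum_congr rfl e1, sum_add_distrib]
    -- The added term `r = k + 1` is zero; it aligns this sum with the shifted one, so that
    -- `opCoeff_succ_succ` applies term by term.
    have e2 : ∑ r ∈ range (k + 1), (Λ + k + r) * opCoeff Λ k r * (c : 𝕜) ^ (k + 1 - r) *
          (ρ * X ^ (k + 1 + r) * F r (s / (1 - c * s))) =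
        ∑ r ∈ range (k + 2), (Λ + k + r) * opCoeff Λ k r * (c : 𝕜) ^ (k + 1 - r) *
          (ρ * X ^ (k + 1 + r) * F r (s / (1 - c * s))) := by
      rw [sum_range_succ _ (k + 1), opCoeff_of_lt Λ (Nat.lt_succ_self k)]
      ring
    rw [e2, sum_range_succ' _ (k + 1), sum_range_succ' _ (k + 1), opCoeff_succ_zero]
    simp only [opCoeff_succ_succ]
    rw [add_right_comm, ← sum_add_distrib]
    congr 1
    · exact sum_congr rfl fun r _ => by ring
    · simp

lemma hasDerivAt_iteratedFDeriv_line {f : E n → 𝕜} {U : Set (E n)} (hU : IsOpen U)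
    (hf : ContDiffOn ℝ ∞ f U) (y z : E n) (r : ℕ) {τ : ℝ} (hτ : y + τ • z ∈ U) :
    HasDerivAt (fun τ : ℝ => iteratedFDeriv ℝ r f (y + τ • z) (fun _ => z))
      (iteratedFDeriv ℝ (r + 1) f (y + τ • z) (fun _ => z)) τ := by
  have h1 : HasDerivAt (fun τ : ℝ => y + τ • z) z τ := by
    simpa using ((hasDerivAt_id τ).smul_const z).const_add y
  have h2 := (((contDiffOn_iteratedFDeriv_apply hU hf r (fun _ => z)).contDiffAt
    (hU.mem_nhds hτ)).differentiableAt (by simp)).hasFDerivAt.comp_hasDerivAt τ h1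
  rw [iteratedFDeriv_succ_apply hU hf hτ]
  exact h2

/-- Derivatives of densities in coordinates related by a map that is projective along a line. -/
theorem iteratedFDeriv_projective {U V : Set (E n)} (hU : IsOpen U) (hV : IsOpen V)
    {ψ : E n → E n} {κ f f' : E n → 𝕜} (hf : ContDiffOn ℝ ∞ f U) (hf' : ContDiffOn ℝ ∞ f' V)
    {y : E n} (hy : y ∈ U) (hψy : ψ y ∈ V) {z v : E n} {c : ℝ} {Λ : 𝕜}
    (hcurve : ∀ s : ℝ, 1 - c * s ≠ 0 → y + (s / (1 - c * s)) • z ∈ U →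
      ψ (y + (s / (1 - c * s)) • z) = ψ y + s • v)
    (hκ : ∀ s : ℝ, 1 - c * s ≠ 0 → y + (s / (1 - c * s)) • z ∈ U →
      κ (y + (s / (1 - c * s)) • z) = κ y * absPow (1 - c * s) Λ)
    (hff' : ∀ x ∈ U, f x = κ x * f' (ψ x)) (k : ℕ) :
    κ y * iteratedFDeriv ℝ k f' (ψ y) (fun _ => v) =
      ∑ r ∈ range (k + 1), opCoeff Λ k r * (c : 𝕜) ^ (k - r) *
        iteratedFDeriv ℝ r f y (fun _ => z) := by
  have hev : ∀ᶠ s : ℝ in nhds 0, 1 - c * s ≠ 0 ∧ y + (s / (1 - c * s)) • z ∈ U ∧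
      ψ y + s • v ∈ V := by
    have c1 : ContinuousAt (fun s : ℝ => 1 - c * s) 0 := by fun_prop
    have n1 : ∀ᶠ s : ℝ in nhds 0, 1 - c * s ≠ 0 := c1.eventually_ne (by simp)
    have c2 : ContinuousAt (fun s : ℝ => y + (s / (1 - c * s)) • z) 0 := by
      refine continuousAt_const.fun_add (ContinuousAt.fun_smul ?_ continuousAt_const)
      exact ContinuousAt.div (f := fun s : ℝ => s) continuousAt_id c1 (by simp)
    have c3 : ContinuousAt (fun s : ℝ => ψ y + s • v) 0 := by fun_prop
    exact n1.and ((c2.eventually (hU.mem_nhds (by simpa using hy))).and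
      (c3.eventually (hV.mem_nhds (by simpa using hψy))))
  obtain ⟨S', hS', hS'o, h0⟩ := eventually_nhds_iff.1 hev
  -- The one-variable formula is used for the restrictions of `f` and `f'` to the two lines and
  -- evaluated at `s = 0`, where every factor `1 - c s` is `1`.
  have key := deriv_mobius (S := {τ : ℝ | y + τ • z ∈ U}) (S' := S') hS'o
    (F := fun r τ => iteratedFDeriv ℝ r f (y + τ • z) (fun _ => z))
    (G := fun r s => κ y * iteratedFDeriv ℝ r f' (ψ y + s • v) (fun _ => v))
    (Λ := Λ) (c := c)
    (fun r τ hτ => hasDerivAt_iteratedFDeriv_line hU hf y z r hτ)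
    (fun r s hs => (hasDerivAt_iteratedFDeriv_line hV hf' (ψ y) v r (hS' s hs).2.2).const_mul _)
    (fun s hs => (hS' s hs).1) (fun s hs => (hS' s hs).2.1)
    (fun s hs => by
      obtain ⟨h1, h2, h3⟩ := hS' s hs
      simp only [iteratedFDeriv_zero_apply]
      rw [hff' _ h2, hcurve s h1 h2, hκ s h1 h2]
      linear_combination (-(κ y * f' (ψ y + s • v))) * absPow_mul_neg (1 - c * s) Λ) k 0 h0
  simpa [absPow_one] using key

/-! ### Divergence of powers of affine vector fields -/

/-- Write `w = u + b y`. The contraction differentiates `H w^l` along the last factor `w`, where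
`∂_w w = b w` gives `l b`, and adds the divergence `n b` of that factor. -/
lemma divergence_pow_affine {U : Set (E n)} (hU : IsOpen U) {a : TensorFamily 𝕜 n} {H : E n → 𝕜}
    {u : E n} {b : ℝ} {l : ℕ}
    (ha : ∀ (I : Fin (l + 1) → Fin n), ∀ y ∈ U, a (l + 1) I y =
      H y * ∏ m, (((u + b • y) (I m) : ℝ) : 𝕜)) {y : E n} (hy : y ∈ U)
    (hH : DifferentiableAt ℝ H y) (I : Fin l → Fin n) :
    divergence a l I y = (fderiv ℝ H y (u + b • y) + ((n : 𝕜) + l) * b * H y) *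
      ∏ m, (((u + b • y) (I m) : ℝ) : 𝕜) := by
  set w : Fin n → E n → 𝕜 := fun i x => (((u + b • x) i : ℝ) : 𝕜) with hw
  set P : E n → 𝕜 := fun x => ∏ m, w (I m) x with hP
  have hwd : ∀ i x, HasFDerivAt (w i) ((RCLike.ofRealCLM : ℝ →L[ℝ] 𝕜).comp
      (b • (EuclideanSpace.proj i : E n →L[ℝ] ℝ))) x := by
    intro i x
    have h1 : HasFDerivAt (fun x : E n => (u + b • x) i)
        (b • (EuclideanSpace.proj i : E n →L[ℝ] ℝ)) x := by
      have := (((EuclideanSpace.proj i : E n →L[ℝ] ℝ).hasFDerivAt (x := x)).const_smul b).const_add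
        (u i)
      simpa using this
    exact (RCLike.ofRealCLM : ℝ →L[ℝ] 𝕜).hasFDerivAt.comp x h1
  have hPd : HasFDerivAt P (∑ m, (∏ j ∈ univ.erase m, w (I j) y) •
      ((RCLike.ofRealCLM : ℝ →L[ℝ] 𝕜).comp (b • (EuclideanSpace.proj (I m) : E n →L[ℝ] ℝ)))) y :=
    HasFDerivAt.finsetProd fun m _ => hwd (I m) y
  have hproj : ∀ (i : Fin n) (x : E n), (EuclideanSpace.proj i : E n →L[ℝ] ℝ) x = x i :=
    fun _ _ => rfl
  have hPw : fderiv ℝ P y (u + b • y) = (l : 𝕜) * b * P y := by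
    rw [hPd.fderiv]
    simp only [_root_.sum_apply, _root_.smul_apply, ContinuousLinearMap.comp_apply,
      hproj, RCLike.ofRealCLM_apply, smul_eq_mul, RCLike.ofReal_mul]
    have e : ∀ m ∈ (univ : Finset (Fin l)), (∏ j ∈ univ.erase m, w (I j) y) *
        ((b : 𝕜) * (((u + b • y) (I m) : ℝ) : 𝕜)) = b * P y := by
      intro m hm
      change (∏ j ∈ univ.erase m, w (I j) y) * ((b : 𝕜) * w (I m) y) = b * P y
      simp only [hP]
      rw [← prod_erase_mul univ (fun m => w (I m) y) hm]
      ring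
    rw [sum_congr rfl e]
    simp [mul_assoc]
  have hterm : ∀ j, fderiv ℝ (a (l + 1) (Fin.snoc I j)) y (stdVec j) =
      ((u + b • y) j : ℝ) • fderiv ℝ (fun x => H x * P x) y (stdVec j) + b * (H y * P y) := by
    intro j
    have e1 : a (l + 1) (Fin.snoc I j) =ᶠ[nhds y] fun x => (H x * P x) * w j x := by
      filter_upwards [hU.mem_nhds hy] with x hx
      rw [ha _ x hx, Fin.prod_univ_castSucc]
      simp only [Fin.snoc_castSucc, Fin.snoc_last, hP, hw]
      ring
    have hHP : DifferentiableAt ℝ (fun x => H x * P x) y := hH.fun_mul hPd.differentiableAt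
    rw [e1.fderiv_eq, (hHP.hasFDerivAt.fun_mul (hwd j y)).fderiv]
    simp only [_root_.add_apply, _root_.smul_apply,
      ContinuousLinearMap.comp_apply, hproj, RCLike.ofRealCLM_apply,
      smul_eq_mul, RCLike.ofReal_mul, RCLike.real_smul_eq_coe_mul]
    simp only [PiLp.single_apply, if_true, RCLike.ofReal_one, hw]
    ring
  have hsum : fderiv ℝ (fun x => H x * P x) y (u + b • y) =
      (fderiv ℝ H y (u + b • y) + (l : 𝕜) * b * H y) * P y := by
    rw [(hH.hasFDerivAt.fun_mul hPd.differentiableAt.hasFDerivAt).fderiv]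
    simp only [_root_.add_apply, _root_.smul_apply, smul_eq_mul, hPw]
    ring
  rw [divergence]
  simp only [hterm]
  rw [sum_add_distrib, ← sum_apply_mul_apply_stdVec (fderiv ℝ (fun x => H x * P x) y) (u + b • y),
    hsum, sum_const, card_univ, Fintype.card_fin, nsmul_eq_mul]
  change _ = _ * P y
  ring

end

/-! ### The family transforming the power of a constant vector field -/

section

variable {𝕜 : Type*} [RCLike 𝕜] {n : ℕ}

/-- Coefficients in the iterated divergence of a transformed power of a constant vector field. -/
def divCoeff (x d j : ℕ) : 𝕜 := (d.choose j : 𝕜) * (x.ascFactorial (d - j) : 𝕜)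

lemma divCoeff_of_lt (x : ℕ) {d j : ℕ} (h : d < j) : (divCoeff x d j : 𝕜) = 0 := by
  simp [divCoeff, Nat.choose_eq_zero_of_lt h]

lemma divCoeff_succ_zero (x d : ℕ) :
    (divCoeff x (d + 1) 0 : 𝕜) = x * divCoeff (x + 1) d 0 := by
  have h : x.ascFactorial (d + 1) = x * (x + 1).ascFactorial d := by
    have := Nat.succ_ascFactorial x d
    rw [Nat.ascFactorial_succ]
    lia
  simp [divCoeff, h]

/-- The recursion that one more divergence produces in `iterate_divergence_projective`; the
parameter drops from `x + 1` to `x` as the tensor degree drops by one. -/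
lemma divCoeff_succ_succ (x d j : ℕ) :
    (divCoeff x (d + 1) (j + 1) : 𝕜) =
      ((x : 𝕜) - (j + 1 : ℕ)) * divCoeff (x + 1) d (j + 1) + divCoeff (x + 1) d j := by
  rcases lt_trichotomy d j with h | rfl | h
  · rw [divCoeff_of_lt x (by omega), divCoeff_of_lt _ (by omega), divCoeff_of_lt _ h]; simp
  · rw [divCoeff_of_lt _ (Nat.lt_succ_self d)]
    simp [divCoeff]
  · obtain ⟨e, rfl⟩ : ∃ e, d = j + 1 + e := ⟨d - (j + 1), by omega⟩
    have h1 : (x + 1).ascFactorial (e + 1) = (x + 1).ascFactorial e * (x + 1 + e) := by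
      rw [Nat.ascFactorial_succ]; ring
    have h2 : x.ascFactorial (e + 1) = x * (x + 1).ascFactorial e := by
      have := Nat.succ_ascFactorial x e
      rw [Nat.ascFactorial_succ]
      lia
    have h3 : (j + 1 + e).choose (j + 1) * (j + 1) = (j + 1 + e).choose j * (e + 1) := by
      rw [Nat.choose_succ_right_eq]
      congr 1
      omega
    have h3' : ((j + 1 + e).choose (j + 1) : 𝕜) * (j + 1) = (j + 1 + e).choose j * (e + 1) := by
      exact_mod_cast h3
    simp only [divCoeff, show j + 1 + e + 1 - (j + 1) = e + 1 by omega,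
      show j + 1 + e - (j + 1) = e by omega, show j + 1 + e - j = e + 1 by omega, h1, h2,
      Nat.choose_succ_succ']
    push_cast
    linear_combination ((x + 1).ascFactorial e : 𝕜) * h3'

/-- The iterated divergence of a transformed power of a constant vector field. -/
theorem iterate_divergence_projective {U V : Set (E n)} (hU : IsOpen U) (hV : IsOpen V)
    {ψ : E n → E n} {q : E n → ℝ} {h : E n → 𝕜} {u v : E n} {b : ℝ}
    (hq : ∀ y ∈ U, DifferentiableAt ℝ q y) (hψ : ∀ y ∈ U, DifferentiableAt ℝ ψ y)
    (hψV : ∀ y ∈ U, ψ y ∈ V) (hh : ContDiffOn ℝ ∞ h V) (hq0 : ∀ y ∈ U, q y ≠ 0)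
    (hqw : ∀ y ∈ U, fderiv ℝ q y (u + b • y) = b * q y)
    (hψw : ∀ y ∈ U, fderiv ℝ ψ y (u + b • y) = (q y)⁻¹ • v)
    {a : TensorFamily 𝕜 n} {k r : ℕ} {C : 𝕜} (hr : r ≤ k)
    (ha : ∀ (I : Fin r → Fin n), ∀ y ∈ U, a r I y =
      C * ((q y : 𝕜) ^ k * h (ψ y)) * ∏ m, (((u + b • y) (I m) : ℝ) : 𝕜)) (d : ℕ) :
    ∀ l, l + d = r → ∀ (I : Fin l → Fin n), ∀ y ∈ U, (divergence^[d] a) l I y =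
      C * (∑ j ∈ range (d + 1), divCoeff (k + n + l) d j * (b : 𝕜) ^ (d - j) *
        ((q y : 𝕜) ^ (k - j) * iteratedFDeriv ℝ j h (ψ y) (fun _ => v))) *
        ∏ m, (((u + b • y) (I m) : ℝ) : 𝕜) := by
  induction d with
  | zero =>
    rintro l rfl I y hy
    simp only [Function.iterate_zero, id]
    rw [show l + 0 = l from rfl] at ha
    rw [ha I y hy]
    simp [divCoeff]
  | succ d ih =>
    intro l hl I y hy
    have dterm : ∀ j, HasFDerivAt (fun x => iteratedFDeriv ℝ j h (ψ x) (fun _ => v))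
        ((fderiv ℝ (fun z => iteratedFDeriv ℝ j h z (fun _ => v)) (ψ y)).comp (fderiv ℝ ψ y)) y := by
      intro j
      exact (((contDiffOn_iteratedFDeriv_apply hV hh j (fun _ => v)).contDiffAt
        (hV.mem_nhds (hψV y hy))).differentiableAt (by simp)).hasFDerivAt.comp y
          (hψ y hy).hasFDerivAt
    have qterm : ∀ e : ℕ, HasFDerivAt (fun x => (q x : 𝕜) ^ e)
        (((e : 𝕜) * (q y : 𝕜) ^ (e - 1)) • ((RCLike.ofRealCLM : ℝ →L[ℝ] 𝕜).comp (fderiv ℝ q y))) y := by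
      intro e
      have h1 : HasFDerivAt (fun x => (q x : 𝕜)) ((RCLike.ofRealCLM : ℝ →L[ℝ] 𝕜).comp
        (fderiv ℝ q y)) y := (RCLike.ofRealCLM : ℝ →L[ℝ] 𝕜).hasFDerivAt.comp y
          (hq y hy).hasFDerivAt
      have := h1.pow e
      refine this.congr_fderiv ?_
      ext
      simp [mul_assoc]
    set H : E n → 𝕜 := fun x => C * (∑ j ∈ range (d + 1), divCoeff (k + n + (l + 1)) d j *
        (b : 𝕜) ^ (d - j) *
        ((q x : 𝕜) ^ (k - j) * iteratedFDeriv ℝ j h (ψ x) (fun _ => v))) with hH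
    have hHd := (HasFDerivAt.fun_sum (u := range (d + 1)) fun j _ =>
      ((qterm (k - j)).fun_mul (dterm j)).const_mul
        (divCoeff (k + n + (l + 1)) d j * (b : 𝕜) ^ (d - j))).const_mul C
    -- Along `w`, the power `q ^ (k - j)` is multiplied by `(k - j) b`, while the derivative of `h`
    -- gains one order and loses one factor `q`. Together with `(n + l) b` from the divergence this
    -- gives `(x - j) b` with `x = k + n + l`.
    have hHd' : fderiv ℝ H y (u + b • y) = C * ∑ j ∈ range (d + 1),
        divCoeff (k + n + (l + 1)) d j * (b : 𝕜) ^ (d - j) *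
        (((k : 𝕜) - j) * b * ((q y : 𝕜) ^ (k - j) * iteratedFDeriv ℝ j h (ψ y) (fun _ => v)) +
          (q y : 𝕜) ^ (k - (j + 1)) * iteratedFDeriv ℝ (j + 1) h (ψ y) (fun _ => v)) := by
      rw [hHd.fderiv]
      simp only [_root_.smul_apply, _root_.sum_apply, _root_.add_apply,
        ContinuousLinearMap.comp_apply, smul_eq_mul, hqw y hy, hψw y hy, map_smul]
      congr 1
      refine sum_congr rfl fun j hj => ?_
      rw [mem_range] at hj
      obtain ⟨e, he⟩ : ∃ e, k - j = e + 1 := ⟨k - j - 1, by omega⟩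
      have hcast : (k : 𝕜) - j = (e : 𝕜) + 1 := by
        rw [← Nat.cast_sub (by omega), he]; simp
      have hqy : (q y : 𝕜) ≠ 0 := by exact_mod_cast hq0 y hy
      rw [hcast, he, show k - (j + 1) = e by omega, iteratedFDeriv_succ_apply hV hh (hψV y hy),
        show Fin.tail (fun _ : Fin (j + 1) => v) = fun _ => v from rfl]
      simp only [RCLike.ofRealCLM_apply, RCLike.real_smul_eq_coe_mul, RCLike.ofReal_mul,
        RCLike.ofReal_inv, Nat.add_sub_cancel, Nat.cast_add, Nat.cast_one]
      field_simp
      ring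
    rw [Function.iterate_succ_apply']
    rw [divergence_pow_affine hU (fun I' y' hy' => ih (l + 1) (by omega) I' y' hy') hy
      hHd.differentiableAt I, hHd']
    congr 1
    rw [show ∀ S T : 𝕜, C * S + ((n : 𝕜) + l) * b * (C * T) = C * (S + ((n : 𝕜) + l) * b * T) from
      fun S T => by ring]
    congr 1
    rw [mul_sum, ← sum_add_distrib]
    set Q : ℕ → 𝕜 := fun j => (q y : 𝕜) ^ (k - j) * iteratedFDeriv ℝ j h (ψ y) (fun _ => v) with hQ
    set x := k + n + l with hx
    have e1 : ∀ j ∈ range (d + 1), divCoeff (k + n + (l + 1)) d j * (b : 𝕜) ^ (d - j) *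
        (((k : 𝕜) - j) * b * ((q y : 𝕜) ^ (k - j) * iteratedFDeriv ℝ j h (ψ y) (fun _ => v)) +
          (q y : 𝕜) ^ (k - (j + 1)) * iteratedFDeriv ℝ (j + 1) h (ψ y) (fun _ => v)) +
        ((n : 𝕜) + l) * b * (divCoeff (k + n + (l + 1)) d j * (b : 𝕜) ^ (d - j) *
        ((q y : 𝕜) ^ (k - j) * iteratedFDeriv ℝ j h (ψ y) (fun _ => v))) =
        ((x : 𝕜) - j) * divCoeff (x + 1) d j * (b : 𝕜) ^ (d + 1 - j) * Q j +
          divCoeff (x + 1) d j * (b : 𝕜) ^ (d + 1 - (j + 1)) * Q (j + 1) := by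
      intro j hj
      rw [mem_range] at hj
      rw [show d + 1 - j = (d - j) + 1 by omega, show d + 1 - (j + 1) = d - j by omega,
        show k + n + (l + 1) = x + 1 by omega]
      simp only [hQ, hx]
      push_cast
      ring
    rw [sum_congr rfl e1, sum_add_distrib]
    have e2 : ∑ j ∈ range (d + 1), ((x : 𝕜) - j) * divCoeff (x + 1) d j *
          (b : 𝕜) ^ (d + 1 - j) * Q j =
        ∑ j ∈ range (d + 2), ((x : 𝕜) - j) * divCoeff (x + 1) d j *
          (b : 𝕜) ^ (d + 1 - j) * Q j := by
      rw [sum_range_succ _ (d + 1), divCoeff_of_lt _ (Nat.lt_succ_self d)]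
      ring
    rw [e2, sum_range_succ' _ (d + 1), sum_range_succ' _ (d + 1), divCoeff_succ_zero]
    simp only [divCoeff_succ_succ]
    rw [add_right_comm, ← sum_add_distrib]
    congr 1
    · exact sum_congr rfl fun r _ => by ring
    · simp [hQ]

/-- The coefficients of the operator which corresponds to `h v^{i₁} ⋯ v^{i_k} ∂_{i₁} ⋯ ∂_{i_k}`
under a linear-fractional transformation. -/
def powFamily (Λ : 𝕜) (k : ℕ) (q : E n → ℝ) (h : E n → 𝕜) (u : E n) (b : ℝ) : TensorFamily 𝕜 n :=
  fun r J y => (opCoeff Λ k r * (b : 𝕜) ^ (k - r)) * ((q y : 𝕜) ^ k * h y) *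
    ∏ m, (((u + b • y) (J m) : ℝ) : 𝕜)

lemma isSymmetricOn_powFamily (Λ : 𝕜) (k : ℕ) {U : Set (E n)} {q : E n → ℝ} {h : E n → 𝕜} (u : E n)
    (b : ℝ) (hq : ContDiffOn ℝ ∞ q U) (hh : ContDiffOn ℝ ∞ h U) :
    IsSymmetricOn k U (powFamily Λ k q h u b) := by
  refine ⟨fun r J => ?_, fun r J π y hy => ?_, fun r hr J y hy => ?_⟩
  · have h1 : ContDiffOn ℝ ∞ (fun y => (q y : 𝕜)) U :=
      (RCLike.ofRealCLM : ℝ →L[ℝ] 𝕜).contDiff.comp_contDiffOn hq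
    refine (contDiffOn_const.mul ((h1.pow k).mul hh)).mul (ContDiff.contDiffOn ?_)
    refine contDiff_prod fun m _ => (RCLike.ofRealCLM : ℝ →L[ℝ] 𝕜).contDiff.comp ?_
    exact (EuclideanSpace.proj (J m) : E n →L[ℝ] ℝ).contDiff.comp
      ((contDiff_const (c := u)).add ((contDiff_const (c := b)).smul contDiff_id))
  · simp only [powFamily, Function.comp_apply]
    rw [Equiv.prod_comp π (fun m => (((u + b • y) (J m) : ℝ) : 𝕜))]
  · simp [powFamily, opCoeff_of_lt Λ hr]

/-- The symbol of a transformed power of a constant vector field. -/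
theorem symbolTensor_powFamily {U V : Set (E n)} (hU : IsOpen U) (hV : IsOpen V)
    {ψ : E n → E n} {q : E n → ℝ} {h : E n → 𝕜} {u v : E n} {b : ℝ}
    (hq : ContDiffOn ℝ ∞ q U) (hψ : ContDiffOn ℝ ∞ ψ U)
    (hψV : ∀ y ∈ U, ψ y ∈ V) (hh : ContDiffOn ℝ ∞ h V) (hq0 : ∀ y ∈ U, q y ≠ 0)
    (hqw : ∀ y ∈ U, fderiv ℝ q y (u + b • y) = b * q y)
    (hψw : ∀ y ∈ U, fderiv ℝ ψ y (u + b • y) = (q y)⁻¹ • v) (μ : 𝕜) {k N : ℕ} (hk : k ≤ N)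
    {l : ℕ} (hl : l ≤ k) (I : Fin l → Fin n) {y : E n} (hy : y ∈ U) :
    symbolTensor μ N (powFamily (((n : 𝕜) + 1) * μ) k q (h ∘ ψ) u b) l I y =
      symbolConst n μ k l * (q y : 𝕜) ^ l * iteratedFDeriv ℝ (k - l) h (ψ y) (fun _ => v) *
        ∏ m, (((u + b • y) (I m) : ℝ) : 𝕜) := by
  have hhψ : ContDiffOn ℝ ∞ (h ∘ ψ) U := hh.comp hψ hψV
  have hdq : ∀ y ∈ U, DifferentiableAt ℝ q y := fun y hy =>
    (hq.contDiffAt (hU.mem_nhds hy)).differentiableAt (by simp)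
  have hdψ : ∀ y ∈ U, DifferentiableAt ℝ ψ y := fun y hy =>
    (hψ.contDiffAt (hU.mem_nhds hy)).differentiableAt (by simp)
  rw [symbolTensor_mono hU (isSymmetricOn_powFamily _ k u b hq hhψ) hk μ I hy]
  obtain ⟨D, rfl⟩ : ∃ D, k = l + D := ⟨k - l, by omega⟩
  set a := powFamily (((n : 𝕜) + 1) * μ) (l + D) q (h ∘ ψ) u b with ha
  set P := ∏ m, (((u + b • y) (I m) : ℝ) : 𝕜) with hP
  set T : ℕ → 𝕜 := fun j => iteratedFDeriv ℝ j h (ψ y) (fun _ => v) with hT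
  have e1 : symbolTensor μ (l + D) a l I y = ∑ i ∈ range (D + 1),
      symbolConst n μ (l + i) l * (divergence^[i] a) l I y := by
    rw [symbolTensor, ← Ico_add_one_right_eq_Icc, sum_Ico_eq_sum_range]
    exact sum_congr (by congr 1; omega) fun i _ => by simp
  -- The powers of `b` from the operator and from the divergences combine to `b ^ (D - j)`,
  -- independent of `i`. For fixed `j` the sum over `i` is therefore the combinatorial identity,
  -- which leaves only `j = D`.
  have e2 : ∀ i ∈ range (D + 1), symbolConst n μ (l + i) l * (divergence^[i] a) l I y =
      ∑ j ∈ range (D + 1), (symbolConst n μ (l + i) l *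
        opCoeff (((n : 𝕜) + 1) * μ) (l + D) (l + i) * divCoeff (2 * l + n + D) i j) *
        ((b : 𝕜) ^ (D - j) * (q y : 𝕜) ^ (l + D - j) * T j * P) := by
    intro i hi
    rw [mem_range] at hi
    rw [iterate_divergence_projective hU hV hdq hdψ hψV hh hq0 hqw hψw (r := l + i) (k := l + D)
      (by omega) (fun I y _ => rfl) i l rfl I y hy]
    rw [mul_sum, sum_mul, mul_sum, sum_subset (range_subset_range.2 (by omega : i + 1 ≤ D + 1))]
    · refine sum_congr rfl fun j _ => ?_
      rw [show l + D + n + l = 2 * l + n + D by ring]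
      rcases lt_or_ge i j with hij | hij
      · simp [divCoeff_of_lt _ hij]
      · rw [show D - j = (l + D - (l + i)) + (i - j) by omega, pow_add]
        ring
    · intro j _ hj
      rw [divCoeff_of_lt _ (by simpa using hj)]
      simp
  rw [e1, sum_congr rfl e2, sum_comm]
  simp only [← sum_mul]
  rw [sum_eq_single D]
  · have := sum_symbolConst_mul_opCoeff n μ l D D le_rfl
    simp only [if_true] at this
    simp only [divCoeff]
    rw [this]
    have hTD : ∀ m, m = D → iteratedFDeriv ℝ m h (ψ y) (fun _ => v) = T D := by
      rintro m rfl
      rfl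
    rw [hTD (l + D - l) (by omega)]
    simp only [Nat.sub_self, pow_zero, Nat.add_sub_cancel]
    ring
  · intro j hj hjD
    have := sum_symbolConst_mul_opCoeff n μ l D j (by simpa [Nat.lt_succ_iff] using hj)
    rw [if_neg hjD] at this
    simp only [divCoeff]
    rw [this, zero_mul]
  · intro hD
    simp at hD

/-- Here `q` and `w` enter only through the pairing of `ξ` with `q w`, the field that `ψ` maps to
`v`. This makes the invariance of the symbol visible. -/
lemma fiberPoly_symbolTensor_powFamily {U V : Set (E n)} (hU : IsOpen U) (hV : IsOpen V)
    {ψ : E n → E n} {q : E n → ℝ} {h : E n → 𝕜} {u v : E n} {b : ℝ}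
    (hq : ContDiffOn ℝ ∞ q U) (hψ : ContDiffOn ℝ ∞ ψ U)
    (hψV : ∀ y ∈ U, ψ y ∈ V) (hh : ContDiffOn ℝ ∞ h V) (hq0 : ∀ y ∈ U, q y ≠ 0)
    (hqw : ∀ y ∈ U, fderiv ℝ q y (u + b • y) = b * q y)
    (hψw : ∀ y ∈ U, fderiv ℝ ψ y (u + b • y) = (q y)⁻¹ • v) (μ : 𝕜) {k N : ℕ} (hk : k ≤ N)
    {y : E n} (hy : y ∈ U) (ξ : Fin n → ℝ) :
    fiberPoly N (symbolTensor μ N (powFamily (((n : 𝕜) + 1) * μ) k q (h ∘ ψ) u b)) y ξ =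
      ∑ l ∈ range (k + 1), symbolConst n μ k l *
        iteratedFDeriv ℝ (k - l) h (ψ y) (fun _ => v) *
        ((q y * ∑ i, ξ i * (u + b • y) i : ℝ) : 𝕜) ^ l := by
  have hhψ : ContDiffOn ℝ ∞ (h ∘ ψ) U := hh.comp hψ hψV
  have hs := isSymmetricOn_powFamily (((n : 𝕜) + 1) * μ) k u b hq hhψ
  rw [show fiberPoly N (symbolTensor μ N (powFamily (((n : 𝕜) + 1) * μ) k q (h ∘ ψ) u b)) y ξ =
      fiberPoly N (symbolTensor μ k (powFamily (((n : 𝕜) + 1) * μ) k q (h ∘ ψ) u b)) y ξ from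
    sum_congr rfl fun l _ => sum_congr rfl fun I _ => by
      rw [symbolTensor_mono hU hs hk μ I hy]]
  rw [fiberPoly_mono (hs.symbolTensor hU μ) hk ξ hy, fiberPoly]
  refine sum_congr rfl fun l hl => ?_
  rw [mem_range] at hl
  have e : ∀ I : Fin l → Fin n, symbolTensor μ k
      (powFamily (((n : 𝕜) + 1) * μ) k q (h ∘ ψ) u b) l I y * ∏ m, (ξ (I m) : 𝕜) =
      symbolConst n μ k l * iteratedFDeriv ℝ (k - l) h (ψ y) (fun _ => v) * ((q y : 𝕜) ^ l *
        ∏ m, ((ξ (I m) * (u + b • y) (I m) : ℝ) : 𝕜)) := by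
    intro I
    rw [symbolTensor_powFamily hU hV hq hψ hψV hh hq0 hqw hψw μ le_rfl (by omega) I hy]
    simp only [RCLike.ofReal_mul, prod_mul_distrib]
    ring
  rw [sum_congr rfl fun I _ => e I, ← mul_sum, ← mul_sum,
    ← Fintype.sum_pow (fun i => ((ξ i * (u + b • y) i : ℝ) : 𝕜)) l, ← mul_pow]
  congr 2
  push_cast
  rfl

end

/-! ### Linear-fractional transformations -/

section

variable {n : ℕ}

/-- The linear part of the affine function `homogImage g · j`. -/
def homogLinear (g : Matrix.GeneralLinearGroup (Fin (n + 1)) ℝ) (j : Fin (n + 1)) : E n →L[ℝ] ℝ :=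
  ∑ i : Fin n, (g : Matrix (Fin (n + 1)) (Fin (n + 1)) ℝ) j i.succ •
    (EuclideanSpace.proj i : E n →L[ℝ] ℝ)

lemma homogLinear_apply (g : Matrix.GeneralLinearGroup (Fin (n + 1)) ℝ) (j : Fin (n + 1))
    (w : E n) : homogLinear g j w =
      ∑ i : Fin n, (g : Matrix (Fin (n + 1)) (Fin (n + 1)) ℝ) j i.succ * w i := by
  simp only [homogLinear, _root_.sum_apply, _root_.smul_apply, smul_eq_mul]
  rfl

lemma homogImage_eq (g : Matrix.GeneralLinearGroup (Fin (n + 1)) ℝ) (y : E n) (j : Fin (n + 1)) :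
    homogImage g y j = (g : Matrix (Fin (n + 1)) (Fin (n + 1)) ℝ) j 0 + homogLinear g j y := by
  rw [homogImage, Matrix.mulVec, dotProduct, Fin.sum_univ_succ, homogLinear_apply]
  simp

lemma homogImage_add_smul (g : Matrix.GeneralLinearGroup (Fin (n + 1)) ℝ) (y w : E n) (t : ℝ)
    (j : Fin (n + 1)) :
    homogImage g (y + t • w) j = homogImage g y j + t * homogLinear g j w := by
  simp only [homogImage_eq, map_add, map_smul, smul_eq_mul]
  ring

lemma hasFDerivAt_homogImage (g : Matrix.GeneralLinearGroup (Fin (n + 1)) ℝ) (j : Fin (n + 1))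
    (y : E n) : HasFDerivAt (fun y => homogImage g y j) (homogLinear g j) y := by
  simp only [homogImage_eq]
  exact (homogLinear g j).hasFDerivAt.const_add _

lemma contDiff_homogImage (g : Matrix.GeneralLinearGroup (Fin (n + 1)) ℝ) (j : Fin (n + 1)) :
    ContDiff ℝ ∞ (fun y => homogImage g y j) := by
  simp only [homogImage_eq]
  exact contDiff_const.add (homogLinear g j).contDiff

/-- A constant vector field is transformed to a multiple of an affine one. -/
lemma exists_homogLinear_eq (g : Matrix.GeneralLinearGroup (Fin (n + 1)) ℝ) (v : E n) :
    ∃ (u : E n) (b : ℝ), ∀ (y : E n) (j : Fin (n + 1)), homogLinear g j (u + b • y) =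
      (Fin.cons 0 v.ofLp : Fin (n + 1) → ℝ) j + b * homogImage g y j := by
  -- In homogeneous coordinates `v` is the direction `(0, v)`. Its preimage `z` under `g` induces,
  -- up to a factor, the field `z' - z₀ y` in the affine chart; hence `u = z'` and `b = -z₀`.
  set z : Fin (n + 1) → ℝ := ((g⁻¹ : Matrix.GeneralLinearGroup (Fin (n + 1)) ℝ) :
    Matrix (Fin (n + 1)) (Fin (n + 1)) ℝ).mulVec (Fin.cons 0 v.ofLp) with hz
  have hgz : (g : Matrix (Fin (n + 1)) (Fin (n + 1)) ℝ).mulVec z = Fin.cons 0 v.ofLp := by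
    rw [hz, Matrix.mulVec_mulVec, ← Matrix.GeneralLinearGroup.coe_mul, mul_inv_cancel,
      Matrix.GeneralLinearGroup.coe_one, Matrix.one_mulVec]
  refine ⟨WithLp.toLp 2 fun i => z i.succ, -z 0, fun y j => ?_⟩
  have h1 := congrFun hgz j
  rw [Matrix.mulVec, dotProduct, Fin.sum_univ_succ] at h1
  rw [map_add, map_smul, homogImage_eq, ← h1]
  simp only [homogLinear_apply, smul_eq_mul]
  ring

/-- On `U`, the map `ψ` is the linear-fractional transformation with matrix `g`. -/
def IsLinearFractionalOn (g : Matrix.GeneralLinearGroup (Fin (n + 1)) ℝ) (U : Set (E n))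
    (ψ : E n → E n) : Prop :=
  ∀ y ∈ U, homogImage g y 0 ≠ 0 ∧ ∀ i : Fin n, ψ y i = homogImage g y i.succ / homogImage g y 0

variable {g : Matrix.GeneralLinearGroup (Fin (n + 1)) ℝ} {U : Set (E n)} {ψ : E n → E n}

lemma IsLinearFractionalOn.contDiffOn (hψ : IsLinearFractionalOn g U ψ) : ContDiffOn ℝ ∞ ψ U := by
  rw [contDiffOn_euclidean]
  intro i
  refine ContDiffOn.congr (f := fun y => homogImage g y i.succ / homogImage g y 0) ?_
    fun y hy => (hψ y hy).2 i
  exact (contDiff_homogImage g _).contDiffOn.div (contDiff_homogImage g _).contDiffOn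
    fun y hy => (hψ y hy).1

/-- Obtained by differentiating the identity of denominator times `ψ y i` with the affine numerator.
-/
lemma IsLinearFractionalOn.fderiv_apply (hψ : IsLinearFractionalOn g U ψ) (hU : IsOpen U) {y : E n}
    (hy : y ∈ U) (w : E n) (i : Fin n) : (fderiv ℝ ψ y w) i =
      (homogLinear g i.succ w - ψ y i * homogLinear g 0 w) / homogImage g y 0 := by
  have hd : DifferentiableAt ℝ ψ y :=
    (hψ.contDiffOn.contDiffAt (hU.mem_nhds hy)).differentiableAt (by simp)
  have h1 := ((EuclideanSpace.proj i : E n →L[ℝ] ℝ).hasFDerivAt.comp y hd.hasFDerivAt)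
  have h2 : HasFDerivAt (fun x => homogImage g x 0 * ψ x i)
      (homogImage g y 0 • ((EuclideanSpace.proj i : E n →L[ℝ] ℝ).comp (fderiv ℝ ψ y)) +
        ψ y i • homogLinear g 0) y := (hasFDerivAt_homogImage g 0 y).fun_mul h1
  have h3 : (fun x => homogImage g x 0 * ψ x i) =ᶠ[nhds y] fun x => homogImage g x i.succ := by
    filter_upwards [hU.mem_nhds hy] with x hx
    rw [(hψ x hx).2 i, mul_div_cancel₀ _ (hψ x hx).1]
  have h4 := (h2.congr_of_eventuallyEq h3.symm).unique (hasFDerivAt_homogImage g i.succ y)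
  have h5 := congrArg (fun L : E n →L[ℝ] ℝ => L w) h4
  have h6 : homogImage g y 0 * (fderiv ℝ ψ y w) i + ψ y i * homogLinear g 0 w =
    homogLinear g i.succ w := h5
  rw [eq_div_iff (hψ y hy).1]
  linarith

/-- The Jacobian matrix. -/
def jacobian (ψ : E n → E n) (y : E n) : Matrix (Fin n) (Fin n) ℝ :=
  Matrix.of fun i j => (fderiv ℝ ψ y (stdVec j)) i

/-- Column operations replace the first column of `g` by `g (1, y)` without changing the
determinant. Subtracting `ψ y i` times the top row from the others clears this column below its top
entry `q`, and the remaining block is `q` times the Jacobian matrix. -/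
lemma IsLinearFractionalOn.det_jacobian (hψ : IsLinearFractionalOn g U ψ) (hU : IsOpen U) {y : E n}
    (hy : y ∈ U) : (jacobian ψ y).det =
      (g : Matrix (Fin (n + 1)) (Fin (n + 1)) ℝ).det / homogImage g y 0 ^ (n + 1) := by
  set G := (g : Matrix (Fin (n + 1)) (Fin (n + 1)) ℝ) with hG
  set c : Fin (n + 1) → ℝ := Fin.cons 1 y.ofLp with hc
  set r : Fin (n + 1) → ℝ := Fin.cons 0 (ψ y).ofLp with hr
  have hq := (hψ y hy).1
  have h1 : (G.updateCol 0 (homogImage g y)).det = G.det := by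
    have := Matrix.det_updateCol_sum G 0 c
    have hcol : (fun k => ∑ i, c i • G k i) = homogImage g y := by
      funext k
      simp only [homogImage, Matrix.mulVec, dotProduct, smul_eq_mul, mul_comm, hc, hG]
    rw [hcol] at this
    rw [this, hc, Fin.cons_zero, one_smul]
  set A := G.updateCol 0 (homogImage g y) with hA
  have hA0 : ∀ k, A k 0 = homogImage g y k := fun k => by simp [hA]
  have hAs : ∀ k (j : Fin n), A k j.succ = G k j.succ := fun k j => by
    simp [hA]
  set B : Matrix (Fin (n + 1)) (Fin (n + 1)) ℝ := Matrix.of fun i j => A i j - r i * A 0 j with hB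
  have h2 : A.det = B.det :=
    Matrix.det_eq_of_forall_row_eq_smul_add_const r 0 (by simp [hr]) fun i j => by
      simp [hB, hr]
  have h3 : B.det = homogImage g y 0 * (B.submatrix Fin.succ Fin.succ).det := by
    rw [Matrix.det_succ_column_zero, Fin.sum_univ_succ, sum_eq_zero]
    · simp [hB, hr, hA0]
    · intro i _
      have : B i.succ 0 = 0 := by
        simp only [hB, Matrix.of_apply, hA0, hr, Fin.cons_succ]
        rw [(hψ y hy).2 i]
        field_simp
        ring
      rw [this]
      ring
  have h4 : B.submatrix Fin.succ Fin.succ = homogImage g y 0 • jacobian ψ y := by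
    ext i j
    simp only [hB, Matrix.submatrix_apply, Matrix.of_apply, hAs, hr, Fin.cons_succ, jacobian,
      Matrix.smul_apply, smul_eq_mul, hψ.fderiv_apply hU hy]
    rw [mul_div_cancel₀ _ hq]
    simp [homogLinear_apply, hG]
  rw [eq_div_iff (pow_ne_zero _ hq), ← h1, h2, h3, h4, Matrix.det_smul, Fintype.card_fin]
  ring

end

/-! ### Corresponding operators -/

section

variable {𝕜 : Type*} [RCLike 𝕜] {n : ℕ}

/-- The operators with coefficients `a` and `a'` and their symbols correspond to each other under
the map `ψ : U → V` of coordinates and the multiplication of functions by `κ`. -/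
structure CorrespondOn (U V : Set (E n)) (ψ : E n → E n) (κ : E n → 𝕜) (μ : 𝕜) (N : ℕ)
    (a a' : TensorFamily 𝕜 n) : Prop where
  left : IsSymmetricOn N U a
  right : IsSymmetricOn N V a'
  applyOp_eq : ∀ f f' : E n → 𝕜, ContDiffOn ℝ ∞ f U → ContDiffOn ℝ ∞ f' V →
    (∀ x ∈ U, f x = κ x * f' (ψ x)) → ∀ y ∈ U, applyOp N a f y = κ y * applyOp N a' f' (ψ y)
  fiberPoly_eq : ∀ y ∈ U, ∀ ξ ξ' : Fin n → ℝ,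
    (∀ w : E n, ∑ i, ξ i * w i = ∑ j, ξ' j * (fderiv ℝ ψ y w) j) →
      fiberPoly N (symbolTensor μ N a) y ξ = fiberPoly N (symbolTensor μ N a') (ψ y) ξ'

variable {U V : Set (E n)} {ψ : E n → E n} {κ : E n → 𝕜} {μ : 𝕜} {N : ℕ}

lemma fiberPoly_congr {a b : TensorFamily 𝕜 n} {y : E n}
    (h : ∀ k (I : Fin k → Fin n), a k I y = b k I y) (ξ : Fin n → ℝ) :
    fiberPoly N a y ξ = fiberPoly N b y ξ := by
  simp only [fiberPoly, h]

lemma CorrespondOn.zero : CorrespondOn U V ψ κ μ N (fun _ _ _ => 0) (fun _ _ _ => 0) := by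
  refine ⟨(IsSymmetricOn.zero U).mono (Nat.zero_le N), (IsSymmetricOn.zero V).mono (Nat.zero_le N),
    fun f f' _ _ _ y _ => ?_, fun y _ ξ ξ' _ => ?_⟩
  · simp [applyOp]
  · simp [fiberPoly, symbolTensor, iterate_divergence_zero]

lemma CorrespondOn.add (hU : IsOpen U) (hV : IsOpen V) (hψV : ∀ y ∈ U, ψ y ∈ V)
    {a a' b b' : TensorFamily 𝕜 n} (ha : CorrespondOn U V ψ κ μ N a a')
    (hb : CorrespondOn U V ψ κ μ N b b') :
    CorrespondOn U V ψ κ μ N (fun k I y => a k I y + b k I y) (fun k I y => a' k I y + b' k I y) := by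
  refine ⟨ha.left.add hb.left, ha.right.add hb.right, fun f f' hf hf' hff' y hy => ?_,
    fun y hy ξ ξ' h => ?_⟩
  · rw [applyOp_add, applyOp_add, ha.applyOp_eq f f' hf hf' hff' y hy,
      hb.applyOp_eq f f' hf hf' hff' y hy, mul_add]
  · rw [fiberPoly_congr (b := fun k I y => symbolTensor μ N a k I y + symbolTensor μ N b k I y)
        (fun k I => symbolTensor_add hU ha.left hb.left μ k I hy) ξ,
      fiberPoly_congr (b := fun k I y => symbolTensor μ N a' k I y + symbolTensor μ N b' k I y)
        (fun k I => symbolTensor_add hV ha.right hb.right μ k I (hψV y hy)) ξ',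
      fiberPoly_add, fiberPoly_add, ha.fiberPoly_eq y hy ξ ξ' h, hb.fiberPoly_eq y hy ξ ξ' h]

lemma exists_correspondOn_sum {ι : Type*} (hU : IsOpen U) (hV : IsOpen V) (hψV : ∀ y ∈ U, ψ y ∈ V)
    (s : Finset ι) (F : ι → TensorFamily 𝕜 n)
    (hF : ∀ i ∈ s, ∃ a, CorrespondOn U V ψ κ μ N a (F i)) :
    ∃ a, CorrespondOn U V ψ κ μ N a (fun k I y => ∑ i ∈ s, F i k I y) := by
  classical
  induction s using Finset.induction_on with
  | empty => exact ⟨_, by simpa using CorrespondOn.zero⟩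
  | insert i s hi ih =>
    obtain ⟨a, ha⟩ := hF i (mem_insert_self i s)
    obtain ⟨b, hb⟩ := ih fun j hj => hF j (mem_insert_of_mem hj)
    simp only [sum_insert hi]
    exact ⟨_, ha.add hU hV hψV hb⟩

lemma CorrespondOn.congr_right (hV : IsOpen V) (hψV : ∀ y ∈ U, ψ y ∈ V)
    {a a' b' : TensorFamily 𝕜 n} (ha : CorrespondOn U V ψ κ μ N a a')
    (h : ∀ k (I : Fin k → Fin n), ∀ y ∈ V, b' k I y = a' k I y) :
    CorrespondOn U V ψ κ μ N a b' := by
  refine ⟨ha.left, ⟨fun k I => (ha.right.smooth k I).congr fun y hy => h k I y hy,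
    fun k I π y hy => ?_, fun k hk I y hy => ?_⟩, fun f f' hf hf' hff' y hy => ?_,
    fun y hy ξ ξ' hξ => ?_⟩
  · rw [h k _ y hy, h k _ y hy, ha.right.symm k I π y hy]
  · rw [h k _ y hy, ha.right.degree_le k hk I y hy]
  · rw [ha.applyOp_eq f f' hf hf' hff' y hy]
    simp only [applyOp, h _ _ _ (hψV y hy)]
  · rw [ha.fiberPoly_eq y hy ξ ξ' hξ]
    exact (fiberPoly_congr (fun k I => symbolTensor_congr hV μ
      (fun k' _ _ J x hx => h k' J x hx) I (hψV y hy)) ξ').symm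

lemma applyOp_powFamily (Λ : 𝕜) (k : ℕ) (q : E n → ℝ) (h : E n → 𝕜) (u : E n) (b : ℝ)
    (f : E n → 𝕜) (y : E n) :
    applyOp k (powFamily Λ k q h u b) f y = (q y : 𝕜) ^ k * h y *
      ∑ r ∈ range (k + 1), opCoeff Λ k r * (b : 𝕜) ^ (k - r) *
        iteratedFDeriv ℝ r f y (fun _ => u + b • y) := by
  rw [applyOp, mul_sum]
  refine sum_congr rfl fun r _ => ?_
  rw [multilinear_diag_eq_sum, mul_sum, mul_sum]
  exact sum_congr rfl fun I _ => by simp only [powFamily]; ring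

lemma opCoeff_self (Λ : 𝕜) (k : ℕ) : opCoeff Λ k k = 1 := by simp [opCoeff]

lemma opCoeff_mul_zero_pow (Λ : 𝕜) (k r : ℕ) :
    opCoeff Λ k r * ((0 : ℝ) : 𝕜) ^ (k - r) = if k = r then 1 else 0 := by
  rcases lt_trichotomy k r with h | rfl | h
  · simp [opCoeff_of_lt Λ h, h.ne]
  · simp [opCoeff_self]
  · simp [h.ne', Nat.sub_ne_zero_of_lt h]

variable {g : Matrix.GeneralLinearGroup (Fin (n + 1)) ℝ}

/-- Operators of the form `h v^{i₁} ⋯ v^{i_k} ∂_{i₁} ⋯ ∂_{i_k}` under a linear-fractional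
transformation. -/
theorem exists_correspondOn_pow (hU : IsOpen U) (hV : IsOpen V) (hψ : IsLinearFractionalOn g U ψ)
    (hψV : ∀ y ∈ U, ψ y ∈ V) (hκ : ∀ y ∈ U, κ y = absPow (jacobian ψ y).det μ)
    {k : ℕ} (hk : k ≤ N) {h : E n → 𝕜} (hh : ContDiffOn ℝ ∞ h V) (v : E n) :
    ∃ a, CorrespondOn U V ψ κ μ N a (powFamily (((n : 𝕜) + 1) * μ) k (fun _ => 1) h v 0) := by
  obtain ⟨u, b, hub⟩ := exists_homogLinear_eq g v
  set q : E n → ℝ := fun y => homogImage g y 0 with hq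
  set Λ := ((n : 𝕜) + 1) * μ with hΛ
  have hqs : ContDiffOn ℝ ∞ q U := (contDiff_homogImage g 0).contDiffOn
  have hψs := hψ.contDiffOn
  have hq0 : ∀ y ∈ U, q y ≠ 0 := fun y hy => (hψ y hy).1
  have hb0 : ∀ y, homogLinear g 0 (u + b • y) = b * q y := fun y => by simp [hub, hq]
  have hbs : ∀ y (i : Fin n), homogLinear g i.succ (u + b • y) =
      v i + b * homogImage g y i.succ := fun y i => by simp [hub]
  have hqw : ∀ y ∈ U, fderiv ℝ q y (u + b • y) = b * q y := fun y hy => by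
    rw [(hasFDerivAt_homogImage g 0 y).fderiv, hb0]
  have hψw : ∀ y ∈ U, fderiv ℝ ψ y (u + b • y) = (q y)⁻¹ • v := by
    intro y hy
    ext i
    rw [hψ.fderiv_apply hU hy, hbs, hb0, (hψ y hy).2 i]
    have := hq0 y hy
    simp only [hq] at this ⊢
    simp only [PiLp.smul_apply, smul_eq_mul]
    field_simp
    ring
  have hone : ContDiffOn ℝ ∞ (fun _ : E n => (1 : ℝ)) V := contDiffOn_const
  have hleft := isSymmetricOn_powFamily Λ k u b hqs (hh.comp hψs hψV)
  have hright := isSymmetricOn_powFamily Λ k v 0 hone hh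
  refine ⟨powFamily Λ k q (h ∘ ψ) u b, hleft.mono hk, hright.mono hk,
    fun f f' hf hf' hff' y hy => ?_, fun y hy ξ ξ' hξ => ?_⟩
  · rw [applyOp_mono hleft hk f hy, applyOp_mono hright hk f' (hψV y hy), applyOp_powFamily,
      applyOp_powFamily]
    have hqy := hq0 y hy
    have hqline : ∀ τ : ℝ, q (y + τ • (q y • (u + b • y))) = q y * (1 + τ * (b * q y)) := by
      intro τ
      simp only [hq]
      rw [smul_smul, homogImage_add_smul, hb0]
      ring
    -- The source of the Möbius parameter: `q` is affine along the line, and with `τ = s / (1 - b q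
    -- s)` one has `1 + b q τ = 1 / (1 - b q s)`.
    have hline : ∀ s : ℝ, 1 - b * q y * s ≠ 0 →
        q (y + (s / (1 - b * q y * s)) • (q y • (u + b • y))) = q y / (1 - b * q y * s) := by
      intro s hs
      rw [hqline]
      obtain ⟨D, hD⟩ : ∃ D, D = 1 - b * q y * s := ⟨_, rfl⟩
      rw [← hD] at hs ⊢
      field_simp
      rw [hD]
      ring
    have key := iteratedFDeriv_projective (𝕜 := 𝕜) hU hV (ψ := ψ) (κ := κ) hf hf' hy (hψV y hy)
      (z := q y • (u + b • y)) (v := v) (c := b * q y) (Λ := Λ) ?_ ?_ hff' k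
    · have e1 : ∑ r ∈ range (k + 1), opCoeff Λ k r * ((0 : ℝ) : 𝕜) ^ (k - r) *
          iteratedFDeriv ℝ r f' (ψ y) (fun _ => v + (0 : ℝ) • ψ y) =
          iteratedFDeriv ℝ k f' (ψ y) (fun _ => v) := by
        rw [sum_eq_single k]
        · rw [opCoeff_mul_zero_pow, if_pos rfl, one_mul, zero_smul, add_zero]
        · intro r _ hr
          rw [opCoeff_mul_zero_pow, if_neg (Ne.symm hr), zero_mul]
        · simp
      rw [e1, RCLike.ofReal_one, one_pow, one_mul, mul_left_comm, key, mul_right_comm,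
        mul_comm _ ((h ∘ ψ) y), Function.comp_apply]
      congr 1
      rw [mul_sum]
      refine sum_congr rfl fun r hr => ?_
      rw [mem_range] at hr
      rw [(iteratedFDeriv ℝ r f y).map_smul_univ (fun _ => q y) (fun _ => u + b • y)]
      rw [prod_const, card_univ, Fintype.card_fin, RCLike.real_smul_eq_coe_mul,
        show (q y : 𝕜) ^ k = (q y : 𝕜) ^ (k - r) * (q y : 𝕜) ^ r by
          rw [← pow_add]; congr 1; omega]
      push_cast
      ring
    · intro s hs hsU
      ext i
      rw [(hψ _ hsU).2 i]
      have hl := hline s hs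
      simp only [hq] at hl
      rw [hl, smul_smul, homogImage_add_smul, hbs]
      simp only [PiLp.add_apply, PiLp.smul_apply, smul_eq_mul]
      rw [(hψ y hy).2 i]
      have hqy' : homogImage g y 0 ≠ 0 := hqy
      obtain ⟨D, hD⟩ : ∃ D, D = 1 - b * q y * s := ⟨_, rfl⟩
      rw [← hD] at hs ⊢
      simp only [hq] at hD ⊢
      field_simp
      rw [hD]
      ring
    · intro s hs hsU
      -- The Jacobian determinant is `det g / q ^ (n + 1)`, so along the line it acquires the factor
      -- `(1 - b q s) ^ (n + 1)`; this is where `Λ = (n + 1) μ` comes from.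
      have hd : (g : Matrix (Fin (n + 1)) (Fin (n + 1)) ℝ).det ≠ 0 :=
        (g.isUnit.map Matrix.detMonoidHom).ne_zero
      rw [hκ _ hsU, hκ y hy, hψ.det_jacobian hU hsU, hψ.det_jacobian hU hy]
      have hl := hline s hs
      simp only [hq] at hl
      rw [hl, div_pow, div_div_eq_mul_div, mul_div_right_comm,
        absPow_mul (div_ne_zero hd (pow_ne_zero _ hqy)) (pow_ne_zero _ hs), absPow_pow, hΛ]
      push_cast
      rfl
  · have h1 := fiberPoly_symbolTensor_powFamily hU hV hqs hψs hψV hh hq0 hqw hψw μ hk hy ξ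
    -- The original operator is itself of this kind, with the identity map, `q = 1` and `b = 0`.
    have h2 := fiberPoly_symbolTensor_powFamily (U := V) (V := V) (ψ := id) (u := v) (v := v)
      (b := 0) hV hV hone contDiffOn_id (fun _ hx => hx) hh (fun _ _ => one_ne_zero)
      (fun y _ => by simp) (fun y _ => by simp) μ hk (hψV y hy) ξ'
    rw [h1]
    refine Eq.trans ?_ h2.symm
    have e : q y * ∑ i, ξ i * (u + b • y) i = 1 * ∑ i, ξ' i * (v + (0 : ℝ) • ψ y) i := by
      rw [hξ, hψw y hy, zero_smul, add_zero, one_mul, mul_sum]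
      refine sum_congr rfl fun i _ => ?_
      have := hq0 y hy
      simp only [PiLp.smul_apply, smul_eq_mul]
      field_simp
    rw [e]
    rfl

/-- Every operator corresponds to an operator under a linear-fractional transformation. -/
theorem exists_correspondOn (hU : IsOpen U) (hV : IsOpen V) (hψ : IsLinearFractionalOn g U ψ)
    (hψV : ∀ y ∈ U, ψ y ∈ V) (hκ : ∀ y ∈ U, κ y = absPow (jacobian ψ y).det μ)
    {a' : TensorFamily 𝕜 n} (ha' : IsSymmetricOn N V a') :
    ∃ a, CorrespondOn U V ψ κ μ N a a' := by
  -- Polarization writes `a'` as a sum of powers of the constant vectors `polVec J T` with smooth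
  -- coefficients. With `b = 0` each `F k J T` is concentrated in degree `k`.
  set F : (k : ℕ) → (Fin k → Fin n) → Finset (Fin k) → TensorFamily 𝕜 n := fun k J T =>
    powFamily (((n : 𝕜) + 1) * μ) k (fun _ => 1)
      (fun y => (-1 : 𝕜) ^ T.card / (k.factorial : 𝕜) * a' k J y) (polVec J T) 0 with hF
  obtain ⟨a, ha⟩ := exists_correspondOn_sum hU hV hψV (range (N + 1))
    (fun k r I y => ∑ J, ∑ T, F k J T r I y) fun k hk =>
      exists_correspondOn_sum hU hV hψV univ (fun J r I y => ∑ T, F k J T r I y) fun J _ =>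
        exists_correspondOn_sum hU hV hψV univ (fun T r I y => F k J T r I y) fun T _ =>
          exists_correspondOn_pow hU hV hψ hψV hκ (by simpa [Nat.lt_succ_iff] using hk)
            (contDiffOn_const.mul (ha'.smooth k J)) (polVec J T)
  refine ⟨a, ha.congr_right hV hψV fun r I y hy => ?_⟩
  have hFne : ∀ k, k ≠ r → ∀ J T, F k J T r I y = 0 := fun k hk J T => by
    simp only [hF, powFamily, opCoeff_mul_zero_pow, if_neg hk, zero_mul]
  rcases lt_or_ge N r with hr | hr
  · rw [ha'.degree_le r hr I y hy, sum_eq_zero]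
    intro k hk
    rw [mem_range] at hk
    exact sum_eq_zero fun J _ => sum_eq_zero fun T _ => hFne k (by omega) J T
  · rw [sum_eq_single r]
    · rw [symm_eq_sum_polVec (a := fun I => a' r I y) (fun I π => ha'.symm r I π y hy) I]
      refine sum_congr rfl fun J _ => sum_congr rfl fun T _ => ?_
      simp [hF, powFamily, opCoeff_self]
    · intro k _ hk
      exact sum_eq_zero fun J _ => sum_eq_zero fun T _ => hFne k hk J T
    · intro h
      exact absurd (mem_range.2 (by omega)) h

end

/-! ### Projectively related charts -/

section

lemma sum_mul_jac {n : ℕ} {M : Type*} [TopologicalSpace M]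
    (c c' : OpenPartialHomeomorph M (E n)) (y : E n) (ξ' : Fin n → ℝ) (w : E n) :
    ∑ i, (∑ j, ξ' j * jac c c' y j i) * w i =
      ∑ j, ξ' j * (fderiv ℝ (transition c c') y w) j := by
  rw [sum_apply_mul_apply_stdVec (fderiv ℝ (transition c c') y) w]
  simp only [sum_mul, WithLp.ofLp_sum, Finset.sum_apply, mul_sum, PiLp.smul_apply, smul_eq_mul]
  rw [sum_comm]
  exact sum_congr rfl fun j _ => sum_congr rfl fun i _ => by
    simp only [jac, Matrix.of_apply]; ring

/-- The matrix `g` is available only near a given point, hence the small set `U`. It is chosen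
before the operator and serves all orders and all coefficients. -/
theorem ProjectivelyRelated.exists_correspondOn {𝕜 : Type*} [RCLike 𝕜] {n : ℕ} {M : Type*}
    [TopologicalSpace M] {c c' : OpenPartialHomeomorph M (E n)}
    (h : ProjectivelyRelated c c') {y : E n} (hy : y ∈ overlap c c') (μ : 𝕜) :
    ∃ U, IsOpen U ∧ y ∈ U ∧ U ⊆ overlap c c' ∧ ∀ (N : ℕ) (a' : TensorFamily 𝕜 n),
      IsSymmetricOn N c'.target a' → ∃ a, CorrespondOn U c'.target (transition c c')
        (fun y => absPow (jac c c' y).det μ) μ N a a' := by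
  obtain ⟨g, hg⟩ := h (c.symm y) ⟨c.map_target hy.1, hy.2⟩
  have hg' := (c.continuousAt_symm hy.1).eventually hg
  obtain ⟨U, hU, hUo, hyU⟩ := eventually_nhds_iff.1
    (hg'.and ((isOpen_overlap c c').mem_nhds hy))
  refine ⟨U, hUo, hyU, fun x hx => (hU x hx).2, fun N a' ha' => ?_⟩
  refine ProjectiveSymbol.exists_correspondOn (g := g) hUo c'.open_target (fun x hx => ?_)
    (fun x hx => c'.map_source (hU x hx).2.2) (fun x _ => rfl) ha'
  obtain ⟨⟨h1, h2⟩, h3⟩ := hU x hx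
  rw [c.right_inv h3.1] at h1 h2
  exact ⟨h1, h2⟩

variable {𝕜 : Type*} [RCLike 𝕜] {n : ℕ} {M : Type*} [TopologicalSpace M] [ChartedSpace (E n) M]
  {μ : 𝕜}

lemma fiberPoly_symbolTensor_mono {N N' : ℕ} {U : Set (E n)} {a : TensorFamily 𝕜 n}
    (hU : IsOpen U) (ha : IsSymmetricOn N U a) (hN : N ≤ N') (ξ : Fin n → ℝ) {y : E n}
    (hy : y ∈ U) :
    fiberPoly N' (symbolTensor μ N' a) y ξ = fiberPoly N (symbolTensor μ N a) y ξ := by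
  rw [fiberPoly_congr (fun k I => symbolTensor_mono hU ha hN μ I hy) ξ,
    fiberPoly_mono (ha.symbolTensor hU μ) hN ξ hy]

lemma exists_eq_sum_mul_jac {c c' : OpenPartialHomeomorph M (E n)} (hc : c ∈ smoothCharts n M)
    (hc' : c' ∈ smoothCharts n M) {y : E n} (hy : y ∈ overlap c c') (ξ : Fin n → ℝ) :
    ∃ ξ' : Fin n → ℝ, (fun i => ∑ j, ξ' j * jac c c' y j i) = ξ := by
  have h := coordCovector_surjective hc' (transition_mem_overlap hy).1
  rw [symm_transition hy] at h
  obtain ⟨ξ', h'⟩ := h (coordCovector c (c.symm y) ξ)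
  refine ⟨ξ', coordCovector_injective hc hy.1 ?_⟩
  rw [← coordCovector_transition hc hc' hy, h']

lemma HasFiberPoly.apply {c : OpenPartialHomeomorph M (E n)}
    {P : (x : M) → (TangentSpace (𝓡 n) x →L[ℝ] ℝ) → 𝕜} {N : ℕ} {b : TensorFamily 𝕜 n}
    (h : HasFiberPoly c P N b) {x : M} (hx : x ∈ c.source) (ξ : Fin n → ℝ) :
    P x (coordCovector c x ξ) = fiberPoly N b (c x) ξ := by
  have := h.apply_eq (c x) (c.map_source hx) ξ
  rwa [c.left_inv hx] at this

lemma exists_coordCovector_eq {c : OpenPartialHomeomorph M (E n)} (hc : c ∈ smoothCharts n M)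
    {x : M} (hx : x ∈ c.source) (η : TangentSpace (𝓡 n) x →L[ℝ] ℝ) :
    ∃ ξ, coordCovector c x ξ = η := by
  have h := coordCovector_surjective hc (c.map_source hx)
  rw [c.left_inv hx] at h
  exact h η

lemma polyFunctions_ext {P Q : (x : M) → (TangentSpace (𝓡 n) x →L[ℝ] ℝ) → 𝕜}
    (h : ∀ x, ∃ c ∈ smoothCharts n M, x ∈ c.source ∧ ∃ N b, HasFiberPoly c P N b ∧
      HasFiberPoly c Q N b) : P = Q := by
  funext x η
  obtain ⟨c, hc, hx, N, b, hP, hQ⟩ := h x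
  obtain ⟨ξ, rfl⟩ := exists_coordCovector_eq hc hx η
  rw [hP.apply hx, hQ.apply hx]

lemma HasFiberPoly.congr {c : OpenPartialHomeomorph M (E n)}
    {P : (x : M) → (TangentSpace (𝓡 n) x →L[ℝ] ℝ) → 𝕜} {N : ℕ} {b b' : TensorFamily 𝕜 n}
    (h : HasFiberPoly c P N b) (hb : ∀ k (I : Fin k → Fin n), ∀ y ∈ c.target, b' k I y = b k I y) :
    HasFiberPoly c P N b' := by
  refine ⟨⟨fun k I => (h.isSymmetricOn.smooth k I).congr (hb k I), fun k I π y hy => ?_,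
    fun k hk I y hy => ?_⟩, fun y hy ξ => ?_⟩
  · rw [hb k _ y hy, hb k _ y hy, h.isSymmetricOn.symm k I π y hy]
  · rw [hb k I y hy, h.isSymmetricOn.degree_le k hk I y hy]
  · rw [h.apply_eq y hy ξ, fiberPoly_congr (fun k I => hb k I y hy) ξ]

lemma HasFiberPoly.add {c : OpenPartialHomeomorph M (E n)}
    {P Q : (x : M) → (TangentSpace (𝓡 n) x →L[ℝ] ℝ) → 𝕜} {N : ℕ} {b b' : TensorFamily 𝕜 n}
    (h : HasFiberPoly c P N b) (h' : HasFiberPoly c Q N b') :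
    HasFiberPoly c (P + Q) N (fun k I y => b k I y + b' k I y) := by
  refine ⟨h.isSymmetricOn.add h'.isSymmetricOn, fun y hy ξ => ?_⟩
  rw [fiberPoly_add, ← h.apply_eq y hy ξ, ← h'.apply_eq y hy ξ]
  rfl

lemma HasFiberPoly.smul {c : OpenPartialHomeomorph M (E n)}
    {P : (x : M) → (TangentSpace (𝓡 n) x →L[ℝ] ℝ) → 𝕜} {N : ℕ} {b : TensorFamily 𝕜 n}
    (h : HasFiberPoly c P N b) (r : 𝕜) : HasFiberPoly c (r • P) N (fun k I y => r * b k I y) := by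
  refine ⟨h.isSymmetricOn.smul r, fun y hy ξ => ?_⟩
  rw [fiberPoly_smul, ← h.apply_eq y hy ξ]
  rfl

lemma HasLocalForm.mono {c : OpenPartialHomeomorph M (E n)} {A : Module.End 𝕜 (densities n M μ)}
    {N N' : ℕ} {a : TensorFamily 𝕜 n} (h : HasLocalForm c A N a) (hN : N ≤ N') :
    HasLocalForm c A N' a :=
  ⟨h.isSymmetricOn.mono hN, fun φ y hy => by
    rw [h.apply_eq φ y hy, applyOp_mono h.isSymmetricOn hN _ hy]⟩

lemma HasLocalForm.add {c : OpenPartialHomeomorph M (E n)} {A B : Module.End 𝕜 (densities n M μ)}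
    {N : ℕ} {a b : TensorFamily 𝕜 n} (h : HasLocalForm c A N a) (h' : HasLocalForm c B N b) :
    HasLocalForm c (A + B) N (fun k I y => a k I y + b k I y) := by
  refine ⟨h.isSymmetricOn.add h'.isSymmetricOn, fun φ y hy => ?_⟩
  rw [applyOp_add, ← h.apply_eq φ y hy, ← h'.apply_eq φ y hy]
  rfl

lemma HasLocalForm.smul {c : OpenPartialHomeomorph M (E n)} {A : Module.End 𝕜 (densities n M μ)}
    {N : ℕ} {a : TensorFamily 𝕜 n} (h : HasLocalForm c A N a) (r : 𝕜) :
    HasLocalForm c (r • A) N (fun k I y => r * a k I y) := by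
  refine ⟨h.isSymmetricOn.smul r, fun φ y hy => ?_⟩
  rw [applyOp_smul, ← h.apply_eq φ y hy]
  rfl

/-- Operators with the same symbol in projectively related charts agree. -/
theorem applyOp_transition {c c' : OpenPartialHomeomorph M (E n)}
    (hc : c ∈ smoothCharts n M) (hc' : c' ∈ smoothCharts n M) (h : ProjectivelyRelated c c')
    {P : (x : M) → (TangentSpace (𝓡 n) x →L[ℝ] ℝ) → 𝕜} {N : ℕ} {a a' : TensorFamily 𝕜 n}
    (has : IsSymmetricOn N c.target a) (has' : IsSymmetricOn N c'.target a')
    (ha : HasFiberPoly c P N (symbolTensor μ N a)) (ha' : HasFiberPoly c' P N (symbolTensor μ N a'))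
    (φ : densities n M μ) {y : E n} (hy : y ∈ overlap c c') :
    applyOp N a (localComponent c φ.1) y = absPow (jac c c' y).det μ *
      applyOp N a' (localComponent c' φ.1) (transition c c' y) := by
  obtain ⟨U, hUo, hyU, hU, hcor⟩ := h.exists_correspondOn hy μ
  -- Transporting `a'` to the chart `c` gives `b` with the same symbol as `a`; by triangularity `a =
  -- b` near the point.
  obtain ⟨b, hb⟩ := hcor N a' has'
  have hUc : U ⊆ c.target := fun x hx => (hU hx).1
  have hsym : ∀ l (I : Fin l → Fin n), ∀ x ∈ U,
      symbolTensor μ N a l I x = symbolTensor μ N b l I x := by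
    intro l I x hx
    refine coeff_eq_of_fiberPoly_eq (ha.isSymmetricOn.mono_set hUc)
      (hb.left.symbolTensor hUo μ) hx (fun ξ => ?_) l I
    obtain ⟨ξ', rfl⟩ := exists_eq_sum_mul_jac hc hc' (hU hx) ξ
    rw [hb.fiberPoly_eq x hx _ ξ' (sum_mul_jac c c' x ξ'), ← ha.apply_eq x (hUc hx),
      ← coordCovector_transition hc hc' (hU hx),
      ← ha'.apply_eq _ (transition_mem_overlap (hU hx)).1 ξ', symm_transition (hU hx)]
  have hab : ∀ k (I : Fin k → Fin n), a k I y = b k I y := fun k I =>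
    eq_of_symbolTensor_eq hUo μ (has.mono_set hUc) hb.left hsym k I hyU
  rw [← hb.applyOp_eq _ (localComponent c' φ.1) ((contDiffOn_localComponent φ hc).mono hUc)
      (contDiffOn_localComponent φ hc')
      (fun x hx => localComponent_transition φ.2 hc hc' (hU hx)) y hyU]
  simp only [applyOp, hab]

variable [IsManifold (𝓡 n) ∞ M] [T2Space M]

/-- The symbols of an operator in projectively related charts are the same. -/
theorem fiberPoly_symbolTensor_transition {c c' : OpenPartialHomeomorph M (E n)}
    (hc : c ∈ smoothCharts n M) (hc' : c' ∈ smoothCharts n M) (h : ProjectivelyRelated c c')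
    {A : Module.End 𝕜 (densities n M μ)} {N N' : ℕ} {a a' : TensorFamily 𝕜 n}
    (ha : HasLocalForm c A N a) (ha' : HasLocalForm c' A N' a') {y : E n} (hy : y ∈ overlap c c')
    (ξ' : Fin n → ℝ) :
    fiberPoly N (symbolTensor μ N a) y (fun i => ∑ j, ξ' j * jac c c' y j i) =
      fiberPoly N' (symbolTensor μ N' a') (transition c c' y) ξ' := by
  obtain ⟨U, hUo, hyU, hU, hcor⟩ := h.exists_correspondOn hy μ
  set K := max N N' with hK
  have hNK : N ≤ K := le_max_left _ _
  have hNK' : N' ≤ K := le_max_right _ _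
  have hyt : transition c c' y ∈ c'.target := (transition_mem_overlap hy).1
  obtain ⟨b, hb⟩ := hcor K a' (ha'.isSymmetricOn.mono hNK')
  have hUc : U ⊆ c.target := fun x hx => (hU hx).1
  -- The transported operator and `A` act alike on densities near the point, so their coefficients
  -- coincide.
  have hab : ∀ k (I : Fin k → Fin n), ∀ x ∈ U, b k I x = a k I x := by
    intro k I x hx
    refine coeff_eq_of_applyOp_eq (μ := μ) hc hUc hb.left
      ((ha.mono hNK).isSymmetricOn.mono_set hUc) (fun φ z hz => ?_) hx k I
    rw [hb.applyOp_eq _ (localComponent c' φ.1) ((contDiffOn_localComponent φ hc).mono hUc)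
      (contDiffOn_localComponent φ hc')
      (fun x hx => localComponent_transition φ.2 hc hc' (hU hx)) z hz,
      ← (ha.mono hNK).apply_eq φ z (hUc hz),
      ← (ha'.mono hNK').apply_eq φ _ (transition_mem_overlap (hU hz)).1,
      ← localComponent_transition (A φ).2 hc hc' (hU hz)]
  rw [← fiberPoly_symbolTensor_mono c.open_target ha.isSymmetricOn hNK _ hy.1,
    ← fiberPoly_symbolTensor_mono c'.open_target ha'.isSymmetricOn hNK' _ hyt,
    ← hb.fiberPoly_eq y hyU _ ξ' (sum_mul_jac c c' y ξ')]
  exact fiberPoly_congr (fun k I => symbolTensor_congr hUo μ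
    (fun k' _ _ J x hx => (hab k' J x hx).symm) I hyU) _

/-- The chain rule for the Jacobian determinants of coordinate changes. -/
lemma absPow_det_jac_trans (μ : 𝕜) {c c' c'' : OpenPartialHomeomorph M (E n)}
    (hc : c ∈ smoothCharts n M) (hc' : c' ∈ smoothCharts n M) (hc'' : c'' ∈ smoothCharts n M)
    {y : E n} (hy : y ∈ overlap c c') (hy' : y ∈ overlap c c'') :
    absPow (jac c c'' y).det μ = absPow (jac c c' y).det μ *
      absPow (jac c' c'' (transition c c' y)).det μ := by
  have hz : transition c c' y ∈ overlap c' c'' :=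
    ⟨(transition_mem_overlap hy).1, by
      change c'.symm (transition c c' y) ∈ c''.source
      rw [symm_transition hy]
      exact hy'.2⟩
  have ht : transition c' c'' (transition c c' y) = transition c c'' y := by
    change c'' (c'.symm (transition c c' y)) = c'' (c.symm y)
    rw [symm_transition hy]
  -- A density with component `1` near the point in `c''` has these factors as components in the
  -- other charts, so the multiplicativity can be read off from it.
  obtain ⟨φ, hφ⟩ := exists_density_eventuallyEq (𝕜 := 𝕜) (μ := μ) hc''
    (transition_mem_overlap hy').1 (f := fun _ => 1) contDiff_const
  have h1 := localComponent_transition φ.2 hc hc' hy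
  rw [localComponent_transition φ.2 hc' hc'' hz, localComponent_transition φ.2 hc hc'' hy', ht,
    hφ.eq_of_nhds, mul_one, mul_one] at h1
  exact h1

lemma contDiffOn_localComponent_ofLocal {C : M → OpenPartialHomeomorph M (E n)}
    (hC : ∀ x, C x ∈ smoothCharts n M) (hCx : ∀ x, x ∈ (C x).source) {f : M → 𝕜}
    (hf : ∀ x, ContDiffOn ℝ ∞ (localComponent (C x) (ofLocal μ C f)) (C x).target)
    {c : OpenPartialHomeomorph M (E n)} (hc : c ∈ smoothCharts n M) :
    ContDiffOn ℝ ∞ (localComponent c (ofLocal μ C f)) c.target := by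
  intro y hy
  set c' := C (c.symm y) with hc'
  have hy' : y ∈ overlap c c' := ⟨hy, hCx _⟩
  have h1 : ContDiffOn ℝ ∞ (fun z => absPow (jac c c' z).det μ *
      localComponent c' (ofLocal μ C f) (transition c c' z)) (overlap c c') :=
    (contDiffOn_absPow_det_jac μ hc (hC _)).mul ((hf (c.symm y)).comp
      (contDiffOn_transition hc (hC _)) fun z hz => (transition_mem_overlap hz).1)
  refine ((h1.contDiffAt ((isOpen_overlap c c').mem_nhds hy')).congr_of_eventuallyEq
    ?_).contDiffWithinAt
  filter_upwards [(isOpen_overlap c c').mem_nhds hy'] with z hz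
  have hzt := (transition_mem_overlap hz).1
  rw [localComponent_ofLocal hC f hc hz.1 (hCx _), localComponent_ofLocal hC f (hC _) hzt (hCx _),
    symm_transition hz, absPow_det_jac_trans μ hc (hC _) (hC (c.symm z)) hz ⟨hz.1, hCx _⟩]
  ring

end

/-! ### The symbol map -/

section

variable {𝕜 : Type*} [RCLike 𝕜] {n : ℕ} {M : Type*} [TopologicalSpace M] [ChartedSpace (E n) M]
  {μ : 𝕜} (𝒜 : ProjectiveAtlas n M)

/-- A chart of a projective atlas at the point `x`. -/
def ProjectiveAtlas.chart (x : M) : OpenPartialHomeomorph M (E n) := (𝒜.cover x).choose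

lemma ProjectiveAtlas.chart_mem (x : M) : 𝒜.chart x ∈ 𝒜.charts := (𝒜.cover x).choose_spec.1

lemma ProjectiveAtlas.chart_mem_smoothCharts (x : M) : 𝒜.chart x ∈ smoothCharts n M :=
  𝒜.smooth (𝒜.chart_mem x)

lemma ProjectiveAtlas.mem_chart_source (x : M) : x ∈ (𝒜.chart x).source :=
  (𝒜.cover x).choose_spec.2

lemma ProjectiveAtlas.equivalent_refl : 𝒜.Equivalent 𝒜 := fun c hc c' hc' =>
  ⟨𝒜.related c hc c' hc', 𝒜.related c' hc' c hc⟩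

/-- The order of a differential operator. -/
def diffOpOrder (A : diffOps n M μ) : ℕ := A.2.choose

/-- The coefficients of a differential operator in a chart. -/
def diffOpCoeff (A : diffOps n M μ) {c : OpenPartialHomeomorph M (E n)} (hc : c ∈ smoothCharts n M) :
    TensorFamily 𝕜 n := (A.2.choose_spec c hc).choose

lemma hasLocalForm_diffOpCoeff (A : diffOps n M μ) {c : OpenPartialHomeomorph M (E n)}
    (hc : c ∈ smoothCharts n M) : HasLocalForm c A.1 (diffOpOrder A) (diffOpCoeff A hc) :=
  (A.2.choose_spec c hc).choose_spec

/-- The symbol of a differential operator, computed in charts of a projective atlas. -/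
def symbolFun (A : diffOps n M μ) (x : M) (η : TangentSpace (𝓡 n) x →L[ℝ] ℝ) : 𝕜 :=
  fiberPoly (diffOpOrder A) (symbolTensor μ (diffOpOrder A)
    (diffOpCoeff A (𝒜.chart_mem_smoothCharts x))) (𝒜.chart x x)
    (exists_coordCovector_eq (𝒜.chart_mem_smoothCharts x) (𝒜.mem_chart_source x) η).choose

/-- Every covector lies over a chart of `𝒜`, where the formula fixes the value; linearity plays no
role. -/
theorem IsGivenBySymbolFormula.unique {σ τ : diffOps n M μ → polyFunctions 𝕜 n M}
    (hσ : IsGivenBySymbolFormula 𝒜 σ) (hτ : IsGivenBySymbolFormula 𝒜 τ) : τ = σ := by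
  funext A
  refine Subtype.ext (polyFunctions_ext fun x => ⟨𝒜.chart x, 𝒜.chart_mem_smoothCharts x,
    𝒜.mem_chart_source x, ?_⟩)
  have ha := hasLocalForm_diffOpCoeff A (𝒜.chart_mem_smoothCharts x)
  exact ⟨_, _, hτ 𝒜 𝒜.equivalent_refl _ (𝒜.chart_mem x) A _ _ ha,
    hσ 𝒜 𝒜.equivalent_refl _ (𝒜.chart_mem x) A _ _ ha⟩

variable [IsManifold (𝓡 n) ∞ M] [T2Space M]

/-- The choices in `symbolFun` are immaterial, by the invariance of the symbol. The chart need not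
belong to `𝒜`, so charts of all equivalent atlases are covered. -/
theorem hasFiberPoly_symbolFun {c : OpenPartialHomeomorph M (E n)} (hc : c ∈ smoothCharts n M)
    (hrel : ∀ c' ∈ 𝒜.charts, ProjectivelyRelated c c') (A : diffOps n M μ) {N : ℕ}
    {a : TensorFamily 𝕜 n} (ha : HasLocalForm c A.1 N a) :
    HasFiberPoly c (symbolFun 𝒜 A) N (symbolTensor μ N a) := by
  refine ⟨ha.isSymmetricOn.symbolTensor c.open_target μ, fun y hy ξ => ?_⟩
  set x := c.symm y with hx
  have hc' := 𝒜.chart_mem_smoothCharts x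
  have hyo : y ∈ overlap c (𝒜.chart x) := ⟨hy, 𝒜.mem_chart_source x⟩
  have hspec := (exists_coordCovector_eq hc' (𝒜.mem_chart_source x)
    (coordCovector c x ξ)).choose_spec
  rw [symbolFun]
  set ξ' := (exists_coordCovector_eq hc' (𝒜.mem_chart_source x) (coordCovector c x ξ)).choose
  have h1 : (fun i => ∑ j, ξ' j * jac c (𝒜.chart x) y j i) = ξ :=
    coordCovector_injective hc hy ((coordCovector_transition hc hc' hyo ξ').symm.trans hspec)
  rw [← h1]
  exact (fiberPoly_symbolTensor_transition hc hc' (hrel _ (𝒜.chart_mem x)) ha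
    (hasLocalForm_diffOpCoeff A hc') hyo ξ').symm

lemma hasFiberPoly_symbolFun_chart (A : diffOps n M μ) (x : M) {N : ℕ} {a : TensorFamily 𝕜 n}
    (ha : HasLocalForm (𝒜.chart x) A.1 N a) :
    HasFiberPoly (𝒜.chart x) (symbolFun 𝒜 A) N (symbolTensor μ N a) :=
  hasFiberPoly_symbolFun 𝒜 (𝒜.chart_mem_smoothCharts x)
    (fun c' hc' => 𝒜.related _ (𝒜.chart_mem x) c' hc') A ha

lemma symbolFun_mem (A : diffOps n M μ) : symbolFun 𝒜 A ∈ polyFunctions 𝕜 n M :=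
  ⟨diffOpOrder A, fun _ hc => exists_hasFiberPoly (fun x => ⟨𝒜.chart x,
    𝒜.chart_mem_smoothCharts x, 𝒜.mem_chart_source x, _, hasFiberPoly_symbolFun_chart 𝒜 A x
      (hasLocalForm_diffOpCoeff A (𝒜.chart_mem_smoothCharts x))⟩) hc⟩

/-- The symbol map of a projective structure. -/
def symbolMap : diffOps n M μ →ₗ[𝕜] polyFunctions 𝕜 n M where
  toFun A := ⟨symbolFun 𝒜 A, symbolFun_mem 𝒜 A⟩
  map_add' A B := by
    refine Subtype.ext (polyFunctions_ext fun x => ⟨𝒜.chart x, 𝒜.chart_mem_smoothCharts x,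
      𝒜.mem_chart_source x, ?_⟩)
    have hc := 𝒜.chart_mem_smoothCharts x
    have ha := (hasLocalForm_diffOpCoeff A hc).mono (le_max_left _ (diffOpOrder B))
    have hb := (hasLocalForm_diffOpCoeff B hc).mono (le_max_right (diffOpOrder A) _)
    refine ⟨_, _, hasFiberPoly_symbolFun_chart 𝒜 (A + B) x (ha.add hb), ?_⟩
    exact ((hasFiberPoly_symbolFun_chart 𝒜 A x ha).add
      (hasFiberPoly_symbolFun_chart 𝒜 B x hb)).congr fun k I y hy =>
        symbolTensor_add (𝒜.chart x).open_target ha.isSymmetricOn hb.isSymmetricOn μ k I hy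
  map_smul' r A := by
    refine Subtype.ext (polyFunctions_ext fun x => ⟨𝒜.chart x, 𝒜.chart_mem_smoothCharts x,
      𝒜.mem_chart_source x, ?_⟩)
    have hc := 𝒜.chart_mem_smoothCharts x
    have ha := hasLocalForm_diffOpCoeff A hc
    refine ⟨_, _, hasFiberPoly_symbolFun_chart 𝒜 (r • A) x (ha.smul r), ?_⟩
    exact ((hasFiberPoly_symbolFun_chart 𝒜 A x ha).smul r).congr fun k I y hy =>
      symbolTensor_smul (𝒜.chart x).open_target ha.isSymmetricOn μ r k I hy

theorem isGivenBySymbolFormula_symbolMap :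
    IsGivenBySymbolFormula 𝒜 (symbolMap 𝒜 : diffOps n M μ →ₗ[𝕜] polyFunctions 𝕜 n M) :=
  fun ℬ hℬ c hc A _ _ ha => hasFiberPoly_symbolFun 𝒜 (ℬ.smooth hc)
    (fun c' hc' => (hℬ c' hc' c hc).2) A ha

theorem injective_symbolMap :
    Function.Injective (symbolMap 𝒜 : diffOps n M μ →ₗ[𝕜] polyFunctions 𝕜 n M) := by
  intro A B hAB
  have hAB' : symbolFun 𝒜 A = symbolFun 𝒜 B := congrArg Subtype.val hAB
  refine Subtype.ext (LinearMap.ext fun φ => Subtype.ext ?_)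
  refine density_eq_of_localComponent_eq (A.1 φ).2 (B.1 φ).2 fun x =>
    ⟨𝒜.chart x, 𝒜.chart_mem_smoothCharts x, 𝒜.mem_chart_source x, ?_⟩
  have hc := 𝒜.chart_mem_smoothCharts x
  have hcx := (𝒜.chart x).map_source (𝒜.mem_chart_source x)
  have ha := (hasLocalForm_diffOpCoeff A hc).mono (le_max_left _ (diffOpOrder B))
  have hb := (hasLocalForm_diffOpCoeff B hc).mono (le_max_right (diffOpOrder A) _)
  have hsa := hasFiberPoly_symbolFun_chart 𝒜 A x ha
  have hsb := hasFiberPoly_symbolFun_chart 𝒜 B x hb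
  rw [ha.apply_eq φ _ hcx, hb.apply_eq φ _ hcx]
  have hcoef := fun l (I : Fin l → Fin n) =>
    eq_of_symbolTensor_eq (𝒜.chart x).open_target μ ha.isSymmetricOn hb.isSymmetricOn
      (fun l I y hy => coeff_eq_of_fiberPoly_eq hsa.isSymmetricOn hsb.isSymmetricOn hy
        (fun ξ => by rw [← hsa.apply_eq y hy ξ, ← hsb.apply_eq y hy ξ, hAB']) l I) l I hcx
  simp only [applyOp, hcoef]

/-- The formula is inverted in a projective chart around each point. The local operators have the
common symbol `P`, so they agree on overlaps and define one operator on densities; since it depends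
on `N`-jets only, it is a differential operator in all smooth charts. -/
theorem surjective_symbolMap :
    Function.Surjective (symbolMap 𝒜 : diffOps n M μ →ₗ[𝕜] polyFunctions 𝕜 n M) := by
  rintro ⟨P, N, hP⟩
  have hex : ∀ x, ∃ a : TensorFamily 𝕜 n, IsSymmetricOn N (𝒜.chart x).target a ∧
      HasFiberPoly (𝒜.chart x) P N (symbolTensor μ N a) := by
    intro x
    obtain ⟨b, hb⟩ := hP _ (𝒜.chart_mem_smoothCharts x)
    obtain ⟨a, ha, hab⟩ := exists_symbolTensor_eq (𝒜.chart x).open_target μ hb.isSymmetricOn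
    exact ⟨a, ha, hb.congr hab⟩
  choose a ha haP using hex
  set C := 𝒜.chart with hC
  have hCs : ∀ x, C x ∈ smoothCharts n M := 𝒜.chart_mem_smoothCharts
  have hCx : ∀ x, x ∈ (C x).source := 𝒜.mem_chart_source
  set F : densities n M μ → (x : M) → (Fin n → TangentSpace (𝓡 n) x) → 𝕜 := fun φ =>
    ofLocal μ C (fun x => applyOp N (a x) (localComponent (C x) φ.1) (C x x)) with hF
  have hFloc : ∀ φ x, ∀ y ∈ (C x).target, localComponent (C x) (F φ) y =
      applyOp N (a x) (localComponent (C x) φ.1) y := by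
    intro φ x y hy
    rw [localComponent_ofLocal hCs _ (hCs x) hy (hCx _)]
    exact (applyOp_transition (hCs x) (hCs _)
      (𝒜.related _ (𝒜.chart_mem x) _ (𝒜.chart_mem _)) (ha x) (ha _) (haP x) (haP _) φ
      ⟨hy, hCx _⟩).symm
  have hFmem : ∀ φ, F φ ∈ densities n M μ := fun φ =>
    ofLocal_mem hCs (fun x _ => hCx x) fun c hc => contDiffOn_localComponent_ofLocal hCs hCx
      (fun x => (contDiffOn_applyOp (C x).open_target (ha x).smooth
        (contDiffOn_localComponent φ (hCs x))).congr fun y hy => hFloc φ x y hy) hc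
  let A : Module.End 𝕜 (densities n M μ) :=
    { toFun := fun φ => ⟨F φ, hFmem φ⟩
      map_add' := fun φ φ' => by
        refine Subtype.ext (density_eq_of_localComponent_eq (hFmem _)
          (⟨F φ, hFmem φ⟩ + ⟨F φ', hFmem φ'⟩ : densities n M μ).2 fun x =>
          ⟨C x, hCs x, hCx x, ?_⟩)
        have hx := (C x).map_source (hCx x)
        change _ = localComponent (C x) (F φ) (C x x) + localComponent (C x) (F φ') (C x x)
        refine (hFloc _ x _ hx).trans ?_
        rw [hFloc φ x _ hx, hFloc φ' x _ hx]
        exact applyOp_add_right (C x).open_target (contDiffOn_localComponent φ (hCs x))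
          (contDiffOn_localComponent φ' (hCs x)) hx
      map_smul' := fun r φ => by
        refine Subtype.ext (density_eq_of_localComponent_eq (hFmem _)
          (r • ⟨F φ, hFmem φ⟩ : densities n M μ).2 fun x => ⟨C x, hCs x, hCx x, ?_⟩)
        have hx := (C x).map_source (hCx x)
        change _ = r * localComponent (C x) (F φ) (C x x)
        refine (hFloc _ x _ hx).trans ?_
        rw [hFloc φ x _ hx]
        exact applyOp_const_mul_right (C x).open_target
          (contDiffOn_localComponent φ (hCs x)) hx r }
  have hAloc : ∀ x, HasLocalForm (C x) A N (a x) := fun x => ⟨ha x, fun φ y hy => hFloc φ x y hy⟩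
  have hA : A ∈ diffOps n M μ := ⟨N, fun c hc => exists_hasLocalForm (fun x =>
    ⟨C x, hCs x, hCx x, fun φ hφ => by
      rw [(hAloc x).apply_eq φ _ ((C x).map_source (hCx x))]
      exact applyOp_eq_zero hφ⟩) hc⟩
  exact ⟨⟨A, hA⟩, Subtype.ext (polyFunctions_ext fun x => ⟨C x, hCs x, hCx x, N, _,
    hasFiberPoly_symbolFun_chart 𝒜 ⟨A, hA⟩ x (hAloc x), haP x⟩)⟩

/-- The formula need not hold in `c`, so at each point the comparison passes through a projective
chart. There the terms of degree `N` of symbol and operator coincide, and these terms transform in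
the same way. -/
theorem exists_hasFiberPoly_symbolFun {c : OpenPartialHomeomorph M (E n)}
    (hc : c ∈ smoothCharts n M) (A : diffOps n M μ) {N : ℕ} {a : TensorFamily 𝕜 n}
    (ha : HasLocalForm c A.1 N a) : ∃ b : TensorFamily 𝕜 n, HasFiberPoly c (symbolFun 𝒜 A) N b ∧
      ∀ I : Fin N → Fin n, ∀ y ∈ c.target, b N I y = a N I y := by
  obtain ⟨N₀, hN₀⟩ := symbolFun_mem 𝒜 A
  obtain ⟨b, hb⟩ := hN₀ c hc
  set K := max N N₀ with hK
  have hNK : N ≤ K := le_max_left _ _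
  have hN₀K : N₀ ≤ K := le_max_right _ _
  have hbK := hb.isSymmetricOn.mono hN₀K
  have key : ∀ y ∈ c.target, (∀ k, N < k → ∀ I : Fin k → Fin n, b k I y = 0) ∧
      ∀ I : Fin N → Fin n, b N I y = a N I y := by
    intro y hy
    set c' := 𝒜.chart (c.symm y) with hc'
    have hc's : c' ∈ smoothCharts n M := 𝒜.chart_mem_smoothCharts _
    have hyo : y ∈ overlap c c' := ⟨hy, 𝒜.mem_chart_source _⟩
    have hto := transition_mem_overlap hyo
    set z := transition c c' y with hz
    set a' := diffOpCoeff A hc's with ha'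
    have hla : HasLocalForm c' A.1 (max K (diffOpOrder A)) a' :=
      (hasLocalForm_diffOpCoeff A hc's).mono (le_max_right _ _)
    set N' := max K (diffOpOrder A) with hN'
    have hKN' : K ≤ N' := le_max_left _ _
    have hsymb := hasFiberPoly_symbolFun_chart 𝒜 A (c.symm y) hla
    have hO := isOpen_overlap c' c
    -- The order bound `N` is known in `c` only; it carries over to `c'` on the overlap.
    have ha's : IsSymmetricOn N (overlap c' c) a' := by
      have h1 := hla.isSymmetricOn.mono_set (fun _ hx => hx.1 : overlap c' c ⊆ c'.target)
      refine ⟨h1.smooth, h1.symm, fun k hk I w hw => ?_⟩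
      have := coeff_eq_zero_of_transition hc hc's ha hla (transition_mem_overlap hw) hk I
      rwa [transition_transition hw] at this
    have hss := ha's.symbolTensor hO μ
    have hfib : ∀ ξ' : Fin n → ℝ, fiberPoly K b y (fun i => ∑ j, ξ' j * jac c c' y j i) =
        fiberPoly K (symbolTensor μ N a') z ξ' := by
      intro ξ'
      rw [fiberPoly_mono hb.isSymmetricOn hN₀K _ hy, ← hb.apply_eq y hy,
        ← coordCovector_transition hc hc's hyo, fiberPoly_mono hss hNK _ hto,
        ← fiberPoly_symbolTensor_mono hO ha's (hNK.trans hKN') ξ' hto,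
        ← hsymb.apply_eq z hto.1 ξ', symm_transition hyo]
    have hhom : ∀ k ≤ K, ∀ ξ' : Fin n → ℝ,
        homPoly b k y (fun i => ∑ j, ξ' j * jac c c' y j i) =
          homPoly (symbolTensor μ N a') k z ξ' := by
      intro k hk ξ'
      refine homPoly_eq_of_fiberPoly_eq (fun t => ?_) hk
      rw [← hfib]
      congr 1
      funext i
      simp only [Pi.smul_apply, smul_eq_mul, mul_sum, mul_assoc]
    constructor
    · intro k hk I
      rcases lt_or_ge K k with hKk | hKk
      · exact hbK.degree_le k hKk I y hy
      · refine symm_ext (a := fun I => b k I y) (b := fun _ => 0)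
          (fun I π => hb.isSymmetricOn.symm k I π y hy) (fun _ _ => rfl) (fun ξ => ?_) I
        obtain ⟨ξ', rfl⟩ := exists_eq_sum_mul_jac hc hc's hyo ξ
        refine (hhom k hKk ξ').trans ?_
        simp [homPoly, hss.degree_le k hk _ z hto]
    · intro I
      refine symm_ext (a := fun I => b N I y) (b := fun I => a N I y)
        (fun I π => hb.isSymmetricOn.symm N I π y hy)
        (fun I π => ha.isSymmetricOn.symm N I π y hy) (fun ξ => ?_) I
      obtain ⟨ξ', rfl⟩ := exists_eq_sum_mul_jac hc hc's hyo ξ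
      refine (hhom N hNK ξ').trans (Eq.trans ?_
        (homPoly_transition hc hc's ha hla hyo (hNK.trans hKN') le_rfl
          (fun k hk _ J => ha's.degree_le k hk J z hto) ξ'))
      refine sum_congr rfl fun J _ => ?_
      -- In the top degree `N` there are no divergence corrections.
      rw [symbolTensor_eq_add μ le_rfl]
      simp [hz]
  have hbN : IsSymmetricOn N c.target b :=
    ⟨hb.isSymmetricOn.smooth, hb.isSymmetricOn.symm, fun k hk I y hy => (key y hy).1 k hk I⟩
  refine ⟨b, ⟨hbN, fun y hy ξ => ?_⟩, fun I y hy => (key y hy).2 I⟩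
  rw [hb.apply_eq y hy ξ, ← fiberPoly_mono hb.isSymmetricOn hN₀K _ hy, fiberPoly_mono hbN hNK _ hy]

theorem isSymbolMap_symbolMap :
    IsSymbolMap (symbolMap 𝒜 : diffOps n M μ →ₗ[𝕜] polyFunctions 𝕜 n M) :=
  ⟨⟨injective_symbolMap 𝒜, surjective_symbolMap 𝒜⟩,
    fun _ hc A _ _ ha => exists_hasFiberPoly_symbolFun 𝒜 hc A ha⟩

end

end ProjectiveSymbol

end

open ProjectiveSymbol in
theorem corollary8p1 {𝕜 : Type*} [RCLike 𝕜] (n : ℕ) {M : Type*} [TopologicalSpace M] [T2Space M]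
    [ChartedSpace (EuclideanSpace ℝ (Fin n)) M] [IsManifold (𝓡 n) ∞ M]
    (𝒜 : ProjectiveAtlas n M) (μ : 𝕜) :
    ∃ σ : diffOps n M μ →ₗ[𝕜] polyFunctions 𝕜 n M,
      IsSymbolMap σ ∧ IsGivenBySymbolFormula 𝒜 σ ∧
      ∀ τ : diffOps n M μ → polyFunctions 𝕜 n M, IsGivenBySymbolFormula 𝒜 τ → τ = σ :=
  ⟨symbolMap 𝒜, isSymbolMap_symbolMap 𝒜, isGivenBySymbolFormula_symbolMap 𝒜,
    fun _ hτ => (isGivenBySymbolFormula_symbolMap 𝒜).unique 𝒜 hτ⟩
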